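/- **Setting.** Let $d\ge 1$, $\alpha,\beta,M>0$, $C_1<C_2$. Fix an integer $S>\max(\alpha,\beta)$ and a compactly supported orthonormal wavelet basis $\{\Phi_{J_0 m},\Psi^{\iota}_{lm}\}$ ($l\ge J_0$, $\iota\in\{0,1\}^d\setminus\{0\}$, $m\in\{0,\dots,2^l-1\}^d$) of $L^2([0,1]^d)$ of Cohen–Daubechies–Vial type and regularity $S$. That is, it is the tensor product of a basis $\{\varphi_{lm},\psi_{lm}\}$ of $L^2([0,1])$ whose functions at level $l$ are $2^{l/2}f(2^l\cdot-m)$ with $f\in\{\varphi,\psi\}$ in the interior, and $2^{l/2}f(2^lx)$, respectively $2^{l/2}f(2^l(1-x))$, with finitely many edge generators $f$ at the end points; all generators are restrictions of compactly supported $C^S$ functions; for $l\ge J_0$ the spaces $V_l=\mathrm{span}\{\varphi_{lm}\}$ of dimension $2^l$ form a multiresolution analysis of $L^2([0,1])$ and contain the polynomials of degree at most $S-1$. For $k=2^{jd}$ with $j\ge J_0$ let $K_{V_k}(x,y)=\sum_m\Phi_{jm}(x)\Phi_{jm}(y)$. Let $H(\alpha,M)$ be the set of uniformly continuous $h$ on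 $[0,1]^d$ with $$2^{J_0(\alpha+d/2)}\max_m|\langle h,\Phi_{J_0m}\rangle|+\sup_{l\ge J_0,\,m,\,\iota}2^{l(\alpha+d/2)}|\langle h,\Psi^{\iota}_{lm}\rangle|\le M .$$ Let $\mathcal P_{(\alpha,\beta)}$ be the set of laws $\mathbb P$ of $(X,A,Y)$ with $X\sim\mathrm{Uniform}([0,1]^d)$, $A,Y\in[C_1,C_2]$ a.s., and $p(x)=\mathbb E[A\mid X=x]\in H(\alpha,M)$, $b(x)=\mathbb E[Y\mid X=x]\in H(\beta,M)$. Assume that this set is nonempty for some radius $M'\in(0,M)$ in place of $M$ (which is automatic if $C_1\le 0\le C_2$). Let $\psi(\mathbb P)=\mathbb E_{\mathbb P}[\mathrm{Cov}_{\mathbb P}(A,Y\mid X)]$. Let $\mathcal D_1,\mathcal D_2,\mathcal D_3,\mathcal D_4$ be disjoint subsamples of size $n\ge1$ of i.i.d. observations from $\mathbb P$, and put $$\hat p(x)=\frac1n\sum_{i\in\mathcal D_1}A_iK_{V_{k_1}}(X_i,x),\qquad \hat b(x)=\frac1n\sum_{i\in\mathcal D_2}Y_iK_{V_{k_2}}(X_i,x),$$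 $$\hat\psi^{\mathrm{INT}}=\frac1n\sum_{i\in\mathcal D_3}A_iY_i-\int_{[0,1]^d}\hat p\,\hat b\,dx,\qquad \hat\psi^{\mathrm{MC}}=\frac1n\sum_{i\in\mathcal D_3}A_iY_i-\frac1n\sum_{i\in\mathcal D_4}\hat p(X_i)\hat b(X_i),$$ $$\hat\psi^{\mathrm{IF}}=\frac1n\sum_{i\in\mathcal D_3}(A_i-\hat p(X_i))(Y_i-\hat b(X_i)).$$ **Theorem.** For every $\mathbb P\in\mathcal P_{(\alpha,\beta)}$, $n\ge1$ and $k_1,k_2$ as above the three estimators are square integrable. In 1), 2a) and 3a) the implied constants are positive and finite and do not depend on $n\ge 1$, $k_1$, $k_2$. 1) $\sup_{\mathbb P\in\mathcal P_{(\alpha,\beta)}}|\mathbb E_{\mathbb P}(\hat\psi^{\mathrm{INT}}-\psi(\mathbb P))|\asymp(k_1\wedge k_2)^{-(\alpha+\beta)/d}$ and $\sup_{\mathbb P\in\mathcal P_{(\alpha,\beta)}}\mathrm{Var}_{\mathbb P}(\hat\psi^{\mathrm{INT}})\lesssim\frac1n+\frac{k_1\wedge k_2}{n^2}$. 2a) $\sup_{\mathbb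 P\in\mathcal P_{(\alpha,\beta)}}|\mathbb E_{\mathbb P}(\hat\psi^{\mathrm{MC}}-\psi(\mathbb P))|\asymp(k_1\wedge k_2)^{-(\alpha+\beta)/d}$ and $\sup_{\mathbb P\in\mathcal P_{(\alpha,\beta)}}\mathrm{Var}_{\mathbb P}(\hat\psi^{\mathrm{MC}})\lesssim\frac1n+\frac{k_1\vee k_2}{n^2}+\frac{k_1k_2}{n^3}$. 2b) There are $\mathbb P\in\mathcal P_{(\alpha,\beta)}$ and $c>0$ such that for all resolution sequences $k_1=k_1(n)$, $k_2=k_2(n)$ with $k_1/n\to\infty$ and $k_2/n\to\infty$, for all sufficiently large $n$, $|\mathbb E_{\mathbb P}(\hat\psi^{\mathrm{MC}}-\psi(\mathbb P))|\ge c\,(k_1\wedge k_2)^{-(\alpha+\beta)/d}$ and $\mathrm{Var}_{\mathbb P}(\hat\psi^{\mathrm{MC}})\ge c\,\frac{k_1k_2}{n^3}$. 3a) $\sup_{\mathbb P\in\mathcal P_{(\alpha,\beta)}}|\mathbb E_{\mathbb P}(\hat\psi^{\mathrm{IF}}-\psi(\mathbb P))|\asymp(k_1\vee k_2)^{-(\alpha+\beta)/d}$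 and $\sup_{\mathbb P\in\mathcal P_{(\alpha,\beta)}}\mathrm{Var}_{\mathbb P}(\hat\psi^{\mathrm{IF}})\lesssim\frac1n+\frac{k_1\vee k_2}{n^2}+\frac{k_1k_2}{n^3}$. 3b) There are $\mathbb P\in\mathcal P_{(\alpha,\beta)}$ and $c>0$ such that for all resolution sequences $k_1=k_1(n)$, $k_2=k_2(n)$ with $k_1/n\to\infty$ and $k_2/n\to\infty$, for all sufficiently large $n$, $|\mathbb E_{\mathbb P}(\hat\psi^{\mathrm{IF}}-\psi(\mathbb P))|\ge c\,(k_1\vee k_2)^{-(\alpha+\beta)/d}$ and $\mathrm{Var}_{\mathbb P}(\hat\psi^{\mathrm{IF}})\ge c\,\frac{k_1k_2}{n^3}$. -/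

import Mathlib

open MeasureTheory ProbabilityTheory Filter Set
open scoped ENNReal NNReal Topology

noncomputable section

namespace DoubleSplit

/-! ### Boundary-corrected wavelet bases of the unit interval -/

/-- The level-`j` family, indexed by `0 ≤ m < 2 ^ j`, generated on `[0,1]` by one interior function
`f`, by `N` left edge functions `fL 0, …, fL (N-1)` and by `N` right edge functions
`fR 0, …, fR (N-1)`:
`2^{j/2} fL_m(2^j x)` for `m < N`, `2^{j/2} f(2^j x - m)` for `N ≤ m < 2^j - N`, and
`2^{j/2} fR_{2^j-1-m}(2^j (1 - x))` for the last `N` indices. -/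
def levelFamily (N : ℕ) (f : ℝ → ℝ) (fL fR : ℕ → ℝ → ℝ) (j : ℕ) (m : Fin (2 ^ j)) (x : ℝ) : ℝ :=
  Real.sqrt (2 ^ j) *
    (if (m : ℕ) < N then fL m (2 ^ j * x)
     else if (m : ℕ) + N < 2 ^ j then f (2 ^ j * x - (m : ℕ))
     else fR (2 ^ j - 1 - (m : ℕ)) (2 ^ j * (1 - x)))

/-- The generators of a boundary-corrected wavelet system on `[0,1]`: the scaling function `φ` and
the wavelet `ψ`, with `N` edge functions of each kind at either end point. -/
structure Generators where
  /-- number of edge functions at each end point -/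
  N : ℕ
  /-- scaling function -/
  φ : ℝ → ℝ
  /-- wavelet -/
  ψ : ℝ → ℝ
  /-- left edge scaling functions (those with index `< N` are used) -/
  φL : ℕ → ℝ → ℝ
  /-- right edge scaling functions -/
  φR : ℕ → ℝ → ℝ
  /-- left edge wavelets -/
  ψL : ℕ → ℝ → ℝ
  /-- right edge wavelets -/
  ψR : ℕ → ℝ → ℝ

/-- The scaling functions `φ_{jm}` on `[0,1]`. -/
def Generators.scal (G : Generators) (j : ℕ) : Fin (2 ^ j) → ℝ → ℝ :=
  levelFamily G.N G.φ G.φL G.φR j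

/-- The wavelets `ψ_{jm}` on `[0,1]`. -/
def Generators.wav (G : Generators) (j : ℕ) : Fin (2 ^ j) → ℝ → ℝ :=
  levelFamily G.N G.ψ G.ψL G.ψR j

/-- A function agrees on `[0,1]` with an element of `V_j = span {φ_{jm} : 0 ≤ m < 2 ^ j}`. -/
def Generators.MemV (G : Generators) (j : ℕ) (g : ℝ → ℝ) : Prop :=
  ∃ c : Fin (2 ^ j) → ℝ, ∀ x ∈ Icc (0 : ℝ) 1, g x = ∑ m, c m * G.scal j m x

/-- A Cohen-Daubechies-Vial type compactly supported orthonormal wavelet basis of `L²([0,1])` of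
regularity `S`: the generators (edge functions included) are restrictions of compactly supported
`C^S` functions, the spaces `V_j` (`j ≥ J₀`) form a multiresolution analysis of `L²([0,1])` with
orthonormal bases `{φ_{jm}}`, the `{ψ_{jm}}` are orthonormal bases of the orthogonal complements of
`V_j` in `V_{j+1}`, and every `V_j` contains the polynomials of degree at most `S - 1`. -/
structure CDVBasis (S : ℕ) extends Generators where
  /-- coarsest level -/
  J₀ : ℕ
  one_le_J₀ : 1 ≤ J₀
  S_le : S ≤ 2 ^ J₀
  edges_le : 2 * N ≤ 2 ^ J₀
  smooth : ContDiff ℝ S φ ∧ ContDiff ℝ S ψ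
  smooth_edge : ∀ m < N, ContDiff ℝ S (φL m) ∧ ContDiff ℝ S (φR m) ∧
    ContDiff ℝ S (ψL m) ∧ ContDiff ℝ S (ψR m)
  compact : HasCompactSupport φ ∧ HasCompactSupport ψ
  compact_edge : ∀ m < N, HasCompactSupport (φL m) ∧ HasCompactSupport (φR m) ∧
    HasCompactSupport (ψL m) ∧ HasCompactSupport (ψR m)
  scal_orthonormal : ∀ j, J₀ ≤ j → ∀ m m' : Fin (2 ^ j),
    ∫ x in Icc (0 : ℝ) 1, toGenerators.scal j m x * toGenerators.scal j m' x
      = if m = m' then 1 else 0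
  wav_orthonormal : ∀ j, J₀ ≤ j → ∀ m m' : Fin (2 ^ j),
    ∫ x in Icc (0 : ℝ) 1, toGenerators.wav j m x * toGenerators.wav j m' x
      = if m = m' then 1 else 0
  scal_wav_orthogonal : ∀ j, J₀ ≤ j → ∀ m m' : Fin (2 ^ j),
    ∫ x in Icc (0 : ℝ) 1, toGenerators.scal j m x * toGenerators.wav j m' x = 0
  scal_nested : ∀ j, J₀ ≤ j → ∀ m : Fin (2 ^ j),
    toGenerators.MemV (j + 1) (toGenerators.scal j m)
  wav_nested : ∀ j, J₀ ≤ j → ∀ m : Fin (2 ^ j),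
    toGenerators.MemV (j + 1) (toGenerators.wav j m)
  complete : ∀ g : ℝ → ℝ, MemLp g 2 (volume.restrict (Icc 0 1)) →
    (∀ j, J₀ ≤ j → ∀ m : Fin (2 ^ j),
      ∫ x in Icc (0 : ℝ) 1, g x * toGenerators.scal j m x = 0) →
    g =ᵐ[volume.restrict (Icc 0 1)] 0
  poly_mem : ∀ j, J₀ ≤ j → ∀ r < S, toGenerators.MemV j (fun x => x ^ r)

/-! ### Tensor-product bases, projection kernels and Hölder balls on the unit cube -/

/-- The unit cube `[0,1]^d`. -/
abbrev cube (d : ℕ) : Set (Fin d → ℝ) := Icc 0 1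

/-- The `L²([0,1]^d)` inner product. -/
def inner2 {d : ℕ} (g h : (Fin d → ℝ) → ℝ) : ℝ := ∫ x in cube d, g x * h x

section Basis

variable {S : ℕ} (B : CDVBasis S) {d : ℕ}

/-- `Φ_{lm}(x) = ∏ φ_{l m_i}(x_i)`. -/
def CDVBasis.Phi (l : ℕ) (m : Fin d → Fin (2 ^ l)) (x : Fin d → ℝ) : ℝ :=
  ∏ i, B.scal l (m i) (x i)

/-- `Ψ^ι_{lm}(x) = ∏ ψ^{ι_i}_{l m_i}(x_i)`, with `ψ^0 = φ` and `ψ^1 = ψ`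
(`false` stands for `0`, `true` for `1`). -/
def CDVBasis.Psi (l : ℕ) (ι : Fin d → Bool) (m : Fin d → Fin (2 ^ l)) (x : Fin d → ℝ) : ℝ :=
  ∏ i, if ι i then B.wav l (m i) (x i) else B.scal l (m i) (x i)

/-- The kernel of the orthogonal projection onto `V_j`, the span of the `2^{jd}` functions
`Φ_{jm}`. -/
def CDVBasis.kernel (j : ℕ) (x y : Fin d → ℝ) : ℝ :=
  ∑ m : Fin d → Fin (2 ^ j), B.Phi j m x * B.Phi j m y

/-- The norm `2^{J₀(α+d/2)} ‖⟨h, Φ_{J₀·}⟩‖_∞ + sup_{l ≥ J₀, m, ι ≠ 0} 2^{l(α+d/2)} |⟨h, Ψ^ι_{lm}⟩|`,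
with values in `[0, ∞]`. -/
def CDVBasis.holderNorm (α : ℝ) (h : (Fin d → ℝ) → ℝ) : ℝ≥0∞ :=
  (⨆ m : Fin d → Fin (2 ^ B.J₀),
      ENNReal.ofReal ((2 : ℝ) ^ ((B.J₀ : ℝ) * (α + d / 2)) * |inner2 h (B.Phi B.J₀ m)|)) +
    ⨆ (l : ℕ) (_ : B.J₀ ≤ l) (ι : Fin d → Bool) (_ : ι ≠ fun _ => false)
      (m : Fin d → Fin (2 ^ l)),
      ENNReal.ofReal ((2 : ℝ) ^ ((l : ℝ) * (α + d / 2)) * |inner2 h (B.Psi l ι m)|)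

/-- The Hölder ball `H(α, M)`. -/
def CDVBasis.holderBall (d : ℕ) (α M : ℝ) : Set ((Fin d → ℝ) → ℝ) :=
  {h | UniformContinuousOn h (cube d) ∧ B.holderNorm α h ≤ ENNReal.ofReal M}

end Basis

/-! ### The model and the functional -/

/-- An observation `(X, A, Y)`. -/
abbrev Obs (d : ℕ) := (Fin d → ℝ) × ℝ × ℝ

/-- The covariate. -/
def obsX {d : ℕ} (o : Obs d) : Fin d → ℝ := o.1

/-- The variable `A`. -/
def obsA {d : ℕ} (o : Obs d) : ℝ := o.2.1

/-- The variable `Y`. -/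
def obsY {d : ℕ} (o : Obs d) : ℝ := o.2.2

/-- The `σ`-algebra generated by `X`. -/
@[reducible] def sigmaX (d : ℕ) : MeasurableSpace (Obs d) := MeasurableSpace.comap obsX inferInstance

/-- `x ↦ g x` is a version of `x ↦ E[Z | X = x]`. -/
def IsRegression {d : ℕ} (P : ProbabilityMeasure (Obs d)) (Z : Obs d → ℝ)
    (g : (Fin d → ℝ) → ℝ) : Prop :=
  (P : Measure (Obs d))[Z | sigmaX d] =ᵐ[(P : Measure (Obs d))] fun o => g (obsX o)

/-- The model `𝒫_{(α,β)}`. -/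
def CDVBasis.model {S : ℕ} (B : CDVBasis S) (d : ℕ) (C₁ C₂ α β M : ℝ) :
    Set (ProbabilityMeasure (Obs d)) :=
  {P | (P : Measure (Obs d)).map obsX = volume.restrict (cube d) ∧
    (∀ᵐ o ∂(P : Measure (Obs d)), obsA o ∈ Icc C₁ C₂ ∧ obsY o ∈ Icc C₁ C₂) ∧
    (∃ p ∈ B.holderBall d α M, IsRegression P obsA p) ∧
    (∃ b ∈ B.holderBall d β M, IsRegression P obsY b)}

/-- The conditional covariance `Cov_P(A, Y | X)`. -/
def condCovAY {d : ℕ} (P : ProbabilityMeasure (Obs d)) : Obs d → ℝ :=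
  (P : Measure (Obs d))[fun o =>
    (obsA o - ((P : Measure (Obs d))[obsA | sigmaX d]) o) *
      (obsY o - ((P : Measure (Obs d))[obsY | sigmaX d]) o) | sigmaX d]

/-- The functional `ψ(P) = E_P[Cov_P(A, Y | X)]`. -/
def psi {d : ℕ} (P : ProbabilityMeasure (Obs d)) : ℝ :=
  ∫ o, condCovAY P o ∂(P : Measure (Obs d))

/-! ### Sample splitting and the estimators -/

/-- `m` disjoint subsamples of `n` observations each. -/
abbrev Sample (d m n : ℕ) := Fin m → Fin n → Obs d

/-- The law of `m` subsamples of size `n` when all `m n` observations are i.i.d. from `P`. -/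
def sampleLaw {d : ℕ} (P : ProbabilityMeasure (Obs d)) (m n : ℕ) : Measure (Sample d m n) :=
  Measure.pi fun _ => Measure.pi fun _ => (P : Measure (Obs d))

section Estimators

variable {S : ℕ} (B : CDVBasis S) {d n : ℕ}

/-- The wavelet projection estimator `x ↦ n⁻¹ ∑ Z_i K_{V_j}(X_i, x)` of `x ↦ E[Z | X = x]` from one
subsample. -/
def CDVBasis.projEst (Z : Obs d → ℝ) (j : ℕ) (D : Fin n → Obs d) (x : Fin d → ℝ) : ℝ :=
  (1 / (n : ℝ)) * ∑ i, Z (D i) * B.kernel j (obsX (D i)) x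

/-- Integral-based plug-in estimator. -/
def CDVBasis.psiINT (j₁ j₂ : ℕ) (D : Sample d 3 n) : ℝ :=
  (1 / (n : ℝ)) * ∑ i, obsA (D 2 i) * obsY (D 2 i)
    - ∫ x in cube d, B.projEst obsA j₁ (D 0) x * B.projEst obsY j₂ (D 1) x

/-- Monte Carlo-based plug-in estimator. -/
def CDVBasis.psiMC (j₁ j₂ : ℕ) (D : Sample d 4 n) : ℝ :=
  (1 / (n : ℝ)) * ∑ i, obsA (D 2 i) * obsY (D 2 i)
    - (1 / (n : ℝ)) * ∑ i,
        B.projEst obsA j₁ (D 0) (obsX (D 3 i)) * B.projEst obsY j₂ (D 1) (obsX (D 3 i))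

/-- First-order bias-corrected estimator. -/
def CDVBasis.psiIF (j₁ j₂ : ℕ) (D : Sample d 3 n) : ℝ :=
  (1 / (n : ℝ)) * ∑ i,
    (obsA (D 2 i) - B.projEst obsA j₁ (D 0) (obsX (D 2 i))) *
      (obsY (D 2 i) - B.projEst obsY j₂ (D 1) (obsX (D 2 i)))

end Estimators

/-! ### Bias and variance -/

/-- The bias `E_P(est - ψ(P))`. -/
def bias {d m n : ℕ} (P : ProbabilityMeasure (Obs d)) (est : Sample d m n → ℝ) : ℝ :=
  ∫ D, (est D - psi P) ∂(sampleLaw P m n)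

/-- The variance of an estimator under `P`. -/
def var {d m n : ℕ} (P : ProbabilityMeasure (Obs d)) (est : Sample d m n → ℝ) : ℝ :=
  variance est (sampleLaw P m n)

/-- The worst-case absolute bias over a set of distributions, with values in `[0, ∞]`. -/
def worstBias {d m n : ℕ} (Q : Set (ProbabilityMeasure (Obs d))) (est : Sample d m n → ℝ) : ℝ≥0∞ :=
  ⨆ P ∈ Q, ENNReal.ofReal |bias P est|

/-- The worst-case variance over a set of distributions, with values in `[0, ∞]`. -/
def worstVar {d m n : ℕ} (Q : Set (ProbabilityMeasure (Obs d))) (est : Sample d m n → ℝ) : ℝ≥0∞ :=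
  ⨆ P ∈ Q, evariance est (sampleLaw P m n)

/-- The resolution `k = 2^{jd} = dim V_j`. -/
def res (d j : ℕ) : ℝ := 2 ^ (j * d)

end DoubleSplit

end

open DoubleSplit

noncomputable section

namespace DoubleSplit

/-! ### One-dimensional bases -/

/-! Bias. Write `Π_j` for the projection onto `V_j`. Conditioning on `X` shows that `p̂` and `b̂`
have means `Π_{j₁} p` and `Π_{j₂} b`. Since `X` is uniform and the `V_j` are nested, `⟨Π_{j₁} p,
Π_{j₂} b⟩ = ⟨Π_{min} p, b⟩`. Hence both plug-in estimators have bias `gap j p b = ⟨p, b⟩ - ⟨Π_j p,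
b⟩` with `j = min j₁ j₂`. In `⟨p - Π_{j₁} p, b - Π_{j₂} b⟩` the coarser projection cancels instead,
so the corrected estimator has the same bias with `j = max j₁ j₂`. By telescoping (`hasSum_lev`),
`gap j p b` is the sum over levels `l ≥ j` of products of wavelet coefficients. A level has `2^{ld}`
products of each type, so the Hölder balls bound it by a multiple of `2^{-l(α+β)}`, and the
geometric series gives the upper bound.

Variance. Up to null sets each estimator is an average of a bounded kernel `h(x, y, z)` over three
independent samples, for Monte Carlo minus that average and with an independent sample mean added.
The second moment has an exact eight-term expansion (`integral_ustat_sq`). For upper bounds, `h` is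
dominated by projection kernels, whose integrals in one variable are bounded uniformly in the
resolution and whose sup norm is `O(k)`; bounding one factor of each square by its maximum and
integrating the other yields every term. For lower bounds only `E h² / n³` is kept. It is of order
`k₁ k₂ / n³` because constants lie in `V_j`, which forces `K(x, x) ≳ k`, and because `A` and `Y` are
bounded away from zero under the chosen law. The mean of `h` stays bounded, so its loss of order
`1/n` is negligible once `k₁, k₂ ≫ n`.

Least favourable law. A single law serves all the lower bounds. The regression functions of a law in
the smaller model are moved slightly towards a nonzero constant inside `(C₁, C₂)`, which creates
room at both end points, and are projected onto some `V_L`, which empties all levels from `L` on.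
There a small multiple of `spike` is inserted, whose coefficients are the largest the smoothness
allows; the slack `M - M'` pays for it. From `L` on the gap then has exactly the extremal order.
Below `L` it is affine in the amplitude of the second spike with positive slope, so avoiding
finitely many amplitudes keeps it nonzero at every resolution. The law of `(X, p(X), b(X))` is the
required one. -/

theorem exists_bound_of_hasCompactSupport {g : ℝ → ℝ} (hg : Continuous g)
    (hc : HasCompactSupport g) : ∃ C : ℝ, 0 < C ∧ ∀ x, |g x| ≤ C ∧ (g x ≠ 0 → |x| ≤ C) := by
  obtain ⟨A, hA⟩ := hc.exists_bound_of_continuous hg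
  obtain ⟨R, hR⟩ := hc.isCompact.isBounded.exists_norm_le
  refine ⟨max 1 (max A R), by positivity, fun x => ⟨?_, fun hx => ?_⟩⟩
  · exact (hA x).trans ((le_max_left _ _).trans (le_max_right _ _))
  · exact (hR x (subset_tsupport _ hx)).trans ((le_max_right _ _).trans (le_max_right _ _))

theorem exists_bound_family {N : ℕ} {g : ℕ → ℝ → ℝ}
    (h : ∀ m < N, Continuous (g m) ∧ HasCompactSupport (g m)) :
    ∃ C : ℝ, 0 < C ∧ ∀ m < N, ∀ x, |g m x| ≤ C ∧ (g m x ≠ 0 → |x| ≤ C) := by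
  have := fun (m : Fin N) => exists_bound_of_hasCompactSupport (h m m.2).1 (h m m.2).2
  choose c hc0 hc using this
  refine ⟨1 + ∑ m, c m, by have := Finset.sum_nonneg fun m (_ : m ∈ Finset.univ) => (hc0 m).le
                           linarith, fun m hm x => ?_⟩
  have hle : c ⟨m, hm⟩ ≤ 1 + ∑ m, c m := by
    have := Finset.single_le_sum (fun m (_ : m ∈ Finset.univ) => (hc0 m).le)
      (Finset.mem_univ (⟨m, hm⟩ : Fin N))
    linarith
  exact ⟨(hc ⟨m, hm⟩ x).1.trans hle, fun h0 => ((hc ⟨m, hm⟩ x).2 h0).trans hle⟩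

theorem continuous_levelFamily {N : ℕ} {f : ℝ → ℝ} {fL fR : ℕ → ℝ → ℝ} (hf : Continuous f)
    (hL : ∀ m < N, Continuous (fL m)) (hR : ∀ m < N, Continuous (fR m)) (j : ℕ)
    (m : Fin (2 ^ j)) : Continuous (levelFamily N f fL fR j m) := by
  unfold levelFamily
  refine continuous_const.mul ?_
  split_ifs with h1 h2
  · exact (hL _ h1).comp (by fun_prop)
  · exact hf.comp (by fun_prop)
  · exact (hR _ (by have := m.2; omega)).comp (by fun_prop)

/-- An edge function is located near an end point, and its index differs from the rescaled end point
by at most `N`. Enlarging the radius by `N` therefore lets all three kinds of generators share one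
localisation `|2^j x - m| ≤ C`, uniform in `j`. -/
theorem exists_levelFamily_local {N : ℕ} {f : ℝ → ℝ} {fL fR : ℕ → ℝ → ℝ} (hf : Continuous f)
    (hfc : HasCompactSupport f)
    (hL : ∀ m < N, Continuous (fL m) ∧ HasCompactSupport (fL m))
    (hR : ∀ m < N, Continuous (fR m) ∧ HasCompactSupport (fR m)) :
    ∃ C : ℝ, ∀ (j : ℕ) (m : Fin (2 ^ j)) (x : ℝ),
      |levelFamily N f fL fR j m x| ≤ C * √(2 ^ j) ∧
      (levelFamily N f fL fR j m x ≠ 0 → |2 ^ j * x - m| ≤ C) := by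
  obtain ⟨a, ha0, ha⟩ := exists_bound_of_hasCompactSupport hf hfc
  obtain ⟨b, hb0, hb⟩ := exists_bound_family hL
  obtain ⟨c, hc0, hc⟩ := exists_bound_family hR
  refine ⟨a + b + c + N, fun j m x => ?_⟩
  have hN : (0 : ℝ) ≤ N := Nat.cast_nonneg N
  unfold levelFamily
  rw [abs_mul, abs_of_nonneg (Real.sqrt_nonneg _), mul_comm]
  split_ifs with h1 h2
  · refine ⟨mul_le_mul_of_nonneg_right (((hb _ h1 _).1).trans (by linarith))
      (Real.sqrt_nonneg _), fun h => ?_⟩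
    have h3 := (hb _ h1 (2 ^ j * x)).2 (right_ne_zero_of_mul h)
    have h4 : ((m : ℕ) : ℝ) ≤ N := by exact_mod_cast h1.le
    have h5 : (0 : ℝ) ≤ ((m : ℕ) : ℝ) := Nat.cast_nonneg _
    rw [abs_le] at h3 ⊢
    constructor <;> linarith
  · refine ⟨mul_le_mul_of_nonneg_right (((ha _).1).trans (by linarith))
      (Real.sqrt_nonneg _), fun h => ?_⟩
    have h3 := (ha (2 ^ j * x - (m : ℕ))).2 (right_ne_zero_of_mul h)
    linarith
  · have h6 : 2 ^ j - 1 - (m : ℕ) < N := by have := m.2; omega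
    refine ⟨mul_le_mul_of_nonneg_right (((hc _ h6 _).1).trans (by linarith))
      (Real.sqrt_nonneg _), fun h => ?_⟩
    have h3 := (hc _ h6 (2 ^ j * (1 - x))).2 (right_ne_zero_of_mul h)
    have h4 : ((2 : ℝ) ^ j) ≤ N + (m : ℕ) := by
      have : 2 ^ j ≤ N + (m : ℕ) := by omega
      exact_mod_cast this
    have h5 : ((m : ℕ) : ℝ) ≤ (2 : ℝ) ^ j := by exact_mod_cast m.2.le
    rw [abs_le] at h3 ⊢
    constructor <;> nlinarith [h3.1, h3.2]

section OneDim

variable {S : ℕ} (B : CDVBasis S)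

/-- The wavelets (`true`) and scaling functions (`false`) on `[0,1]`. -/
def CDVBasis.fam (t : Bool) (j : ℕ) (m : Fin (2 ^ j)) (x : ℝ) : ℝ :=
  if t then B.wav j m x else B.scal j m x

theorem CDVBasis.continuous_fam (t : Bool) (j : ℕ) (m : Fin (2 ^ j)) :
    Continuous (B.fam t j m) := by
  cases t
  · exact continuous_levelFamily B.smooth.1.continuous
      (fun m hm => (B.smooth_edge m hm).1.continuous)
      (fun m hm => (B.smooth_edge m hm).2.1.continuous) j m
  · exact continuous_levelFamily B.smooth.2.continuous
      (fun m hm => (B.smooth_edge m hm).2.2.1.continuous)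
      (fun m hm => (B.smooth_edge m hm).2.2.2.continuous) j m

theorem CDVBasis.exists_fam_local : ∃ C : ℝ, 1 ≤ C ∧ ∀ (t : Bool) (j : ℕ) (m : Fin (2 ^ j)) (x : ℝ),
    |B.fam t j m x| ≤ C * √(2 ^ j) ∧ (B.fam t j m x ≠ 0 → |2 ^ j * x - m| ≤ C) := by
  obtain ⟨a, ha⟩ := exists_levelFamily_local B.smooth.1.continuous B.compact.1
    (fun m hm => ⟨(B.smooth_edge m hm).1.continuous, (B.compact_edge m hm).1⟩)
    (fun m hm => ⟨(B.smooth_edge m hm).2.1.continuous, (B.compact_edge m hm).2.1⟩)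
  obtain ⟨b, hb⟩ := exists_levelFamily_local B.smooth.2.continuous B.compact.2
    (fun m hm => ⟨(B.smooth_edge m hm).2.2.1.continuous, (B.compact_edge m hm).2.2.1⟩)
    (fun m hm => ⟨(B.smooth_edge m hm).2.2.2.continuous, (B.compact_edge m hm).2.2.2⟩)
  refine ⟨max 1 (max a b), le_max_left _ _, fun t j m x => ?_⟩
  cases t
  · have h : a ≤ max 1 (max a b) := (le_max_left _ _).trans (le_max_right _ _)
    exact ⟨(ha j m x).1.trans (mul_le_mul_of_nonneg_right h (Real.sqrt_nonneg _)),
      fun h0 => ((ha j m x).2 h0).trans h⟩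
  · have h : b ≤ max 1 (max a b) := (le_max_right _ _).trans (le_max_right _ _)
    exact ⟨(hb j m x).1.trans (mul_le_mul_of_nonneg_right h (Real.sqrt_nonneg _)),
      fun h0 => ((hb j m x).2 h0).trans h⟩

/-- A constant bounding both the size and the support radius of the generators. -/
def CDVBasis.locC : ℝ := B.exists_fam_local.choose

theorem CDVBasis.one_le_locC : 1 ≤ B.locC := B.exists_fam_local.choose_spec.1

theorem CDVBasis.locC_pos : 0 < B.locC := one_pos.trans_le B.one_le_locC

theorem CDVBasis.abs_fam_le (t : Bool) (j : ℕ) (m : Fin (2 ^ j)) (x : ℝ) :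
    |B.fam t j m x| ≤ B.locC * √(2 ^ j) := (B.exists_fam_local.choose_spec.2 t j m x).1

theorem CDVBasis.fam_support (t : Bool) (j : ℕ) (m : Fin (2 ^ j)) (x : ℝ)
    (h : B.fam t j m x ≠ 0) : |2 ^ j * x - m| ≤ B.locC :=
  (B.exists_fam_local.choose_spec.2 t j m x).2 h

theorem card_filter_abs_sub_le {n : ℕ} (y C : ℝ) (hC : 0 ≤ C) :
    ((Finset.univ.filter fun m : Fin n => |y - (m : ℕ)| ≤ C).card : ℝ) ≤ 2 * C + 1 := by
  have h1 : (Finset.univ.filter fun m : Fin n => |y - (m : ℕ)| ≤ C).card ≤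
      (Finset.Icc ⌈y - C⌉ ⌊y + C⌋).card := by
    refine Finset.card_le_card_of_injOn (fun m => ((m : ℕ) : ℤ)) ?_ ?_
    · intro m hm
      have hm' : |y - (m : ℕ)| ≤ C := by simpa using hm
      rw [abs_le] at hm'
      simp only [Finset.coe_Icc, Set.mem_Icc, Int.ceil_le, Int.le_floor, Int.cast_natCast]
      constructor <;> linarith [hm'.1, hm'.2]
    · intro a _ b _ hab
      simp only [Nat.cast_inj] at hab
      exact Fin.ext hab
  have h2 : ((Finset.Icc ⌈y - C⌉ ⌊y + C⌋).card : ℝ) ≤ 2 * C + 1 := by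
    rw [Int.card_Icc]
    have h3 := Int.floor_le (y + C)
    have h4 := Int.le_ceil (y - C)
    have h5 : (((⌊y + C⌋ + 1 - ⌈y - C⌉).toNat : ℤ) : ℝ) ≤ 2 * C + 1 := by
      rw [Int.toNat_eq_max]
      push_cast
      exact max_le (by linarith) (by linarith)
    exact_mod_cast h5
  exact le_trans (by exact_mod_cast h1) h2

theorem CDVBasis.card_fam_ne_zero_le (t : Bool) (j : ℕ) (x : ℝ) :
    ((Finset.univ.filter fun m : Fin (2 ^ j) => B.fam t j m x ≠ 0).card : ℝ) ≤
      2 * B.locC + 1 := by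
  refine le_trans ?_ (card_filter_abs_sub_le (n := 2 ^ j) (2 ^ j * x) B.locC B.locC_pos.le)
  exact_mod_cast Finset.card_le_card (Finset.monotone_filter_right _
    fun m _ hm => B.fam_support t j m x hm)

/-- The constant in the bounds on sums of absolute values of basis functions. -/
def CDVBasis.sumC : ℝ := (2 * B.locC + 1) * B.locC

theorem CDVBasis.sumC_pos : 0 < B.sumC := by
  have := B.locC_pos
  unfold CDVBasis.sumC; positivity

/-- Only boundedly many functions of one level are nonzero at a given point, so the sum is no larger
in order than a single term. -/
theorem CDVBasis.sum_abs_fam_le (t : Bool) (j : ℕ) (x : ℝ) :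
    ∑ m, |B.fam t j m x| ≤ B.sumC * √(2 ^ j) := by
  have h : ∑ m, |B.fam t j m x| =
      ∑ m ∈ Finset.univ.filter (fun m : Fin (2 ^ j) => B.fam t j m x ≠ 0), |B.fam t j m x| := by
    rw [Finset.sum_filter]
    refine Finset.sum_congr rfl fun m _ => ?_
    split_ifs with h
    · rfl
    · simp only [not_not] at h; simp [h]
  rw [h]
  refine (Finset.sum_le_card_nsmul _ _ _ fun m _ => B.abs_fam_le t j m x).trans ?_
  rw [nsmul_eq_mul, CDVBasis.sumC, mul_assoc]
  have := B.locC_pos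
  exact mul_le_mul_of_nonneg_right (B.card_fam_ne_zero_le t j x) (by positivity)

theorem integrableOn_unit {f : ℝ → ℝ} (hf : Continuous f) :
    Integrable f (volume.restrict (Icc (0 : ℝ) 1)) :=
  hf.continuousOn.integrableOn_compact isCompact_Icc

/-- Height `C 2^{j/2}` times support length `2C / 2^j`. -/
theorem CDVBasis.integral_abs_fam_le (t : Bool) (j : ℕ) (m : Fin (2 ^ j)) :
    ∫ x in Icc (0 : ℝ) 1, |B.fam t j m x| ≤ 2 * B.locC ^ 2 / √(2 ^ j) := by
  have hK := B.locC_pos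
  set s : ℝ := √(2 ^ j) with hs
  have hs0 : 0 < s := Real.sqrt_pos.2 (by positivity)
  have hs2 : s * s = 2 ^ j := Real.mul_self_sqrt (by positivity)
  set a : ℝ := (m - B.locC) / 2 ^ j
  set b : ℝ := (m + B.locC) / 2 ^ j
  have h1 : ∀ x, |B.fam t j m x| ≤ (Icc a b).indicator (fun _ => B.locC * s) x := by
    intro x
    by_cases h : B.fam t j m x = 0
    · rw [h, abs_zero]
      exact indicator_nonneg (fun _ _ => by positivity) x
    · have h2 := abs_le.1 (B.fam_support t j m x h)
      rw [indicator_of_mem]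
      · exact B.abs_fam_le t j m x
      · have : (0 : ℝ) < 2 ^ j := by positivity
        constructor
        · rw [div_le_iff₀ this]; linarith [h2.1]
        · rw [le_div_iff₀ this]; linarith [h2.2]
  have hi : Integrable ((Icc a b).indicator (fun _ => B.locC * s)) :=
    (integrableOn_const (by simp)).integrable_indicator measurableSet_Icc
  calc ∫ x in Icc (0 : ℝ) 1, |B.fam t j m x|
      ≤ ∫ x in Icc (0 : ℝ) 1, (Icc a b).indicator (fun _ => B.locC * s) x :=
        integral_mono (integrableOn_unit (B.continuous_fam t j m).abs) hi.integrableOn h1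
    _ ≤ ∫ x, (Icc a b).indicator (fun _ => B.locC * s) x :=
        setIntegral_le_integral hi (ae_of_all _ fun x => indicator_nonneg (fun _ _ => by positivity) x)
    _ = (b - a) * (B.locC * s) := by
        rw [integral_indicator measurableSet_Icc, setIntegral_const, smul_eq_mul]
        congr 1
        rw [Measure.real, Real.volume_Icc, ENNReal.toReal_ofReal]
        have : (0 : ℝ) < 2 ^ j := by positivity
        rw [sub_nonneg]
        exact div_le_div_of_nonneg_right (by linarith) this.le
    _ = 2 * B.locC ^ 2 / s := by
        simp only [a, b]
        rw [← hs2]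
        field_simp
        ring

theorem CDVBasis.integral_fam_mul (t t' : Bool) {j : ℕ} (hj : B.J₀ ≤ j) (m m' : Fin (2 ^ j)) :
    ∫ x in Icc (0 : ℝ) 1, B.fam t j m x * B.fam t' j m' x =
      if t = t' ∧ m = m' then 1 else 0 := by
  cases t <;> cases t'
  · simpa [CDVBasis.fam] using B.scal_orthonormal j hj m m'
  · simpa [CDVBasis.fam] using B.scal_wav_orthogonal j hj m m'
  · simpa [CDVBasis.fam, mul_comm] using B.scal_wav_orthogonal j hj m' m
  · simpa [CDVBasis.fam] using B.wav_orthonormal j hj m m'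

theorem CDVBasis.memV_fam (t : Bool) {j : ℕ} (hj : B.J₀ ≤ j) (m : Fin (2 ^ j)) :
    B.MemV (j + 1) (B.fam t j m) := by
  cases t
  · exact B.scal_nested j hj m
  · exact B.wav_nested j hj m

theorem CDVBasis.memV_scal (j : ℕ) (m : Fin (2 ^ j)) : B.MemV j (B.fam false j m) :=
  ⟨Pi.single m 1, fun x _ => by simp [CDVBasis.fam, Pi.single_apply]⟩

theorem CDVBasis.memV_succ {j : ℕ} (hj : B.J₀ ≤ j) {g : ℝ → ℝ} (hg : B.MemV j g) :
    B.MemV (j + 1) g := by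
  obtain ⟨c, hc⟩ := hg
  choose e he using fun m => B.scal_nested j hj m
  refine ⟨fun k => ∑ m, c m * e m k, fun x hx => ?_⟩
  rw [hc x hx]
  simp_rw [he _ x hx, Finset.mul_sum, Finset.sum_mul]
  rw [Finset.sum_comm]
  exact Finset.sum_congr rfl fun k _ => Finset.sum_congr rfl fun m _ => by ring

theorem CDVBasis.memV_mono {j j' : ℕ} (hj : B.J₀ ≤ j) (hjj' : j ≤ j') {g : ℝ → ℝ}
    (hg : B.MemV j g) : B.MemV j' g := by
  induction j', hjj' using Nat.le_induction with
  | base => exact hg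
  | succ k hk ih => exact B.memV_succ (hj.trans hk) ih

/-- Orthonormality identifies the unknown coefficients in `MemV` with inner products. -/
theorem CDVBasis.memV_coeff {j : ℕ} (hj : B.J₀ ≤ j) {g : ℝ → ℝ} (hg : B.MemV j g) :
    ∀ x ∈ Icc (0 : ℝ) 1,
      g x = ∑ m, (∫ y in Icc (0 : ℝ) 1, g y * B.fam false j m y) * B.fam false j m x := by
  obtain ⟨c, hc⟩ := hg
  have h : ∀ m, ∫ y in Icc (0 : ℝ) 1, g y * B.fam false j m y = c m := by
    intro m
    have h1 : ∫ y in Icc (0 : ℝ) 1, g y * B.fam false j m y =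
        ∫ y in Icc (0 : ℝ) 1, ∑ k, c k * (B.fam false j k y * B.fam false j m y) := by
      refine setIntegral_congr_fun measurableSet_Icc fun y hy => ?_
      simp only [hc y hy, Finset.sum_mul]
      exact Finset.sum_congr rfl fun k _ => by simp [CDVBasis.fam]; ring
    rw [h1, integral_finsetSum]
    · simp_rw [integral_const_mul, B.integral_fam_mul _ _ hj]
      simp
    · exact fun k _ => integrableOn_unit (continuous_const.mul
        ((B.continuous_fam _ _ _).mul (B.continuous_fam _ _ _)))
  intro x hx
  simp_rw [h, hc x hx]
  simp [CDVBasis.fam]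

theorem CDVBasis.integral_memV_mul_wav {j : ℕ} (hj : B.J₀ ≤ j) {g : ℝ → ℝ} (hg : B.MemV j g)
    (m : Fin (2 ^ j)) : ∫ y in Icc (0 : ℝ) 1, g y * B.fam true j m y = 0 := by
  obtain ⟨c, hc⟩ := hg
  have h1 : ∫ y in Icc (0 : ℝ) 1, g y * B.fam true j m y =
      ∫ y in Icc (0 : ℝ) 1, ∑ k, c k * (B.fam false j k y * B.fam true j m y) := by
    refine setIntegral_congr_fun measurableSet_Icc fun y hy => ?_
    simp only [hc y hy, Finset.sum_mul]
    exact Finset.sum_congr rfl fun k _ => by simp [CDVBasis.fam]; ring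
  rw [h1, integral_finsetSum]
  · simp_rw [integral_const_mul, B.integral_fam_mul _ _ hj]
    simp
  · exact fun k _ => integrableOn_unit (continuous_const.mul
      ((B.continuous_fam _ _ _).mul (B.continuous_fam _ _ _)))

/-- One-dimensional projection kernels: onto `V_j` (`false`) and onto its complement in `V_{j+1}`
(`true`). -/
def CDVBasis.kernel1 (t : Bool) (j : ℕ) (x y : ℝ) : ℝ := ∑ m, B.fam t j m x * B.fam t j m y

/-- Let `U` express the scaling functions and wavelets of level `j` in the scaling functions of
level `j + 1`. Orthonormality makes the rows of `U` orthonormal. There are `2 * 2^j = 2^(j+1)` of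
them, so `U` is square and its columns are orthonormal too. A dimension count thus replaces the
decomposition of `V_{j+1}` into `V_j` and its complement. -/
theorem CDVBasis.kernel1_succ {j : ℕ} (hj : B.J₀ ≤ j) {x y : ℝ} (hx : x ∈ Icc (0 : ℝ) 1)
    (hy : y ∈ Icc (0 : ℝ) 1) :
    B.kernel1 false (j + 1) x y = B.kernel1 false j x y + B.kernel1 true j x y := by
  let U : Bool × Fin (2 ^ j) → Fin (2 ^ (j + 1)) → ℝ := fun a k =>
    ∫ y in Icc (0 : ℝ) 1, B.fam a.1 j a.2 y * B.fam false (j + 1) k y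
  have hU : ∀ a, ∀ x ∈ Icc (0 : ℝ) 1, B.fam a.1 j a.2 x = ∑ k, U a k * B.fam false (j + 1) k x :=
    fun a => B.memV_coeff (hj.trans j.le_succ) (B.memV_fam a.1 hj a.2)
  have h1 : Matrix.of U * (Matrix.of U).transpose = 1 := by
    ext a b
    rw [Matrix.mul_apply, Matrix.one_apply]
    have h2 := B.integral_fam_mul a.1 b.1 hj a.2 b.2
    rw [show (if a = b then (1 : ℝ) else 0) = if a.1 = b.1 ∧ a.2 = b.2 then 1 else 0 by
      simp [Prod.ext_iff], ← h2]
    have h3 : ∫ x in Icc (0 : ℝ) 1, B.fam a.1 j a.2 x * B.fam b.1 j b.2 x =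
        ∫ x in Icc (0 : ℝ) 1, ∑ k, U a k * (B.fam b.1 j b.2 x * B.fam false (j + 1) k x) := by
      refine setIntegral_congr_fun measurableSet_Icc fun y hy => ?_
      rw [hU a y hy, Finset.sum_mul]
      exact Finset.sum_congr rfl fun k _ => by ring
    rw [h3, integral_finsetSum]
    · simp_rw [integral_const_mul]
      rfl
    · exact fun k _ => integrableOn_unit (continuous_const.mul
        ((B.continuous_fam _ _ _).mul (B.continuous_fam _ _ _)))
  have h2 : (Matrix.of U).transpose * Matrix.of U = 1 := by
    rwa [← Matrix.mul_eq_one_comm_of_card_eq]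
    simp [pow_succ, mul_comm]
  have h3 : ∀ k k', ∑ a, U a k * U a k' = if k = k' then 1 else 0 := by
    intro k k'
    have := congrFun (congrFun h2 k) k'
    rwa [Matrix.mul_apply, Matrix.one_apply] at this
  have h4 : B.kernel1 false j x y + B.kernel1 true j x y =
      ∑ a : Bool × Fin (2 ^ j), B.fam a.1 j a.2 x * B.fam a.1 j a.2 y := by
    rw [Fintype.sum_prod_type]
    simp [CDVBasis.kernel1, add_comm]
  rw [h4]
  calc B.kernel1 false (j + 1) x y
      = ∑ k, ∑ k', (∑ a, U a k * U a k') * (B.fam false (j + 1) k x * B.fam false (j + 1) k' y) := by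
        simp_rw [h3]
        simp [CDVBasis.kernel1]
    _ = ∑ k, ∑ k', ∑ a, (U a k * U a k') * (B.fam false (j + 1) k x * B.fam false (j + 1) k' y) := by
        simp_rw [Finset.sum_mul]
    _ = ∑ k, ∑ a, ∑ k', (U a k * U a k') * (B.fam false (j + 1) k x * B.fam false (j + 1) k' y) :=
        Finset.sum_congr rfl fun k _ => Finset.sum_comm
    _ = ∑ a, ∑ k, ∑ k', (U a k * U a k') * (B.fam false (j + 1) k x * B.fam false (j + 1) k' y) :=
        Finset.sum_comm
    _ = ∑ a : Bool × Fin (2 ^ j), B.fam a.1 j a.2 x * B.fam a.1 j a.2 y := by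
        refine Finset.sum_congr rfl fun a _ => ?_
        rw [hU a x hx, hU a y hy, Finset.sum_mul_sum]
        exact Finset.sum_congr rfl fun k _ => Finset.sum_congr rfl fun k' _ => by ring

theorem CDVBasis.integral_kernel1_mul {j : ℕ} (hj : B.J₀ ≤ j) {g : ℝ → ℝ} (hg : B.MemV j g)
    (hgc : ContinuousOn g (Icc 0 1)) {x : ℝ} (hx : x ∈ Icc (0 : ℝ) 1) :
    ∫ y in Icc (0 : ℝ) 1, B.kernel1 false j x y * g y = g x := by
  rw [B.memV_coeff hj hg x hx]
  have h1 : ∀ y, B.kernel1 false j x y * g y =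
      ∑ m, B.fam false j m x * (g y * B.fam false j m y) := fun y => by
    rw [CDVBasis.kernel1, Finset.sum_mul]
    exact Finset.sum_congr rfl fun m _ => by ring
  simp_rw [h1]
  rw [integral_finsetSum]
  · simp_rw [integral_const_mul, mul_comm]
  · intro m _
    exact (continuousOn_const.mul
      (hgc.mul (B.continuous_fam _ _ _).continuousOn)).integrableOn_compact isCompact_Icc

/-- As a function of `z` the coarser kernel lies in `V_j`, hence in `V_{j'}`, and the finer kernel
reproduces it. -/
theorem CDVBasis.integral_kernel1_kernel1 {j j' : ℕ} (hj : B.J₀ ≤ j) (hjj' : j ≤ j') (x : ℝ)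
    {y : ℝ} (hy : y ∈ Icc (0 : ℝ) 1) :
    ∫ z in Icc (0 : ℝ) 1, B.kernel1 false j x z * B.kernel1 false j' y z = B.kernel1 false j x y := by
  have h1 : ∀ z, B.kernel1 false j x z * B.kernel1 false j' y z =
      ∑ m, B.fam false j m x * (B.kernel1 false j' y z * B.fam false j m z) := fun z => by
    rw [CDVBasis.kernel1, Finset.sum_mul]
    exact Finset.sum_congr rfl fun m _ => by ring
  simp_rw [h1]
  rw [integral_finsetSum]
  · simp_rw [integral_const_mul]
    refine Finset.sum_congr rfl fun m _ => ?_
    rw [B.integral_kernel1_mul (hj.trans hjj') (B.memV_mono hj hjj' (B.memV_scal j m))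
      (B.continuous_fam _ _ _).continuousOn hy]
  · intro m _
    refine integrableOn_unit (continuous_const.mul (Continuous.mul ?_ (B.continuous_fam _ _ _)))
    exact continuous_finsetSum _ fun m _ => continuous_const.mul (B.continuous_fam _ _ _)

theorem CDVBasis.abs_kernel1_le (t : Bool) (j : ℕ) (x y : ℝ) :
    |B.kernel1 t j x y| ≤ B.sumC * B.locC * 2 ^ j := by
  have hK := B.locC_pos
  calc |B.kernel1 t j x y| ≤ ∑ m, |B.fam t j m x| * |B.fam t j m y| := by
        refine (Finset.abs_sum_le_sum_abs _ _).trans (le_of_eq ?_)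
        simp_rw [abs_mul]
    _ ≤ ∑ m, |B.fam t j m x| * (B.locC * √(2 ^ j)) :=
        Finset.sum_le_sum fun m _ =>
          mul_le_mul_of_nonneg_left (B.abs_fam_le t j m y) (abs_nonneg _)
    _ ≤ (B.sumC * √(2 ^ j)) * (B.locC * √(2 ^ j)) := by
        rw [← Finset.sum_mul]
        exact mul_le_mul_of_nonneg_right (B.sum_abs_fam_le t j x) (by positivity)
    _ = B.sumC * B.locC * 2 ^ j := by
        have : √((2 : ℝ) ^ j) * √(2 ^ j) = 2 ^ j := Real.mul_self_sqrt (by positivity)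
        linear_combination B.sumC * B.locC * this

theorem CDVBasis.kernel1_support (t : Bool) (j : ℕ) (x y : ℝ) (h : B.kernel1 t j x y ≠ 0) :
    |x - y| ≤ 2 * B.locC / 2 ^ j := by
  obtain ⟨m, _, hm⟩ := Finset.exists_ne_zero_of_sum_ne_zero h
  have h1 := abs_le.1 (B.fam_support t j m x (left_ne_zero_of_mul hm))
  have h2 := abs_le.1 (B.fam_support t j m y (right_ne_zero_of_mul hm))
  have h3 : (0 : ℝ) < 2 ^ j := by positivity
  rw [le_div_iff₀ h3]
  nth_rw 1 [← abs_of_pos h3]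
  rw [← abs_mul, abs_le]
  constructor <;> linarith [h1.1, h1.2, h2.1, h2.2]

/-- The constant in the uniform `L¹` bound on the kernels. -/
def CDVBasis.L1C : ℝ := 2 * B.locC ^ 2 * B.sumC

/-- The factor `2^{j/2}` from the sum at `x` cancels the `2^{-j/2}` from the `L¹` norms, which makes
the bound uniform in `j`. -/
theorem CDVBasis.integral_abs_kernel1_le (t : Bool) (j : ℕ) (x : ℝ) :
    ∫ y in Icc (0 : ℝ) 1, |B.kernel1 t j x y| ≤ B.L1C := by
  have hK := B.locC_pos
  have hs : 0 < √((2 : ℝ) ^ j) := Real.sqrt_pos.2 (by positivity)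
  have hc : ∀ m, Continuous fun y => |B.fam t j m x| * |B.fam t j m y| := fun m =>
    continuous_const.mul (B.continuous_fam _ _ _).abs
  calc ∫ y in Icc (0 : ℝ) 1, |B.kernel1 t j x y|
      ≤ ∫ y in Icc (0 : ℝ) 1, ∑ m, |B.fam t j m x| * |B.fam t j m y| := by
        refine integral_mono (integrableOn_unit ?_) (integrableOn_unit ?_) fun y => ?_
        · exact (continuous_finsetSum _ fun m _ =>
            continuous_const.mul (B.continuous_fam _ _ _)).abs
        · exact continuous_finsetSum _ fun m _ => hc m
        · refine (Finset.abs_sum_le_sum_abs _ _).trans (le_of_eq ?_)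
          simp_rw [abs_mul]
    _ = ∑ m, |B.fam t j m x| * ∫ y in Icc (0 : ℝ) 1, |B.fam t j m y| := by
        rw [integral_finsetSum _ fun m _ => integrableOn_unit (hc m)]
        simp_rw [integral_const_mul]
    _ ≤ ∑ m, |B.fam t j m x| * (2 * B.locC ^ 2 / √(2 ^ j)) :=
        Finset.sum_le_sum fun m _ =>
          mul_le_mul_of_nonneg_left (B.integral_abs_fam_le t j m) (abs_nonneg _)
    _ ≤ (B.sumC * √(2 ^ j)) * (2 * B.locC ^ 2 / √(2 ^ j)) := by
        rw [← Finset.sum_mul]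
        exact mul_le_mul_of_nonneg_right (B.sum_abs_fam_le t j x) (by positivity)
    _ = B.L1C := by unfold CDVBasis.L1C; field_simp

/-- The constant in the lower bound on the diagonal of the kernels. -/
def CDVBasis.diagC : ℝ := ((2 * B.locC + 1) * (2 * B.locC ^ 2) ^ 2)⁻¹

theorem CDVBasis.diagC_pos : 0 < B.diagC := by
  have := B.locC_pos
  unfold CDVBasis.diagC; positivity

theorem CDVBasis.memV_one (hS : 0 < S) {j : ℕ} (hj : B.J₀ ≤ j) : B.MemV j (fun _ => 1) := by
  simpa using B.poly_mem j hj 0 hS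

/-- Constants belong to `V_j`, so `1 = ∑ c_m φ_{jm}(x)` with `|c_m| = O(2^{-j/2})`, and boundedly
many terms are nonzero. Cauchy-Schwarz over those terms then forces `∑ φ_{jm}(x)² ≳ 2^j`; this lower
bound is what makes the variance lower bounds possible. -/
theorem CDVBasis.le_kernel1_diag (hS : 0 < S) {j : ℕ} (hj : B.J₀ ≤ j) {x : ℝ}
    (hx : x ∈ Icc (0 : ℝ) 1) : B.diagC * 2 ^ j ≤ B.kernel1 false j x x := by
  have hK := B.locC_pos
  have hp : (0 : ℝ) < 2 ^ j := by positivity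
  have hs : √((2 : ℝ) ^ j) ^ 2 = 2 ^ j := Real.sq_sqrt (by positivity)
  set c : Fin (2 ^ j) → ℝ := fun m => ∫ y in Icc (0 : ℝ) 1, 1 * B.fam false j m y
  have h1 : (1 : ℝ) = ∑ m, c m * B.fam false j m x := B.memV_coeff hj (B.memV_one hS hj) x hx
  have hc : ∀ m, c m ^ 2 ≤ (2 * B.locC ^ 2) ^ 2 / 2 ^ j := by
    intro m
    have : |c m| ≤ 2 * B.locC ^ 2 / √(2 ^ j) := by
      refine le_trans ?_ (B.integral_abs_fam_le false j m)
      simp only [c, one_mul]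
      exact abs_integral_le_integral_abs
    rw [← hs, ← div_pow, ← sq_abs]
    exact pow_le_pow_left₀ (abs_nonneg _) this 2
  set T := Finset.univ.filter fun m : Fin (2 ^ j) => B.fam false j m x ≠ 0
  have h2 : (1 : ℝ) = ∑ m ∈ T, c m * B.fam false j m x := by
    rw [h1, Finset.sum_filter]
    refine Finset.sum_congr rfl fun m _ => ?_
    split_ifs with h
    · rfl
    · simp only [not_not] at h; simp [h]
  have h3 : ∑ m ∈ T, c m ^ 2 ≤ (2 * B.locC + 1) * ((2 * B.locC ^ 2) ^ 2 / 2 ^ j) := by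
    refine (Finset.sum_le_card_nsmul _ _ _ fun m _ => hc m).trans ?_
    rw [nsmul_eq_mul]
    exact mul_le_mul_of_nonneg_right (B.card_fam_ne_zero_le false j x) (by positivity)
  have h4 : ∑ m ∈ T, B.fam false j m x ^ 2 ≤ B.kernel1 false j x x := by
    simp_rw [CDVBasis.kernel1, ← sq]
    exact Finset.sum_le_sum_of_subset_of_nonneg (Finset.filter_subset _ _)
      fun _ _ _ => sq_nonneg _
  have h5 : (1 : ℝ) ≤ (2 * B.locC + 1) * ((2 * B.locC ^ 2) ^ 2 / 2 ^ j) * B.kernel1 false j x x := by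
    calc (1 : ℝ) = (∑ m ∈ T, c m * B.fam false j m x) ^ 2 := by rw [← h2, one_pow]
      _ ≤ (∑ m ∈ T, c m ^ 2) * ∑ m ∈ T, B.fam false j m x ^ 2 := Finset.sum_mul_sq_le_sq_mul_sq _ _ _
      _ ≤ _ := mul_le_mul h3 h4 (Finset.sum_nonneg fun _ _ => sq_nonneg _) (by positivity)
  unfold CDVBasis.diagC
  rw [inv_mul_le_iff₀ (by positivity)]
  calc (2 : ℝ) ^ j = 2 ^ j * 1 := (mul_one _).symm
    _ ≤ 2 ^ j * ((2 * B.locC + 1) * ((2 * B.locC ^ 2) ^ 2 / 2 ^ j) * B.kernel1 false j x x) :=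
        mul_le_mul_of_nonneg_left h5 hp.le
    _ = _ := by field_simp

end OneDim

/-! ### Tensor-product bases on the cube -/

theorem volume_restrict_cube (d : ℕ) : (volume.restrict (cube d) : Measure (Fin d → ℝ)) =
    Measure.pi fun _ : Fin d => (volume : Measure ℝ).restrict (Icc 0 1) := by
  rw [← Measure.restrict_pi_pi, ← volume_pi]
  congr 1
  exact (pi_univ_Icc (0 : Fin d → ℝ) 1).symm

instance isProbabilityMeasure_unit :
    IsProbabilityMeasure ((volume : Measure ℝ).restrict (Icc 0 1)) :=
  ⟨by simp⟩

instance isProbabilityMeasure_cube (d : ℕ) :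
    IsProbabilityMeasure (volume.restrict (cube d) : Measure (Fin d → ℝ)) := by
  rw [volume_restrict_cube]; infer_instance

theorem integral_cube_prod {d : ℕ} (f : Fin d → ℝ → ℝ) :
    ∫ x in cube d, ∏ i, f i (x i) = ∏ i, ∫ x in Icc (0 : ℝ) 1, f i x := by
  rw [volume_restrict_cube]
  exact integral_fintype_prod_eq_prod f

theorem measurableSet_cube (d : ℕ) : MeasurableSet (cube d) := measurableSet_Icc

theorem isCompact_cube (d : ℕ) : IsCompact (cube d) := isCompact_Icc

theorem mem_cube_apply {d : ℕ} {x : Fin d → ℝ} (hx : x ∈ cube d) (i : Fin d) :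
    x i ∈ Icc (0 : ℝ) 1 := ⟨hx.1 i, hx.2 i⟩

theorem integrable_cube {d : ℕ} {f : (Fin d → ℝ) → ℝ} (hf : ContinuousOn f (cube d)) :
    Integrable f (volume.restrict (cube d)) :=
  hf.integrableOn_compact (isCompact_cube d)

section Tensor

variable {S : ℕ} (B : CDVBasis S) {d : ℕ}

theorem CDVBasis.Psi_eq (l : ℕ) (ι : Fin d → Bool) (m : Fin d → Fin (2 ^ l)) (x : Fin d → ℝ) :
    B.Psi l ι m x = ∏ i, B.fam (ι i) l (m i) (x i) := rfl

theorem CDVBasis.Phi_eq (l : ℕ) (m : Fin d → Fin (2 ^ l)) :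
    B.Phi l m = B.Psi l (fun _ => false) m := by
  funext x; simp [CDVBasis.Phi, CDVBasis.Psi]

theorem CDVBasis.continuous_Psi (l : ℕ) (ι : Fin d → Bool) (m : Fin d → Fin (2 ^ l)) :
    Continuous (B.Psi l ι m) :=
  continuous_finsetProd _ fun i _ => (B.continuous_fam (ι i) l (m i)).comp (continuous_apply i)

theorem CDVBasis.continuous_Phi (l : ℕ) (m : Fin d → Fin (2 ^ l)) : Continuous (B.Phi l m) := by
  rw [B.Phi_eq]; exact B.continuous_Psi _ _ _

theorem CDVBasis.sum_abs_Psi_le (l : ℕ) (ι : Fin d → Bool) (x : Fin d → ℝ) :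
    ∑ m, |B.Psi l ι m x| ≤ (B.sumC * √(2 ^ l)) ^ d := by
  simp_rw [B.Psi_eq, Finset.abs_prod]
  have h := Finset.prod_univ_sum (fun _ : Fin d => (Finset.univ : Finset (Fin (2 ^ l))))
    (fun i m => |B.fam (ι i) l m (x i)|)
  rw [Fintype.piFinset_univ] at h
  rw [← h]
  refine (Finset.prod_le_prod (fun i _ => Finset.sum_nonneg fun _ _ => abs_nonneg _)
    fun i _ => B.sum_abs_fam_le (ι i) l (x i)).trans (le_of_eq ?_)
  simp

theorem CDVBasis.inner2_Psi_Psi {l : ℕ} (hl : B.J₀ ≤ l) (ι ι' : Fin d → Bool)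
    (m m' : Fin d → Fin (2 ^ l)) :
    inner2 (B.Psi l ι m) (B.Psi l ι' m') = if ι = ι' ∧ m = m' then 1 else 0 := by
  simp_rw [inner2, B.Psi_eq, ← Finset.prod_mul_distrib]
  rw [integral_cube_prod (fun i t => B.fam (ι i) l (m i) t * B.fam (ι' i) l (m' i) t)]
  simp_rw [B.integral_fam_mul _ _ hl]
  rw [Finset.prod_ite_zero]
  simp [funext_iff, forall_and]

/-- The integral factors over coordinates. In a coordinate where the finer function is a wavelet,
the coarser factor lies in `V_{l'}`, so that one-dimensional factor vanishes. -/
theorem CDVBasis.inner2_Psi_Psi_of_lt {l l' : ℕ} (hl : B.J₀ ≤ l) (hll' : l < l')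
    (ι ι' : Fin d → Bool) (hι' : ι' ≠ fun _ => false) (m : Fin d → Fin (2 ^ l))
    (m' : Fin d → Fin (2 ^ l')) : inner2 (B.Psi l ι m) (B.Psi l' ι' m') = 0 := by
  simp_rw [inner2, B.Psi_eq, ← Finset.prod_mul_distrib]
  rw [integral_cube_prod (fun i t => B.fam (ι i) l (m i) t * B.fam (ι' i) l' (m' i) t)]
  obtain ⟨i, hi⟩ : ∃ i, ι' i = true := by
    by_contra! h
    exact hι' (funext fun i => by simpa using h i)
  refine Finset.prod_eq_zero (Finset.mem_univ i) ?_
  rw [hi]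
  exact B.integral_memV_mul_wav (hl.trans hll'.le)
    (B.memV_mono (hl.trans l.le_succ) hll' (B.memV_fam (ι i) hl (m i))) (m' i)

theorem inner2_comm (g h : (Fin d → ℝ) → ℝ) : inner2 g h = inner2 h g := by
  simp_rw [inner2, mul_comm]

theorem CDVBasis.inner2_Phi_Psi {l l' : ℕ} (hl : B.J₀ ≤ l) (hll' : l ≤ l')
    (ι' : Fin d → Bool) (hι' : ι' ≠ fun _ => false) (m : Fin d → Fin (2 ^ l))
    (m' : Fin d → Fin (2 ^ l')) : inner2 (B.Phi l m) (B.Psi l' ι' m') = 0 := by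
  rw [B.Phi_eq]
  rcases hll'.lt_or_eq with h | rfl
  · exact B.inner2_Psi_Psi_of_lt hl h _ _ hι' _ _
  · rw [B.inner2_Psi_Psi hl, if_neg]
    exact fun h => hι' h.1.symm

/-- Projection kernel onto the span of the `Ψ^ι_{lm}`. -/
def CDVBasis.psiKer (l : ℕ) (ι : Fin d → Bool) (x y : Fin d → ℝ) : ℝ :=
  ∑ m, B.Psi l ι m x * B.Psi l ι m y

theorem CDVBasis.psiKer_eq_prod (l : ℕ) (ι : Fin d → Bool) (x y : Fin d → ℝ) :
    B.psiKer l ι x y = ∏ i, B.kernel1 (ι i) l (x i) (y i) := by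
  simp_rw [CDVBasis.psiKer, B.Psi_eq, ← Finset.prod_mul_distrib, CDVBasis.kernel1]
  rw [Finset.prod_univ_sum, Fintype.piFinset_univ]

theorem CDVBasis.kernel_eq_psiKer (j : ℕ) (x y : Fin d → ℝ) :
    B.kernel j x y = B.psiKer j (fun _ => false) x y := by
  simp_rw [CDVBasis.kernel, CDVBasis.psiKer, B.Phi_eq]

theorem CDVBasis.kernel_eq_prod (j : ℕ) (x y : Fin d → ℝ) :
    B.kernel j x y = ∏ i, B.kernel1 false j (x i) (y i) := by
  rw [B.kernel_eq_psiKer, B.psiKer_eq_prod]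

/-- Each coordinate kernel splits in two by `kernel1_succ`; expanding the product indexes the terms
by `ι`. -/
theorem CDVBasis.kernel_succ {j : ℕ} (hj : B.J₀ ≤ j) {x y : Fin d → ℝ} (hx : x ∈ cube d)
    (hy : y ∈ cube d) : B.kernel (j + 1) x y = ∑ ι, B.psiKer j ι x y := by
  simp_rw [B.kernel_eq_prod, B.psiKer_eq_prod]
  have h := Finset.prod_univ_sum (fun _ : Fin d => (Finset.univ : Finset Bool))
    (fun i t => B.kernel1 t j (x i) (y i))
  rw [Fintype.piFinset_univ] at h
  rw [← h]
  refine Finset.prod_congr rfl fun i _ => ?_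
  rw [B.kernel1_succ hj (mem_cube_apply hx i) (mem_cube_apply hy i), Fintype.sum_bool, add_comm]

theorem CDVBasis.kernel_comm (j : ℕ) (x y : Fin d → ℝ) : B.kernel j x y = B.kernel j y x :=
  Finset.sum_congr rfl fun _ _ => mul_comm _ _

theorem CDVBasis.continuous_kernel (j : ℕ) :
    Continuous fun z : (Fin d → ℝ) × (Fin d → ℝ) => B.kernel j z.1 z.2 :=
  continuous_finsetSum _ fun m _ =>
    ((B.continuous_Phi j m).comp continuous_fst).mul ((B.continuous_Phi j m).comp continuous_snd)

theorem CDVBasis.continuous_kernel_right (j : ℕ) (x : Fin d → ℝ) : Continuous (B.kernel j x) :=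
  continuous_finsetSum _ fun m _ => continuous_const.mul (B.continuous_Phi j m)

theorem CDVBasis.integral_kernel_kernel_of_le {j j' : ℕ} (hj : B.J₀ ≤ j) (hjj' : j ≤ j')
    (x : Fin d → ℝ) {y : Fin d → ℝ} (hy : y ∈ cube d) :
    ∫ z in cube d, B.kernel j x z * B.kernel j' y z = B.kernel j x y := by
  simp_rw [B.kernel_eq_prod, ← Finset.prod_mul_distrib]
  rw [integral_cube_prod (fun i t => B.kernel1 false j (x i) t * B.kernel1 false j' (y i) t)]
  exact Finset.prod_congr rfl fun i _ =>
    B.integral_kernel1_kernel1 hj hjj' (x i) (mem_cube_apply hy i)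

theorem CDVBasis.integral_kernel_kernel {j j' : ℕ} (hj : B.J₀ ≤ j) (hj' : B.J₀ ≤ j')
    {x y : Fin d → ℝ} (hx : x ∈ cube d) (hy : y ∈ cube d) :
    ∫ z in cube d, B.kernel j x z * B.kernel j' y z = B.kernel (min j j') x y := by
  rcases le_total j j' with h | h
  · rw [min_eq_left h, B.integral_kernel_kernel_of_le hj h x hy]
  · rw [min_eq_right h, B.kernel_comm, ← B.integral_kernel_kernel_of_le hj' h y hx]
    simp_rw [mul_comm]

theorem CDVBasis.integral_kernel_sq {j : ℕ} (hj : B.J₀ ≤ j) {x : Fin d → ℝ} (hx : x ∈ cube d) :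
    ∫ z in cube d, B.kernel j x z ^ 2 = B.kernel j x x := by
  simp_rw [sq]
  exact B.integral_kernel_kernel_of_le hj le_rfl x hx

/-- The `d`-dimensional upper bound constant for the size of the kernels. -/
def CDVBasis.supC (d : ℕ) : ℝ := (B.sumC * B.locC) ^ d

theorem CDVBasis.supC_pos (d : ℕ) : 0 < B.supC d := by
  have := B.sumC_pos; have := B.locC_pos
  unfold CDVBasis.supC; positivity

theorem CDVBasis.abs_kernel_le (j : ℕ) (x y : Fin d → ℝ) :
    |B.kernel j x y| ≤ B.supC d * res d j := by
  rw [B.kernel_eq_prod, Finset.abs_prod]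
  refine (Finset.prod_le_prod (fun _ _ => abs_nonneg _)
    fun i _ => B.abs_kernel1_le false j (x i) (y i)).trans (le_of_eq ?_)
  simp [CDVBasis.supC, res, mul_pow, pow_mul]

theorem CDVBasis.kernel_support (j : ℕ) (x y : Fin d → ℝ) (h : B.kernel j x y ≠ 0) :
    dist x y ≤ 2 * B.locC / 2 ^ j := by
  have hK := B.locC_pos
  rw [B.kernel_eq_prod, Finset.prod_ne_zero_iff] at h
  refine (dist_pi_le_iff (by positivity)).2 fun i => ?_
  rw [Real.dist_eq]
  exact B.kernel1_support false j _ _ (h i (Finset.mem_univ i))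

theorem CDVBasis.integral_abs_kernel_le (j : ℕ) (x : Fin d → ℝ) :
    ∫ y in cube d, |B.kernel j x y| ≤ B.L1C ^ d := by
  simp_rw [B.kernel_eq_prod, Finset.abs_prod]
  rw [integral_cube_prod (fun i t => |B.kernel1 false j (x i) t|)]
  refine (Finset.prod_le_prod (fun _ _ => integral_nonneg fun _ => abs_nonneg _)
    fun i _ => B.integral_abs_kernel1_le false j (x i)).trans (le_of_eq ?_)
  simp

theorem CDVBasis.le_kernel_diag (hS : 0 < S) {j : ℕ} (hj : B.J₀ ≤ j) {x : Fin d → ℝ}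
    (hx : x ∈ cube d) : B.diagC ^ d * res d j ≤ B.kernel j x x := by
  have hK := B.diagC_pos
  rw [B.kernel_eq_prod]
  refine le_trans (le_of_eq ?_) (Finset.prod_le_prod (fun _ _ => by positivity)
    fun i _ => B.le_kernel1_diag hS hj (mem_cube_apply hx i))
  simp [res, mul_pow, pow_mul]

theorem CDVBasis.integral_kernel_Psi {l j : ℕ} (hl : B.J₀ ≤ l) (hlj : l < j) (ι : Fin d → Bool)
    (m : Fin d → Fin (2 ^ l)) {x : Fin d → ℝ} (hx : x ∈ cube d) :
    ∫ y in cube d, B.Psi l ι m y * B.kernel j x y = B.Psi l ι m x := by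
  simp_rw [B.kernel_eq_prod, B.Psi_eq, ← Finset.prod_mul_distrib]
  rw [integral_cube_prod (fun i t => B.fam (ι i) l (m i) t * B.kernel1 false j (x i) t)]
  refine Finset.prod_congr rfl fun i _ => ?_
  rw [← B.integral_kernel1_mul (hl.trans hlj.le)
    (B.memV_mono (hl.trans l.le_succ) hlj (B.memV_fam (ι i) hl (m i)))
    (B.continuous_fam _ _ _).continuousOn (mem_cube_apply hx i)]
  simp_rw [mul_comm]

theorem CDVBasis.integral_kernel_Phi {l j : ℕ} (hl : B.J₀ ≤ l) (hlj : l ≤ j)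
    (m : Fin d → Fin (2 ^ l)) {x : Fin d → ℝ} (hx : x ∈ cube d) :
    ∫ y in cube d, B.Phi l m y * B.kernel j x y = B.Phi l m x := by
  simp_rw [B.Phi_eq, B.kernel_eq_prod, B.Psi_eq, ← Finset.prod_mul_distrib]
  rw [integral_cube_prod (fun i t => B.fam false l (m i) t * B.kernel1 false j (x i) t)]
  refine Finset.prod_congr rfl fun i _ => ?_
  rw [← B.integral_kernel1_mul (hl.trans hlj)
    (B.memV_mono hl hlj (B.memV_scal l (m i)))
    (B.continuous_fam _ _ _).continuousOn (mem_cube_apply hx i)]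
  simp_rw [mul_comm]

theorem CDVBasis.integral_kernel (hS : 0 < S) {j : ℕ} (hj : B.J₀ ≤ j) {x : Fin d → ℝ}
    (hx : x ∈ cube d) : ∫ y in cube d, B.kernel j x y = 1 := by
  simp_rw [B.kernel_eq_prod]
  rw [integral_cube_prod (fun i t => B.kernel1 false j (x i) t)]
  refine Finset.prod_eq_one fun i _ => ?_
  have := B.integral_kernel1_mul hj (B.memV_one hS hj) continuousOn_const (mem_cube_apply hx i)
  simpa using this

/-- The orthogonal projection onto `V_j`. -/
def CDVBasis.proj (j : ℕ) (u : (Fin d → ℝ) → ℝ) (x : Fin d → ℝ) : ℝ :=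
  ∫ y in cube d, u y * B.kernel j x y

theorem CDVBasis.proj_eq_sum (j : ℕ) {u : (Fin d → ℝ) → ℝ} (hu : ContinuousOn u (cube d))
    (x : Fin d → ℝ) : B.proj j u x = ∑ m, inner2 u (B.Phi j m) * B.Phi j m x := by
  simp_rw [CDVBasis.proj, CDVBasis.kernel, Finset.mul_sum]
  rw [integral_finsetSum]
  · refine Finset.sum_congr rfl fun m _ => ?_
    rw [inner2, ← integral_mul_const]
    congr 1; ext y; ring
  · exact fun m _ => integrable_cube (hu.mul
      (continuous_const.mul (B.continuous_Phi j m)).continuousOn)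

theorem CDVBasis.continuous_proj (j : ℕ) {u : (Fin d → ℝ) → ℝ} (hu : ContinuousOn u (cube d)) :
    Continuous (B.proj j u) := by
  have : B.proj j u = fun x => ∑ m, inner2 u (B.Phi j m) * B.Phi j m x :=
    funext (B.proj_eq_sum j hu)
  rw [this]
  exact continuous_finsetSum _ fun m _ => continuous_const.mul (B.continuous_Phi j m)

theorem CDVBasis.L1C_pos : 0 < B.L1C := by
  have := B.locC_pos; have := B.sumC_pos
  unfold CDVBasis.L1C; positivity

/-- The kernels form an approximate identity: integral one, uniformly bounded `L¹` norm, support of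
radius `O(2^{-j})`. Uniform continuity on the cube finishes the argument. -/
theorem CDVBasis.proj_uniform (hS : 0 < S) {u : (Fin d → ℝ) → ℝ} (hu : ContinuousOn u (cube d))
    {ε : ℝ} (hε : 0 < ε) : ∃ J, B.J₀ ≤ J ∧ ∀ j ≥ J, ∀ x ∈ cube d, |B.proj j u x - u x| ≤ ε := by
  have hL := B.L1C_pos
  have huc := (isCompact_cube d).uniformContinuousOn_of_continuous hu
  obtain ⟨δ, hδ, hd⟩ := Metric.uniformContinuousOn_iff.1 huc (ε / B.L1C ^ d) (by positivity)
  have ht : Tendsto (fun j : ℕ => 2 * B.locC / (2 : ℝ) ^ j) atTop (𝓝 0) :=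
    tendsto_const_nhds.div_atTop (tendsto_pow_atTop_atTop_of_one_lt one_lt_two)
  obtain ⟨J, hJ⟩ := eventually_atTop.1 (ht.eventually_lt_const hδ)
  refine ⟨max J B.J₀, le_max_right _ _, fun j hj x hx => ?_⟩
  have hj0 : B.J₀ ≤ j := (le_max_right _ _).trans hj
  have hKc := B.continuous_kernel_right j x
  have h1 : B.proj j u x - u x = ∫ y in cube d, (u y - u x) * B.kernel j x y := by
    simp_rw [sub_mul]
    rw [integral_sub, integral_const_mul, B.integral_kernel hS hj0 hx, mul_one]
    · rfl
    · exact integrable_cube (hu.mul hKc.continuousOn)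
    · exact integrable_cube (continuous_const.mul hKc).continuousOn
  rw [h1]
  calc |∫ y in cube d, (u y - u x) * B.kernel j x y|
      ≤ ∫ y in cube d, |(u y - u x) * B.kernel j x y| := abs_integral_le_integral_abs
    _ ≤ ∫ y in cube d, (ε / B.L1C ^ d) * |B.kernel j x y| := by
        refine setIntegral_mono_on ?_ ?_ (measurableSet_cube d) fun y hy => ?_
        · exact integrable_cube ((hu.sub continuousOn_const).mul hKc.continuousOn).abs
        · exact integrable_cube (continuous_const.mul hKc.abs).continuousOn
        · rw [abs_mul]
          by_cases h : B.kernel j x y = 0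
          · simp [h]
          · refine mul_le_mul_of_nonneg_right ?_ (abs_nonneg _)
            have h2 := B.kernel_support j x y h
            have h3 := hd y hy x hx (by
              rw [dist_comm]; exact h2.trans_lt (hJ j ((le_max_left _ _).trans hj)))
            rw [Real.dist_eq] at h3
            exact h3.le
    _ ≤ ε / B.L1C ^ d * B.L1C ^ d := by
        rw [integral_const_mul]
        exact mul_le_mul_of_nonneg_left (B.integral_abs_kernel_le j x) (by positivity)
    _ = ε := by field_simp

/-- The `L²` inner product of the residuals of `u` and `v` after projection onto `V_j`. -/
def CDVBasis.gap (j : ℕ) (u v : (Fin d → ℝ) → ℝ) : ℝ := inner2 u v - inner2 (B.proj j u) v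

/-- The contribution of the wavelets at level `l` to the inner product of `u` and `v`. -/
def CDVBasis.lev (l : ℕ) (u v : (Fin d → ℝ) → ℝ) : ℝ :=
  ∑ ι ∈ Finset.univ.filter (fun ι : Fin d → Bool => ι ≠ fun _ => false),
    ∑ m, inner2 u (B.Psi l ι m) * inner2 v (B.Psi l ι m)

theorem integral_mul_psiKer (l : ℕ) (ι : Fin d → Bool) {u : (Fin d → ℝ) → ℝ}
    (hu : ContinuousOn u (cube d)) (x : Fin d → ℝ) :
    ∫ y in cube d, u y * B.psiKer l ι x y = ∑ m, inner2 u (B.Psi l ι m) * B.Psi l ι m x := by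
  simp_rw [CDVBasis.psiKer, Finset.mul_sum]
  rw [integral_finsetSum]
  · refine Finset.sum_congr rfl fun m _ => ?_
    rw [inner2, ← integral_mul_const]
    congr 1; ext y; ring
  · exact fun m _ => integrable_cube (hu.mul
      (continuous_const.mul (B.continuous_Psi l ι m)).continuousOn)

theorem CDVBasis.continuous_psiKer_right (l : ℕ) (ι : Fin d → Bool) (x : Fin d → ℝ) :
    Continuous (B.psiKer l ι x) :=
  continuous_finsetSum _ fun m _ => continuous_const.mul (B.continuous_Psi l ι m)

theorem inner2_sum_left {κ : Type*} (s : Finset κ) (f : κ → (Fin d → ℝ) → ℝ) (v : (Fin d → ℝ) → ℝ)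
    (hf : ∀ k ∈ s, ContinuousOn (f k) (cube d)) (hv : ContinuousOn v (cube d)) :
    inner2 (fun x => ∑ k ∈ s, f k x) v = ∑ k ∈ s, inner2 (f k) v := by
  simp_rw [inner2, Finset.sum_mul]
  exact integral_finsetSum _ fun k hk => integrable_cube ((hf k hk).mul hv)

theorem inner2_const_mul_left (c : ℝ) (u v : (Fin d → ℝ) → ℝ) :
    inner2 (fun x => c * u x) v = c * inner2 u v := by
  simp_rw [inner2, mul_assoc]
  exact integral_const_mul _ _

theorem inner2_add_left {u u' v : (Fin d → ℝ) → ℝ} (hu : ContinuousOn u (cube d))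
    (hu' : ContinuousOn u' (cube d)) (hv : ContinuousOn v (cube d)) :
    inner2 (fun x => u x + u' x) v = inner2 u v + inner2 u' v := by
  simp_rw [inner2, add_mul]
  exact integral_add (integrable_cube (hu.mul hv)) (integrable_cube (hu'.mul hv))

theorem inner2_congr {u u' v v' : (Fin d → ℝ) → ℝ} (hu : ∀ x ∈ cube d, u x = u' x)
    (hv : ∀ x ∈ cube d, v x = v' x) : inner2 u v = inner2 u' v' :=
  setIntegral_congr_fun (measurableSet_cube d) fun x hx => by simp only [hu x hx, hv x hx]

theorem CDVBasis.inner2_proj_left (j : ℕ) {u v : (Fin d → ℝ) → ℝ} (hu : ContinuousOn u (cube d))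
    (hv : ContinuousOn v (cube d)) :
    inner2 (B.proj j u) v = ∑ m, inner2 u (B.Phi j m) * inner2 v (B.Phi j m) := by
  rw [inner2_congr (fun x _ => B.proj_eq_sum j hu x) (fun x _ => rfl), inner2_sum_left]
  · exact Finset.sum_congr rfl fun m _ => by
      rw [inner2_const_mul_left, inner2_comm (B.Phi j m) v]
  · exact fun m _ => (continuous_const.mul (B.continuous_Phi j m)).continuousOn
  · exact hv

/-- In the expansion of `Π_{j+1}` over `ι`, the type `ι = 0` is `Π_j`; the remaining types make up
`lev`. -/
theorem CDVBasis.gap_eq_gap_succ_add_lev {j : ℕ} (hj : B.J₀ ≤ j) {u v : (Fin d → ℝ) → ℝ}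
    (hu : ContinuousOn u (cube d)) (hv : ContinuousOn v (cube d)) :
    B.gap j u v = B.gap (j + 1) u v + B.lev j u v := by
  have h1 : ∀ x ∈ cube d, B.proj (j + 1) u x =
      ∑ ι, ∑ m, inner2 u (B.Psi j ι m) * B.Psi j ι m x := by
    intro x hx
    have h2 : B.proj (j + 1) u x = ∫ y in cube d, ∑ ι, u y * B.psiKer j ι x y :=
      setIntegral_congr_fun (measurableSet_cube d) fun y hy => by
        simp only [B.kernel_succ hj hx hy, Finset.mul_sum]
    rw [h2, integral_finsetSum]
    · exact Finset.sum_congr rfl fun ι _ => integral_mul_psiKer B j ι hu x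
    · exact fun ι _ => integrable_cube (hu.mul (B.continuous_psiKer_right j ι x).continuousOn)
  have h3 : inner2 (B.proj (j + 1) u) v =
      ∑ ι, ∑ m, inner2 u (B.Psi j ι m) * inner2 v (B.Psi j ι m) := by
    rw [inner2_congr h1 (fun x _ => rfl), inner2_sum_left]
    · refine Finset.sum_congr rfl fun ι _ => ?_
      rw [inner2_sum_left]
      · exact Finset.sum_congr rfl fun m _ => by
          rw [inner2_const_mul_left, inner2_comm (B.Psi j ι m) v]
      · exact fun m _ => (continuous_const.mul (B.continuous_Psi j ι m)).continuousOn
      · exact hv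
    · exact fun ι _ => (continuous_finsetSum _ fun m _ =>
        continuous_const.mul (B.continuous_Psi j ι m)).continuousOn
    · exact hv
  rw [CDVBasis.gap, CDVBasis.gap, h3, B.inner2_proj_left j hu hv, CDVBasis.lev,
    ← Finset.sum_filter_add_sum_filter_not Finset.univ
      (fun ι : Fin d → Bool => ι ≠ fun _ => false)]
  simp only [ne_eq, not_not, Finset.filter_eq', Finset.mem_univ, if_true, Finset.sum_singleton,
    B.Phi_eq]
  ring

theorem CDVBasis.tendsto_gap (hS : 0 < S) {u v : (Fin d → ℝ) → ℝ}
    (hu : ContinuousOn u (cube d)) (hv : ContinuousOn v (cube d)) :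
    Tendsto (fun j => B.gap j u v) atTop (𝓝 0) := by
  rw [Metric.tendsto_atTop]
  intro ε hε
  set I : ℝ := ∫ x in cube d, |v x|
  have hI : 0 ≤ I := integral_nonneg fun _ => abs_nonneg _
  -- The `+ 1` covers `I = 0` and makes the final inequality strict.
  obtain ⟨J, -, hJ⟩ := B.proj_uniform hS hu (ε := ε / (I + 1)) (by positivity)
  refine ⟨J, fun j hj => ?_⟩
  rw [Real.dist_eq, sub_zero]
  have hpc := (B.continuous_proj j hu).continuousOn (s := cube d)
  have h1 : B.gap j u v = ∫ x in cube d, (u x - B.proj j u x) * v x := by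
    simp_rw [sub_mul]
    rw [integral_sub]
    · rfl
    · exact integrable_cube (hu.mul hv)
    · exact integrable_cube (hpc.mul hv)
  rw [h1]
  calc |∫ x in cube d, (u x - B.proj j u x) * v x|
      ≤ ∫ x in cube d, |(u x - B.proj j u x) * v x| := abs_integral_le_integral_abs
    _ ≤ ∫ x in cube d, ε / (I + 1) * |v x| := by
        refine setIntegral_mono_on ?_ ?_ (measurableSet_cube d) fun x hx => ?_
        · exact integrable_cube ((hu.sub hpc).mul hv).abs
        · exact integrable_cube (continuousOn_const.mul hv.abs)
        · rw [abs_mul, abs_sub_comm]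
          exact mul_le_mul_of_nonneg_right (hJ j hj x hx) (abs_nonneg _)
    _ = ε / (I + 1) * I := integral_const_mul _ _
    _ < ε := by
        rw [div_mul_eq_mul_div, div_lt_iff₀ (by linarith)]
        nlinarith

theorem CDVBasis.gap_eq_gap_add_sum_lev {j : ℕ} (hj : B.J₀ ≤ j) {u v : (Fin d → ℝ) → ℝ}
    (hu : ContinuousOn u (cube d)) (hv : ContinuousOn v (cube d)) (n : ℕ) :
    B.gap j u v = B.gap (j + n) u v + ∑ l ∈ Finset.range n, B.lev (j + l) u v := by
  induction n with
  | zero => simp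
  | succ n ih =>
    rw [ih, B.gap_eq_gap_succ_add_lev (hj.trans (Nat.le_add_right j n)) hu hv,
      Finset.sum_range_succ, add_assoc j n 1]
    ring

/-- Telescoping together with `tendsto_gap`. Convergence of the partial sums is all that the upper
and lower bounds on the gap require. -/
theorem CDVBasis.hasSum_lev (hS : 0 < S) {j : ℕ} (hj : B.J₀ ≤ j) {u v : (Fin d → ℝ) → ℝ}
    (hu : ContinuousOn u (cube d)) (hv : ContinuousOn v (cube d)) :
    Tendsto (fun n => ∑ l ∈ Finset.range n, B.lev (j + l) u v) atTop (𝓝 (B.gap j u v)) := by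
  have h : (fun n => ∑ l ∈ Finset.range n, B.lev (j + l) u v) =
      fun n => B.gap j u v - B.gap (n + j) u v := by
    funext n
    rw [B.gap_eq_gap_add_sum_lev hj hu hv n, add_comm n j]
    ring
  rw [h]
  simpa using tendsto_const_nhds.sub ((tendsto_add_atTop_iff_nat j).2 (B.tendsto_gap hS hu hv))

theorem CDVBasis.abs_gap_le_of_lev_le (hS : 0 < S) {j : ℕ} (hj : B.J₀ ≤ j)
    {u v : (Fin d → ℝ) → ℝ} (hu : ContinuousOn u (cube d)) (hv : ContinuousOn v (cube d))
    {A r : ℝ} (hA : 0 ≤ A) (hr0 : 0 ≤ r) (hr1 : r < 1)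
    (h : ∀ l ≥ j, |B.lev l u v| ≤ A * r ^ l) : |B.gap j u v| ≤ A * r ^ j / (1 - r) := by
  have ht := (B.hasSum_lev hS hj hu hv).abs
  refine le_of_tendsto' ht fun n => ?_
  calc |∑ l ∈ Finset.range n, B.lev (j + l) u v|
      ≤ ∑ l ∈ Finset.range n, A * r ^ j * r ^ l := by
        refine (Finset.abs_sum_le_sum_abs _ _).trans (Finset.sum_le_sum fun l _ => ?_)
        rw [mul_assoc, ← pow_add]
        exact h _ (Nat.le_add_right j l)
    _ ≤ A * r ^ j * (1 - r)⁻¹ := by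
        rw [← Finset.mul_sum, ← tsum_geometric_of_lt_one hr0 hr1]
        exact mul_le_mul_of_nonneg_left ((summable_geometric_of_lt_one hr0 hr1).sum_le_tsum _
          fun _ _ => by positivity) (by positivity)
    _ = _ := by rw [div_eq_mul_inv]

/-- When no level contributes negatively, the gap is at least any one of its terms. -/
theorem CDVBasis.lev_le_gap (hS : 0 < S) {j : ℕ} (hj : B.J₀ ≤ j)
    {u v : (Fin d → ℝ) → ℝ} (hu : ContinuousOn u (cube d)) (hv : ContinuousOn v (cube d))
    (h : ∀ l ≥ j, 0 ≤ B.lev l u v) {k : ℕ} (hk : j ≤ k) : B.lev k u v ≤ B.gap j u v := by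
  refine ge_of_tendsto (B.hasSum_lev hS hj hu hv) ?_
  filter_upwards [eventually_gt_atTop (k - j)] with n hn
  have := Finset.single_le_sum (f := fun l => B.lev (j + l) u v)
    (fun l _ => h _ (Nat.le_add_right j l)) (Finset.mem_range.2 hn)
  simpa [Nat.add_sub_cancel' hk] using this

theorem CDVBasis.gap_add_mul_right (j : ℕ) {u v w : (Fin d → ℝ) → ℝ}
    (hu : ContinuousOn u (cube d)) (hv : ContinuousOn v (cube d)) (hw : ContinuousOn w (cube d))
    (ε : ℝ) : B.gap j u (fun x => v x + ε * w x) = B.gap j u v + ε * B.gap j u w := by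
  have hp := (B.continuous_proj j hu).continuousOn (s := cube d)
  have hεw : ContinuousOn (fun x => ε * w x) (cube d) := continuousOn_const.mul hw
  simp only [CDVBasis.gap]
  rw [inner2_comm u, inner2_comm (B.proj j u), inner2_add_left hv hεw hu,
    inner2_add_left hv hεw hp, inner2_const_mul_left, inner2_const_mul_left,
    inner2_comm v u, inner2_comm v, inner2_comm w u, inner2_comm w]
  ring

end Tensor

/-! ### Hölder balls -/

section Holder

variable {S : ℕ} (B : CDVBasis S) {d : ℕ}

/-- The coarse and the fine part of the norm get separate budgets because the perturbation built
later spends them differently: a constant affects only the coarse part, a spike only the fine part.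
-/
theorem CDVBasis.exists_bounds_of_mem_holderBall {α M : ℝ} (hM : 0 ≤ M) {h : (Fin d → ℝ) → ℝ}
    (hh : h ∈ B.holderBall d α M) : ∃ M₁ M₂ : ℝ, 0 ≤ M₁ ∧ 0 ≤ M₂ ∧ M₁ + M₂ ≤ M ∧
      (∀ m, (2 : ℝ) ^ ((B.J₀ : ℝ) * (α + d / 2)) * |inner2 h (B.Phi B.J₀ m)| ≤ M₁) ∧
      ∀ l ≥ B.J₀, ∀ ι : Fin d → Bool, (ι ≠ fun _ => false) → ∀ m,
        (2 : ℝ) ^ ((l : ℝ) * (α + d / 2)) * |inner2 h (B.Psi l ι m)| ≤ M₂ := by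
  obtain ⟨-, hn⟩ := hh
  unfold CDVBasis.holderNorm at hn
  set a := ⨆ m : Fin d → Fin (2 ^ B.J₀),
    ENNReal.ofReal ((2 : ℝ) ^ ((B.J₀ : ℝ) * (α + d / 2)) * |inner2 h (B.Phi B.J₀ m)|) with ha
  set b := ⨆ (l : ℕ) (_ : B.J₀ ≤ l) (ι : Fin d → Bool) (_ : ι ≠ fun _ => false)
    (m : Fin d → Fin (2 ^ l)),
    ENNReal.ofReal ((2 : ℝ) ^ ((l : ℝ) * (α + d / 2)) * |inner2 h (B.Psi l ι m)|) with hb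
  have ha' : a ≠ ∞ := ne_top_of_le_ne_top ENNReal.ofReal_ne_top (le_self_add.trans hn)
  have hb' : b ≠ ∞ := ne_top_of_le_ne_top ENNReal.ofReal_ne_top (le_add_self.trans hn)
  refine ⟨a.toReal, b.toReal, ENNReal.toReal_nonneg, ENNReal.toReal_nonneg, ?_, fun m => ?_,
    fun l hl ι hι m => ?_⟩
  · rw [← ENNReal.toReal_add ha' hb']
    exact ENNReal.toReal_le_of_le_ofReal hM hn
  · refine (ENNReal.ofReal_le_iff_le_toReal ha').1 ?_
    exact le_iSup (fun m : Fin d → Fin (2 ^ B.J₀) =>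
      ENNReal.ofReal ((2 : ℝ) ^ ((B.J₀ : ℝ) * (α + d / 2)) * |inner2 h (B.Phi B.J₀ m)|)) m
  · refine (ENNReal.ofReal_le_iff_le_toReal hb').1 ?_
    rw [hb]
    refine le_iSup₂_of_le l hl (le_iSup₂_of_le ι hι ?_)
    exact le_iSup (fun m : Fin d → Fin (2 ^ l) =>
      ENNReal.ofReal ((2 : ℝ) ^ ((l : ℝ) * (α + d / 2)) * |inner2 h (B.Psi l ι m)|)) m

theorem CDVBasis.mem_holderBall_of_bounds {α M M₁ M₂ : ℝ} (h₁ : 0 ≤ M₁) (h₂ : 0 ≤ M₂)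
    (hM : M₁ + M₂ ≤ M) {h : (Fin d → ℝ) → ℝ} (hc : ContinuousOn h (cube d))
    (hΦ : ∀ m, (2 : ℝ) ^ ((B.J₀ : ℝ) * (α + d / 2)) * |inner2 h (B.Phi B.J₀ m)| ≤ M₁)
    (hΨ : ∀ l ≥ B.J₀, ∀ ι : Fin d → Bool, (ι ≠ fun _ => false) → ∀ m,
        (2 : ℝ) ^ ((l : ℝ) * (α + d / 2)) * |inner2 h (B.Psi l ι m)| ≤ M₂) :
    h ∈ B.holderBall d α M := by
  refine ⟨(isCompact_cube d).uniformContinuousOn_of_continuous hc, ?_⟩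
  unfold CDVBasis.holderNorm
  refine le_trans ?_ (ENNReal.ofReal_le_ofReal hM)
  rw [ENNReal.ofReal_add h₁ h₂]
  gcongr
  · exact iSup_le fun m => ENNReal.ofReal_le_ofReal (hΦ m)
  · exact iSup₂_le fun l hl => iSup₂_le fun ι hι => iSup_le fun m =>
      ENNReal.ofReal_le_ofReal (hΨ l hl ι hι m)

theorem CDVBasis.abs_inner2_Psi_le {α M : ℝ} (hM : 0 ≤ M) {h : (Fin d → ℝ) → ℝ}
    (hh : h ∈ B.holderBall d α M) {l : ℕ} (hl : B.J₀ ≤ l) {ι : Fin d → Bool}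
    (hι : ι ≠ fun _ => false) (m : Fin d → Fin (2 ^ l)) :
    |inner2 h (B.Psi l ι m)| ≤ M * (2 : ℝ) ^ (-((l : ℝ) * (α + d / 2))) := by
  obtain ⟨M₁, M₂, h1, -, h12, -, hΨ⟩ := B.exists_bounds_of_mem_holderBall hM hh
  have h := hΨ l hl ι hι m
  rw [Real.rpow_neg two_pos.le, ← div_eq_mul_inv, le_div_iff₀ (by positivity), mul_comm]
  linarith

/-- The number `2^{ld}` of translates at level `l` cancels the two normalising factors `2^{-ld/2}`.
-/
theorem level_rpow (l d : ℕ) (α β : ℝ) :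
    (2 : ℝ) ^ (-((l : ℝ) * (α + d / 2))) * (2 : ℝ) ^ (-((l : ℝ) * (β + d / 2))) * ((2 : ℝ) ^ l) ^ d =
      ((2 : ℝ) ^ (-(α + β))) ^ l := by
  rw [← Real.rpow_natCast (2 ^ (-(α + β))), ← Real.rpow_mul two_pos.le,
    ← Real.rpow_natCast 2 l, ← Real.rpow_natCast _ d, ← Real.rpow_mul two_pos.le,
    ← Real.rpow_add two_pos, ← Real.rpow_add two_pos]
  congr 1
  ring

theorem CDVBasis.abs_lev_le {α β M : ℝ} (hM : 0 ≤ M) {p b : (Fin d → ℝ) → ℝ}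
    (hp : p ∈ B.holderBall d α M) (hb : b ∈ B.holderBall d β M) {l : ℕ} (hl : B.J₀ ≤ l) :
    |B.lev l p b| ≤ 2 ^ d * M ^ 2 * ((2 : ℝ) ^ (-(α + β))) ^ l := by
  set x := (2 : ℝ) ^ (-((l : ℝ) * (α + d / 2))) with hx
  set y := (2 : ℝ) ^ (-((l : ℝ) * (β + d / 2))) with hy
  have hx0 : 0 < x := by positivity
  have hy0 : 0 < y := by positivity
  calc |B.lev l p b|
      ≤ ∑ ι ∈ Finset.univ.filter (fun ι : Fin d → Bool => ι ≠ fun _ => false),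
          ∑ m : Fin d → Fin (2 ^ l), M ^ 2 * (x * y) := by
        refine (Finset.abs_sum_le_sum_abs _ _).trans (Finset.sum_le_sum fun ι hι => ?_)
        refine (Finset.abs_sum_le_sum_abs _ _).trans (Finset.sum_le_sum fun m _ => ?_)
        have hι' := (Finset.mem_filter.1 hι).2
        rw [abs_mul]
        calc _ ≤ (M * x) * (M * y) := mul_le_mul (B.abs_inner2_Psi_le hM hp hl hι' m)
              (B.abs_inner2_Psi_le hM hb hl hι' m) (abs_nonneg _) (by positivity)
          _ = _ := by ring
    _ = ((Finset.univ.filter (fun ι : Fin d → Bool => ι ≠ fun _ => false)).card : ℝ) *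
          (M ^ 2 * (x * y * (2 ^ l) ^ d)) := by
        simp only [Finset.sum_const, Finset.card_univ, Fintype.card_fun, Fintype.card_fin,
          nsmul_eq_mul, Nat.cast_pow, Nat.cast_ofNat]
        ring
    _ ≤ 2 ^ d * (M ^ 2 * (x * y * (2 ^ l) ^ d)) := by
        refine mul_le_mul_of_nonneg_right ?_ (by positivity)
        have : (Finset.univ.filter (fun ι : Fin d → Bool => ι ≠ fun _ => false)).card ≤ 2 ^ d :=
          (Finset.card_le_univ _).trans (by simp)
        exact_mod_cast this
    _ = _ := by rw [level_rpow]; ring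

theorem two_rpow_neg_lt_one {s : ℝ} (hs : 0 < s) : (2 : ℝ) ^ (-s) < 1 :=
  Real.rpow_lt_one_of_one_lt_of_neg one_lt_two (by linarith)

/-- The constant in the upper bound on the bias. -/
def biasC (d : ℕ) (M s : ℝ) : ℝ := 2 ^ d * M ^ 2 / (1 - (2 : ℝ) ^ (-s))

theorem biasC_nonneg {d : ℕ} {M s : ℝ} (hs : 0 < s) : 0 ≤ biasC d M s := by
  have := two_rpow_neg_lt_one hs
  unfold biasC
  have : 0 < 1 - (2 : ℝ) ^ (-s) := by linarith
  positivity

theorem CDVBasis.abs_gap_le (hS : 0 < S) {α β M : ℝ} (hM : 0 ≤ M) (hαβ : 0 < α + β)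
    {p b : (Fin d → ℝ) → ℝ} (hp : p ∈ B.holderBall d α M) (hb : b ∈ B.holderBall d β M) {j : ℕ}
    (hj : B.J₀ ≤ j) : |B.gap j p b| ≤ biasC d M (α + β) * ((2 : ℝ) ^ (-(α + β))) ^ j := by
  refine (B.abs_gap_le_of_lev_le hS hj hp.1.continuousOn hb.1.continuousOn (by positivity)
    (by positivity) (two_rpow_neg_lt_one hαβ)
    fun l hl => B.abs_lev_le hM hp hb (hj.trans hl)).trans (le_of_eq ?_)
  unfold biasC; ring

theorem res_rpow {d : ℕ} (hd : 1 ≤ d) (j : ℕ) (s : ℝ) :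
    res d j ^ (-s / (d : ℝ)) = ((2 : ℝ) ^ (-s)) ^ j := by
  have hd' : (d : ℝ) ≠ 0 := by positivity
  rw [res, ← Real.rpow_natCast 2, ← Real.rpow_natCast _ j, ← Real.rpow_mul two_pos.le,
    ← Real.rpow_mul two_pos.le]
  congr 1
  push_cast
  field_simp

theorem res_pos (d j : ℕ) : 0 < res d j := by unfold res; positivity

theorem one_le_res (d j : ℕ) : 1 ≤ res d j := one_le_pow₀ one_le_two

theorem res_mono (d : ℕ) : Monotone (res d) := fun _ _ h =>
  pow_le_pow_right₀ one_le_two (Nat.mul_le_mul_right d h)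

theorem res_min (d i j : ℕ) : res d (min i j) = min (res d i) (res d j) := (res_mono d).map_min

theorem res_max (d i j : ℕ) : res d (max i j) = max (res d i) (res d j) := (res_mono d).map_max

end Holder

/-! ### Bounded measurable functions -/

/-- Bounded measurable real functions. -/
def BddMeas {E : Type*} [MeasurableSpace E] (f : E → ℝ) : Prop :=
  Measurable f ∧ ∃ C, ∀ x, |f x| ≤ C

namespace BddMeas

variable {E F : Type*} [MeasurableSpace E] [MeasurableSpace F] {f g : E → ℝ}

theorem const (c : ℝ) : BddMeas fun _ : E => c := ⟨measurable_const, |c|, fun _ => le_rfl⟩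

theorem add (hf : BddMeas f) (hg : BddMeas g) : BddMeas fun x => f x + g x := by
  obtain ⟨hf, a, ha⟩ := hf
  obtain ⟨hg, b, hb⟩ := hg
  exact ⟨hf.add hg, a + b, fun x => (abs_add_le _ _).trans (add_le_add (ha x) (hb x))⟩

theorem mul (hf : BddMeas f) (hg : BddMeas g) : BddMeas fun x => f x * g x := by
  obtain ⟨hf, a, ha⟩ := hf
  obtain ⟨hg, b, hb⟩ := hg
  refine ⟨hf.mul hg, a * b, fun x => ?_⟩
  rw [abs_mul]
  exact mul_le_mul (ha x) (hb x) (abs_nonneg _) ((abs_nonneg _).trans (ha x))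

theorem sub (hf : BddMeas f) (hg : BddMeas g) : BddMeas fun x => f x - g x := by
  simpa [sub_eq_add_neg] using hf.add ((const (-1)).mul hg)

theorem sq (hf : BddMeas f) : BddMeas fun x => f x ^ 2 := by
  simpa [pow_two] using hf.mul hf

theorem abs (hf : BddMeas f) : BddMeas fun x => |f x| :=
  ⟨continuous_abs.measurable.comp hf.1, hf.2.imp fun C hC x => by rw [abs_abs]; exact hC x⟩

theorem sum {κ : Type*} (s : Finset κ) {f : κ → E → ℝ} (h : ∀ k ∈ s, BddMeas (f k)) :
    BddMeas fun x => ∑ k ∈ s, f k x := by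
  classical
  induction s using Finset.induction_on with
  | empty => simpa using const (E := E) 0
  | insert a s ha ih =>
    simp_rw [Finset.sum_insert ha]
    exact (h a (Finset.mem_insert_self a s)).add
      (ih fun k hk => h k (Finset.mem_insert_of_mem hk))

theorem comp {φ : F → E} (hf : BddMeas f) (hφ : Measurable φ) : BddMeas fun x => f (φ x) :=
  ⟨hf.1.comp hφ, hf.2.imp fun _ hC x => hC (φ x)⟩

theorem integrable (hf : BddMeas f) (μ : Measure E) [IsFiniteMeasure μ] : Integrable f μ := by
  obtain ⟨hf, a, ha⟩ := hf
  exact Integrable.of_bound hf.aestronglyMeasurable a (ae_of_all _ ha)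

theorem memLp (hf : BddMeas f) (μ : Measure E) [IsFiniteMeasure μ] : MemLp f 2 μ := by
  obtain ⟨hf, a, ha⟩ := hf
  exact MemLp.of_bound hf.aestronglyMeasurable a (ae_of_all _ ha)

theorem integral {h : E → F → ℝ} (hh : BddMeas fun z : E × F => h z.1 z.2) (μ : Measure F)
    [IsProbabilityMeasure μ] : BddMeas fun x => ∫ y, h x y ∂μ := by
  obtain ⟨hh, a, ha⟩ := hh
  refine ⟨(hh.stronglyMeasurable.integral_prod_right (f := h)).measurable, a, fun x => ?_⟩
  have := norm_integral_le_of_norm_le_const (μ := μ) (C := a) (f := h x)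
    (ae_of_all _ fun y => ha (x, y))
  simpa using this

theorem swap {h : E → F → ℝ} (hh : BddMeas fun z : E × F => h z.1 z.2) :
    BddMeas fun z : F × E => h z.2 z.1 := hh.comp measurable_swap

theorem left {h : E → F → ℝ} (hh : BddMeas fun z : E × F => h z.1 z.2) (y : F) :
    BddMeas fun x => h x y := hh.comp (by fun_prop : Measurable fun x => (x, y))

theorem right {h : E → F → ℝ} (hh : BddMeas fun z : E × F => h z.1 z.2) (x : E) :
    BddMeas fun y => h x y := hh.comp (by fun_prop : Measurable fun y => (x, y))

/-- A bounded measurable function on a product of probability spaces is integrable, so Fubini needs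
no further conditions. This is the reason for working with `BddMeas`. -/
theorem integral_swap {h : E → F → ℝ} (hh : BddMeas fun z : E × F => h z.1 z.2) (μ : Measure E)
    (ν : Measure F) [IsProbabilityMeasure μ] [IsProbabilityMeasure ν] :
    ∫ x, ∫ y, h x y ∂ν ∂μ = ∫ y, ∫ x, h x y ∂μ ∂ν :=
  integral_integral_swap (hh.integrable (μ.prod ν))

theorem integral_mono (hf : BddMeas f) (hg : BddMeas g) (μ : Measure E) [IsFiniteMeasure μ]
    (h : ∀ x, f x ≤ g x) : ∫ x, f x ∂μ ≤ ∫ x, g x ∂μ :=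
  MeasureTheory.integral_mono (hf.integrable μ) (hg.integrable μ) h

end BddMeas

/-! ### Second moments of multi-sample averages -/

section UStat

variable {E : Type*} [MeasurableSpace E] (μ : Measure E) [IsProbabilityMeasure μ]

/-- The law of one subsample of size `n`. -/
def iidLaw (n : ℕ) : Measure (Fin n → E) := Measure.pi fun _ => μ

instance (n : ℕ) : IsProbabilityMeasure (iidLaw μ n) := by unfold iidLaw; infer_instance

/-- Sample averages. -/
def avg {n : ℕ} (f : Fin n → ℝ) : ℝ := (1 / (n : ℝ)) * ∑ i, f i

theorem BddMeas.avg {F : Type*} [MeasurableSpace F] {n : ℕ} {f : Fin n → F → ℝ}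
    (h : ∀ i, BddMeas (f i)) : BddMeas fun x => avg fun i => f i x :=
  (BddMeas.const _).mul (BddMeas.sum _ fun i _ => h i)

theorem BddMeas.avg_comp {F : Type*} [MeasurableSpace F] {n : ℕ} {f : F → E → ℝ}
    (h : BddMeas fun z : F × E => f z.1 z.2) :
    BddMeas fun z : F × (Fin n → E) => DoubleSplit.avg fun i => f z.1 (z.2 i) :=
  BddMeas.avg fun i => h.comp (φ := fun z : F × (Fin n → E) => (z.1, z.2 i)) (by fun_prop)

theorem integral_avg_iidLaw {n : ℕ} (hn : 1 ≤ n) {g : E → ℝ} (hg : BddMeas g) :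
    ∫ D, avg (fun i => g (D i)) ∂(iidLaw μ n) = ∫ x, g x ∂μ := by
  have hn' : (n : ℝ) ≠ 0 := by positivity
  simp_rw [avg]
  rw [integral_const_mul, integral_finsetSum]
  · have : ∀ i : Fin n, ∫ D, g (D i) ∂(iidLaw μ n) = ∫ x, g x ∂μ := fun i =>
      integral_comp_eval (μ := fun _ : Fin n => μ) hg.1.aestronglyMeasurable
    simp_rw [this]
    simp only [Finset.sum_const, Finset.card_univ, Fintype.card_fin, nsmul_eq_mul]
    field_simp
  · exact fun i _ => (hg.comp (measurable_pi_apply i)).integrable _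

/-- This is the formula for the variance of a mean, arranged as a mixture with weights `1/n` and `1
- 1/n`: the square is taken before or after integrating. In this form it can be iterated over
independent samples. -/
theorem integral_avg_sq {n : ℕ} (hn : 1 ≤ n) {g : E → ℝ} (hg : BddMeas g) :
    ∫ D, avg (fun i => g (D i)) ^ 2 ∂(iidLaw μ n) =
      1 / n * ∫ x, g x ^ 2 ∂μ + (1 - 1 / n) * (∫ x, g x ∂μ) ^ 2 := by
  have hn' : (n : ℝ) ≠ 0 := by positivity
  have h1 : Var[fun D : Fin n → E => avg fun i => g (D i); iidLaw μ n] = 1 / n * Var[g; μ] := by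
    have h2 := variance_sum_pi (μ := fun _ : Fin n => μ) (X := fun _ => g)
      fun _ => hg.memLp μ
    simp only [Finset.sum_const, Finset.card_univ, Fintype.card_fin, nsmul_eq_mul] at h2
    have h3 : (fun D : Fin n → E => avg fun i => g (D i)) =
        fun D => (1 / (n : ℝ)) * (∑ i, fun D : Fin n → E => g (D i)) D := by
      funext D; simp [avg]
    rw [h3, variance_const_mul, iidLaw, h2]
    field_simp
  have hb : BddMeas fun D : Fin n → E => avg fun i => g (D i) :=
    BddMeas.avg fun i => hg.comp (measurable_pi_apply i)
  rw [variance_eq_sub (hb.memLp _), variance_eq_sub (hg.memLp _)] at h1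
  simp only [Pi.pow_apply] at h1
  rw [integral_avg_iidLaw μ hn hg] at h1
  linear_combination h1

/-- `integral_avg_sq` is applied to the first sample with the second frozen, then to the second
sample in each of the two resulting terms. -/
theorem integral_avg_sq_two {n : ℕ} (hn : 1 ≤ n) {h : E → E → ℝ}
    (hh : BddMeas fun z : E × E => h z.1 z.2) :
    ∫ w, avg (fun i => avg fun k => h (w.1 i) (w.2 k)) ^ 2 ∂((iidLaw μ n).prod (iidLaw μ n)) =
      1 / n * (1 / n * (∫ x, ∫ y, h x y ^ 2 ∂μ ∂μ) + (1 - 1 / n) * ∫ x, (∫ y, h x y ∂μ) ^ 2 ∂μ) +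
      (1 - 1 / n) * (1 / n * (∫ y, (∫ x, h x y ∂μ) ^ 2 ∂μ) +
        (1 - 1 / n) * (∫ y, ∫ x, h x y ∂μ ∂μ) ^ 2) := by
  have hG : BddMeas fun z : E × (Fin n → E) => avg fun k => h z.1 (z.2 k) := hh.avg_comp
  have hG2 := hG.sq
  have hU : BddMeas fun w : (Fin n → E) × (Fin n → E) =>
      avg (fun i => avg fun k => h (w.1 i) (w.2 k)) :=
    BddMeas.avg fun i => hG.comp (φ := fun w : (Fin n → E) × (Fin n → E) => (w.1 i, w.2))
      (by fun_prop)
  rw [integral_prod_symm _ (hU.sq.integrable _)]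
  have h1 : ∀ D' : Fin n → E,
      ∫ D, avg (fun i => avg fun k => h (D i) (D' k)) ^ 2 ∂(iidLaw μ n) =
        1 / n * (∫ x, avg (fun k => h x (D' k)) ^ 2 ∂μ) +
          (1 - 1 / n) * avg (fun k => ∫ x, h x (D' k) ∂μ) ^ 2 := by
    intro D'
    rw [integral_avg_sq μ hn (g := fun x => avg fun k => h x (D' k))
      (BddMeas.left (h := fun x (D' : Fin n → E) => avg fun k => h x (D' k)) hG D')]
    congr 3
    simp_rw [avg]
    rw [integral_const_mul, integral_finsetSum _ fun k _ => (hh.left (D' k)).integrable μ]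
  simp_rw [h1]
  have h2 : BddMeas fun D' : Fin n → E => ∫ x, avg (fun k => h x (D' k)) ^ 2 ∂μ :=
    BddMeas.integral (h := fun (D' : Fin n → E) x => avg (fun k => h x (D' k)) ^ 2)
      (BddMeas.swap (h := fun x (D' : Fin n → E) => avg (fun k => h x (D' k)) ^ 2) hG2) μ
  have h3 : BddMeas fun y => ∫ x, h x y ∂μ := BddMeas.integral (h := fun y x => h x y) hh.swap μ
  have h4 : BddMeas fun D' : Fin n → E => avg (fun k => ∫ x, h x (D' k) ∂μ) :=
    BddMeas.avg fun k => h3.comp (measurable_pi_apply k)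
  rw [integral_add (((BddMeas.const _).mul h2).integrable _)
    (((BddMeas.const _).mul h4.sq).integrable _), integral_const_mul, integral_const_mul,
    integral_avg_sq μ hn h3,
    ← BddMeas.integral_swap (h := fun x (D' : Fin n → E) => avg (fun k => h x (D' k)) ^ 2) hG2 μ
      (iidLaw μ n)]
  have h5 : ∀ x, ∫ D' : Fin n → E, avg (fun k => h x (D' k)) ^ 2 ∂(iidLaw μ n) =
      1 / n * (∫ y, h x y ^ 2 ∂μ) + (1 - 1 / n) * (∫ y, h x y ∂μ) ^ 2 := fun x =>
    integral_avg_sq μ hn (hh.right x)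
  simp_rw [h5]
  rw [integral_add (((BddMeas.const _).mul
      (BddMeas.integral (h := fun x y => h x y ^ 2) hh.sq μ)).integrable _)
    (((BddMeas.const _).mul (BddMeas.integral (h := h) hh μ).sq).integrable _), integral_const_mul,
    integral_const_mul]

/-- The three-sample average of a kernel `h`. -/
def ustat {n : ℕ} (h : E → E → E → ℝ) (w : (Fin n → E) × (Fin n → E) × (Fin n → E)) : ℝ :=
  avg fun i => avg fun k => avg fun l => h (w.1 i) (w.2.1 k) (w.2.2 l)

variable {h : E → E → E → ℝ}

theorem BddMeas.avg_avg {n : ℕ} (hh : BddMeas fun z : E × E × E => h z.1 z.2.1 z.2.2) :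
    BddMeas fun z : E × (Fin n → E) × (Fin n → E) =>
      DoubleSplit.avg fun k => DoubleSplit.avg fun l => h z.1 (z.2.1 k) (z.2.2 l) :=
  BddMeas.avg fun k => BddMeas.avg fun l =>
    hh.comp (φ := fun z : E × (Fin n → E) × (Fin n → E) => (z.1, z.2.1 k, z.2.2 l)) (by fun_prop)

theorem BddMeas.ustat {n : ℕ} (hh : BddMeas fun z : E × E × E => h z.1 z.2.1 z.2.2) :
    BddMeas (ustat (n := n) h) :=
  BddMeas.avg fun i => BddMeas.avg fun k => BddMeas.avg fun l =>
    hh.comp (φ := fun w : (Fin n → E) × (Fin n → E) × (Fin n → E) => (w.1 i, w.2.1 k, w.2.2 l))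
      (by fun_prop)

/-- The law of three independent subsamples of size `n`. -/
def threeLaw (n : ℕ) : Measure ((Fin n → E) × (Fin n → E) × (Fin n → E)) :=
  (iidLaw μ n).prod ((iidLaw μ n).prod (iidLaw μ n))

instance (n : ℕ) : IsProbabilityMeasure (threeLaw μ n) := by unfold threeLaw; infer_instance

theorem BddMeas.section_right (hh : BddMeas fun z : E × E × E => h z.1 z.2.1 z.2.2) (x : E) :
    BddMeas fun z : E × E => h x z.1 z.2 :=
  hh.comp (φ := fun z : E × E => (x, z.1, z.2)) (by fun_prop)

theorem BddMeas.rot (hh : BddMeas fun z : E × E × E => h z.1 z.2.1 z.2.2) :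
    BddMeas fun z : (E × E) × E => h z.2 z.1.1 z.1.2 :=
  hh.comp (φ := fun z : (E × E) × E => (z.2, z.1.1, z.1.2)) (by fun_prop)

theorem BddMeas.integral_first (hh : BddMeas fun z : E × E × E => h z.1 z.2.1 z.2.2) :
    BddMeas fun z : E × E => ∫ x, h x z.1 z.2 ∂μ :=
  BddMeas.integral (h := fun (z : E × E) x => h x z.1 z.2) hh.rot μ

theorem BddMeas.integral_second (hh : BddMeas fun z : E × E × E => h z.1 z.2.1 z.2.2) :
    BddMeas fun z : E × E => ∫ y, h z.1 y z.2 ∂μ :=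
  BddMeas.integral (h := fun (z : E × E) y => h z.1 y z.2)
    (hh.comp (φ := fun z : (E × E) × E => (z.1.1, z.2, z.1.2)) (by fun_prop)) μ

theorem BddMeas.integral_third (hh : BddMeas fun z : E × E × E => h z.1 z.2.1 z.2.2) :
    BddMeas fun z : E × E => ∫ y, h z.1 z.2 y ∂μ :=
  BddMeas.integral (h := fun (z : E × E) y => h z.1 z.2 y)
    (hh.comp (φ := fun z : (E × E) × E => (z.1.1, z.1.2, z.2)) (by fun_prop)) μ

/-- One more iteration. Each of the eight terms records, for every sample, whether its two indices
in the square coincide (weight `1/n`) or that variable is integrated out before squaring (weight `1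
- 1/n`). -/
theorem integral_ustat_sq {n : ℕ} (hn : 1 ≤ n)
    (hh : BddMeas fun z : E × E × E => h z.1 z.2.1 z.2.2) :
    ∫ w, ustat h w ^ 2 ∂(threeLaw μ n) =
      1 / n * (1 / n * (1 / n * (∫ x, ∫ y, ∫ z, h x y z ^ 2 ∂μ ∂μ ∂μ) +
            (1 - 1 / n) * ∫ x, ∫ y, (∫ z, h x y z ∂μ) ^ 2 ∂μ ∂μ) +
          (1 - 1 / n) * (1 / n * (∫ x, ∫ z, (∫ y, h x y z ∂μ) ^ 2 ∂μ ∂μ) +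
            (1 - 1 / n) * ∫ x, (∫ z, ∫ y, h x y z ∂μ ∂μ) ^ 2 ∂μ)) +
      (1 - 1 / n) * (1 / n * (1 / n * (∫ y, ∫ z, (∫ x, h x y z ∂μ) ^ 2 ∂μ ∂μ) +
            (1 - 1 / n) * ∫ y, (∫ z, ∫ x, h x y z ∂μ ∂μ) ^ 2 ∂μ) +
          (1 - 1 / n) * (1 / n * (∫ z, (∫ y, ∫ x, h x y z ∂μ ∂μ) ^ 2 ∂μ) +
            (1 - 1 / n) * (∫ z, ∫ y, ∫ x, h x y z ∂μ ∂μ ∂μ) ^ 2)) := by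
  have hG : BddMeas fun z : E × (Fin n → E) × (Fin n → E) =>
      avg fun k => avg fun l => h z.1 (z.2.1 k) (z.2.2 l) := hh.avg_avg
  have hG2 := hG.sq
  rw [threeLaw, integral_prod_symm _ (hh.ustat.sq.integrable _)]
  have h3 := hh.integral_first μ
  have h1 : ∀ w : (Fin n → E) × (Fin n → E), ∫ D, ustat h (D, w) ^ 2 ∂(iidLaw μ n) =
        1 / n * (∫ x, avg (fun k => avg fun l => h x (w.1 k) (w.2 l)) ^ 2 ∂μ) +
          (1 - 1 / n) * avg (fun k => avg fun l => ∫ x, h x (w.1 k) (w.2 l) ∂μ) ^ 2 := by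
    intro w
    rw [show (∫ D, ustat h (D, w) ^ 2 ∂(iidLaw μ n)) = ∫ D : Fin n → E, avg (fun i =>
      (fun x => avg fun k => avg fun l => h x (w.1 k) (w.2 l)) (D i)) ^ 2 ∂(iidLaw μ n) from rfl,
      integral_avg_sq μ hn (g := fun x => avg fun k => avg fun l => h x (w.1 k) (w.2 l))
      (BddMeas.left (h := fun x (w : (Fin n → E) × (Fin n → E)) =>
        avg fun k => avg fun l => h x (w.1 k) (w.2 l)) hG w)]
    congr 3
    have h6 : ∀ k l, BddMeas fun x => h x (w.1 k) (w.2 l) := fun k l =>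
      hh.comp (φ := fun x => (x, w.1 k, w.2 l)) (by fun_prop)
    simp_rw [avg]
    rw [integral_const_mul, integral_finsetSum]
    · simp_rw [integral_const_mul]
      congr 1
      refine Finset.sum_congr rfl fun k _ => ?_
      rw [integral_finsetSum _ fun l _ => (h6 k l).integrable μ]
    · exact fun k _ => ((BddMeas.const _).mul (BddMeas.sum _ fun l _ => h6 k l)).integrable μ
  simp_rw [h1]
  have h2 : BddMeas fun w : (Fin n → E) × (Fin n → E) =>
      ∫ x, avg (fun k => avg fun l => h x (w.1 k) (w.2 l)) ^ 2 ∂μ :=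
    BddMeas.integral (h := fun (w : (Fin n → E) × (Fin n → E)) x =>
        avg (fun k => avg fun l => h x (w.1 k) (w.2 l)) ^ 2)
      (BddMeas.swap (h := fun x (w : (Fin n → E) × (Fin n → E)) =>
        avg (fun k => avg fun l => h x (w.1 k) (w.2 l)) ^ 2) hG2) μ
  have h4 : BddMeas fun w : (Fin n → E) × (Fin n → E) =>
      avg fun k => avg fun l => ∫ x, h x (w.1 k) (w.2 l) ∂μ :=
    BddMeas.avg fun k => BddMeas.avg fun l =>
      h3.comp (φ := fun w : (Fin n → E) × (Fin n → E) => (w.1 k, w.2 l)) (by fun_prop)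
  rw [integral_add (((BddMeas.const _).mul h2).integrable _)
    (((BddMeas.const _).mul h4.sq).integrable _), integral_const_mul, integral_const_mul,
    integral_avg_sq_two μ hn (h := fun y z => ∫ x, h x y z ∂μ) h3,
    ← BddMeas.integral_swap (h := fun x (w : (Fin n → E) × (Fin n → E)) =>
        avg (fun k => avg fun l => h x (w.1 k) (w.2 l)) ^ 2) hG2 μ
      ((iidLaw μ n).prod (iidLaw μ n))]
  simp_rw [fun x => integral_avg_sq_two μ hn (hh.section_right x)]
  have k1 : BddMeas fun x => ∫ y, ∫ z, h x y z ^ 2 ∂μ ∂μ :=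
    BddMeas.integral (h := fun x y => ∫ z, h x y z ^ 2 ∂μ)
      (BddMeas.integral_third (h := fun x y z => h x y z ^ 2) μ hh.sq) μ
  have k2 : BddMeas fun x => ∫ y, (∫ z, h x y z ∂μ) ^ 2 ∂μ :=
    BddMeas.integral (h := fun x y => (∫ z, h x y z ∂μ) ^ 2) (hh.integral_third μ).sq μ
  have k3 : BddMeas fun x => ∫ z, (∫ y, h x y z ∂μ) ^ 2 ∂μ :=
    BddMeas.integral (h := fun x z => (∫ y, h x y z ∂μ) ^ 2) (hh.integral_second μ).sq μ
  have k4 : BddMeas fun x => (∫ z, ∫ y, h x y z ∂μ ∂μ) ^ 2 :=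
    (BddMeas.integral (h := fun x z => ∫ y, h x y z ∂μ) (hh.integral_second μ) μ).sq
  have c := fun t : ℝ => BddMeas.const (E := E) t
  rw [integral_add (((c _).mul (((c _).mul k1).add ((c _).mul k2))).integrable _)
      (((c _).mul (((c _).mul k3).add ((c _).mul k4))).integrable _),
    integral_const_mul, integral_const_mul,
    integral_add (((c _).mul k1).integrable _) (((c _).mul k2).integrable _),
    integral_add (((c _).mul k3).integrable _) (((c _).mul k4).integrable _),
    integral_const_mul, integral_const_mul, integral_const_mul, integral_const_mul]

theorem integral_ustat {n : ℕ} (hn : 1 ≤ n)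
    (hh : BddMeas fun z : E × E × E => h z.1 z.2.1 z.2.2) :
    ∫ w, ustat h w ∂(threeLaw μ n) = ∫ z, ∫ y, ∫ x, h x y z ∂μ ∂μ ∂μ := by
  have h3 := hh.integral_first μ
  rw [threeLaw, integral_prod_symm _ (hh.ustat.integrable _)]
  have h1 : ∀ w : (Fin n → E) × (Fin n → E), ∫ D, ustat h (D, w) ∂(iidLaw μ n) =
        avg (fun k => avg fun l => ∫ x, h x (w.1 k) (w.2 l) ∂μ) := by
    intro w
    have h6 : ∀ k l, BddMeas fun x => h x (w.1 k) (w.2 l) := fun k l =>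
      hh.comp (φ := fun x => (x, w.1 k, w.2 l)) (by fun_prop)
    rw [show (∫ D, ustat h (D, w) ∂(iidLaw μ n)) = ∫ D : Fin n → E, avg (fun i =>
      (fun x => avg fun k => avg fun l => h x (w.1 k) (w.2 l)) (D i)) ∂(iidLaw μ n) from rfl,
      integral_avg_iidLaw μ hn (g := fun x => avg fun k => avg fun l => h x (w.1 k) (w.2 l))
      (BddMeas.avg fun k => BddMeas.avg fun l => h6 k l)]
    simp_rw [avg]
    rw [integral_const_mul, integral_finsetSum]
    · simp_rw [integral_const_mul]
      congr 1
      refine Finset.sum_congr rfl fun k _ => ?_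
      rw [integral_finsetSum _ fun l _ => (h6 k l).integrable μ]
    · exact fun k _ => ((BddMeas.const _).mul (BddMeas.sum _ fun l _ => h6 k l)).integrable μ
  simp_rw [h1]
  have h5 : BddMeas fun w : (Fin n → E) × (Fin n → E) =>
      avg fun k => avg fun l => ∫ x, h x (w.1 k) (w.2 l) ∂μ :=
    BddMeas.avg fun k => BddMeas.avg fun l =>
      h3.comp (φ := fun w : (Fin n → E) × (Fin n → E) => (w.1 k, w.2 l)) (by fun_prop)
  rw [integral_prod_symm _ (h5.integrable _)]
  have h7 : ∀ D' : Fin n → E, ∫ D, avg (fun k => avg fun l => ∫ x, h x (D k) (D' l) ∂μ) ∂(iidLaw μ n)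
      = avg fun l => ∫ y, ∫ x, h x y (D' l) ∂μ ∂μ := by
    intro D'
    rw [integral_avg_iidLaw μ hn (g := fun y => avg fun l => ∫ x, h x y (D' l) ∂μ)
      (BddMeas.avg fun l => BddMeas.left (h := fun y z => ∫ x, h x y z ∂μ) h3 (D' l))]
    simp_rw [avg]
    rw [integral_const_mul, integral_finsetSum _ fun l _ =>
      (BddMeas.left (h := fun y z => ∫ x, h x y z ∂μ) h3 (D' l)).integrable μ]
  simp_rw [h7]
  exact integral_avg_iidLaw μ hn (g := fun z => ∫ y, ∫ x, h x y z ∂μ ∂μ)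
    (BddMeas.integral (h := fun z y => ∫ x, h x y z ∂μ)
      (BddMeas.swap (h := fun y z => ∫ x, h x y z ∂μ) h3) μ)

/-- The squared mean carries weight `(1 - 1/n)³ ≤ 1`, so subtracting the full squared mean removes
it. In the other seven nonnegative terms the factors `1 - 1/n` are dropped. -/
theorem variance_ustat_le {n : ℕ} (hn : 1 ≤ n)
    (hh : BddMeas fun z : E × E × E => h z.1 z.2.1 z.2.2) :
    Var[ustat h; threeLaw μ n] ≤
      ((∫ x, (∫ z, ∫ y, h x y z ∂μ ∂μ) ^ 2 ∂μ) + (∫ y, (∫ z, ∫ x, h x y z ∂μ ∂μ) ^ 2 ∂μ) +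
        (∫ z, (∫ y, ∫ x, h x y z ∂μ ∂μ) ^ 2 ∂μ)) / n +
      ((∫ x, ∫ y, (∫ z, h x y z ∂μ) ^ 2 ∂μ ∂μ) + (∫ x, ∫ z, (∫ y, h x y z ∂μ) ^ 2 ∂μ ∂μ) +
        (∫ y, ∫ z, (∫ x, h x y z ∂μ) ^ 2 ∂μ ∂μ)) / n ^ 2 +
      (∫ x, ∫ y, ∫ z, h x y z ^ 2 ∂μ ∂μ ∂μ) / n ^ 3 := by
  rw [variance_eq_sub (hh.ustat.memLp _)]
  simp only [Pi.pow_apply]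
  rw [integral_ustat μ hn hh, integral_ustat_sq μ hn hh]
  have hn' : (1 : ℝ) ≤ n := by exact_mod_cast hn
  have hn0 : (0 : ℝ) < n := by linarith
  set q : ℝ := 1 / n with hq
  have hq0 : 0 < q := by positivity
  have hq1 : q ≤ 1 := by rw [hq, div_le_one hn0]; exact hn'
  have e1 : ∀ t : ℝ, t / n = q * t := fun t => by rw [hq]; ring
  have e2 : ∀ t : ℝ, t / (n : ℝ) ^ 2 = q ^ 2 * t := fun t => by rw [hq]; field_simp
  have e3 : ∀ t : ℝ, t / (n : ℝ) ^ 3 = q ^ 3 * t := fun t => by rw [hq]; field_simp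
  rw [e1, e2, e3]
  have p1 : 0 ≤ ∫ x, (∫ z, ∫ y, h x y z ∂μ ∂μ) ^ 2 ∂μ := integral_nonneg fun _ => sq_nonneg _
  have p2 : 0 ≤ ∫ y, (∫ z, ∫ x, h x y z ∂μ ∂μ) ^ 2 ∂μ := integral_nonneg fun _ => sq_nonneg _
  have p3 : 0 ≤ ∫ z, (∫ y, ∫ x, h x y z ∂μ ∂μ) ^ 2 ∂μ := integral_nonneg fun _ => sq_nonneg _
  have p12 : 0 ≤ ∫ x, ∫ y, (∫ z, h x y z ∂μ) ^ 2 ∂μ ∂μ :=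
    integral_nonneg fun _ => integral_nonneg fun _ => sq_nonneg _
  have p13 : 0 ≤ ∫ x, ∫ z, (∫ y, h x y z ∂μ) ^ 2 ∂μ ∂μ :=
    integral_nonneg fun _ => integral_nonneg fun _ => sq_nonneg _
  have p23 : 0 ≤ ∫ y, ∫ z, (∫ x, h x y z ∂μ) ^ 2 ∂μ ∂μ :=
    integral_nonneg fun _ => integral_nonneg fun _ => sq_nonneg _
  set v1 := ∫ x, (∫ z, ∫ y, h x y z ∂μ ∂μ) ^ 2 ∂μ
  set v2 := ∫ y, (∫ z, ∫ x, h x y z ∂μ ∂μ) ^ 2 ∂μ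
  set v3 := ∫ z, (∫ y, ∫ x, h x y z ∂μ ∂μ) ^ 2 ∂μ
  set v12 := ∫ x, ∫ y, (∫ z, h x y z ∂μ) ^ 2 ∂μ ∂μ
  set v13 := ∫ x, ∫ z, (∫ y, h x y z ∂μ) ^ 2 ∂μ ∂μ
  set v23 := ∫ y, ∫ z, (∫ x, h x y z ∂μ) ^ 2 ∂μ ∂μ
  set t := ∫ z, ∫ y, ∫ x, h x y z ∂μ ∂μ ∂μ
  set v := ∫ x, ∫ y, ∫ z, h x y z ^ 2 ∂μ ∂μ ∂μ
  have hr0 : 0 ≤ 1 - q := by linarith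
  have hr1 : 1 - q ≤ 1 := by linarith
  have hr2 : (1 - q) ^ 2 ≤ 1 := pow_le_one₀ hr0 hr1
  have hr3 : (1 - q) ^ 3 ≤ 1 := pow_le_one₀ hr0 hr1
  have a1 : (1 - q) ^ 2 * (q * (v1 + v2 + v3)) ≤ q * (v1 + v2 + v3) :=
    mul_le_of_le_one_left (by positivity) hr2
  have a2 : (1 - q) * (q ^ 2 * (v12 + v13 + v23)) ≤ q ^ 2 * (v12 + v13 + v23) :=
    mul_le_of_le_one_left (by positivity) hr1
  have a3 : (1 - q) ^ 3 * t ^ 2 ≤ t ^ 2 := mul_le_of_le_one_left (by positivity) hr3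
  nlinarith [a1, a2, a3]

/-- All terms are nonnegative, so the six intermediate ones may be discarded; only the full second
moment and the squared mean remain. -/
theorem le_variance_ustat {n : ℕ} (hn : 1 ≤ n)
    (hh : BddMeas fun z : E × E × E => h z.1 z.2.1 z.2.2) :
    (∫ x, ∫ y, ∫ z, h x y z ^ 2 ∂μ ∂μ ∂μ) / n ^ 3 -
      3 * (∫ z, ∫ y, ∫ x, h x y z ∂μ ∂μ ∂μ) ^ 2 / n ≤ Var[ustat h; threeLaw μ n] := by
  rw [variance_eq_sub (hh.ustat.memLp _)]
  simp only [Pi.pow_apply]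
  rw [integral_ustat μ hn hh, integral_ustat_sq μ hn hh]
  have hn' : (1 : ℝ) ≤ n := by exact_mod_cast hn
  have hn0 : (0 : ℝ) < n := by linarith
  set q : ℝ := 1 / n with hq
  have hq0 : 0 < q := by positivity
  have hq1 : q ≤ 1 := by rw [hq, div_le_one hn0]; exact hn'
  have e1 : ∀ t : ℝ, t / n = q * t := fun t => by rw [hq]; ring
  have e3 : ∀ t : ℝ, t / (n : ℝ) ^ 3 = q ^ 3 * t := fun t => by rw [hq]; field_simp
  rw [e1, e3]
  have p1 : 0 ≤ ∫ x, (∫ z, ∫ y, h x y z ∂μ ∂μ) ^ 2 ∂μ := integral_nonneg fun _ => sq_nonneg _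
  have p2 : 0 ≤ ∫ y, (∫ z, ∫ x, h x y z ∂μ ∂μ) ^ 2 ∂μ := integral_nonneg fun _ => sq_nonneg _
  have p3 : 0 ≤ ∫ z, (∫ y, ∫ x, h x y z ∂μ ∂μ) ^ 2 ∂μ := integral_nonneg fun _ => sq_nonneg _
  have p12 : 0 ≤ ∫ x, ∫ y, (∫ z, h x y z ∂μ) ^ 2 ∂μ ∂μ :=
    integral_nonneg fun _ => integral_nonneg fun _ => sq_nonneg _
  have p13 : 0 ≤ ∫ x, ∫ z, (∫ y, h x y z ∂μ) ^ 2 ∂μ ∂μ :=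
    integral_nonneg fun _ => integral_nonneg fun _ => sq_nonneg _
  have p23 : 0 ≤ ∫ y, ∫ z, (∫ x, h x y z ∂μ) ^ 2 ∂μ ∂μ :=
    integral_nonneg fun _ => integral_nonneg fun _ => sq_nonneg _
  set v1 := ∫ x, (∫ z, ∫ y, h x y z ∂μ ∂μ) ^ 2 ∂μ
  set v2 := ∫ y, (∫ z, ∫ x, h x y z ∂μ ∂μ) ^ 2 ∂μ
  set v3 := ∫ z, (∫ y, ∫ x, h x y z ∂μ ∂μ) ^ 2 ∂μ
  set v12 := ∫ x, ∫ y, (∫ z, h x y z ∂μ) ^ 2 ∂μ ∂μ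
  set v13 := ∫ x, ∫ z, (∫ y, h x y z ∂μ) ^ 2 ∂μ ∂μ
  set v23 := ∫ y, ∫ z, (∫ x, h x y z ∂μ) ^ 2 ∂μ ∂μ
  set t := ∫ z, ∫ y, ∫ x, h x y z ∂μ ∂μ ∂μ
  set v := ∫ x, ∫ y, ∫ z, h x y z ^ 2 ∂μ ∂μ ∂μ
  have hr0 : 0 ≤ 1 - q := by linarith
  have a1 : 0 ≤ (1 - q) ^ 2 * (q * (v1 + v2 + v3)) := by positivity
  have a2 : 0 ≤ (1 - q) * (q ^ 2 * (v12 + v13 + v23)) := by positivity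
  -- Bernoulli's inequality: replacing `(1 - 1/n)³ t²` by `t²` costs at most `3 t² / n`.
  have a3 : (1 - 3 * q) * t ^ 2 ≤ (1 - q) ^ 3 * t ^ 2 := by
    refine mul_le_mul_of_nonneg_right ?_ (sq_nonneg _)
    nlinarith [sq_nonneg q, mul_nonneg (sq_nonneg q) (by linarith : (0 : ℝ) ≤ 3 - q)]
  nlinarith [a1, a2, a3]

end UStat

/-! ### Distributions in the model -/

section Model

variable {d : ℕ}

theorem measurable_obsX : Measurable (obsX : Obs d → Fin d → ℝ) := measurable_fst
theorem measurable_obsA : Measurable (obsA : Obs d → ℝ) := measurable_snd.fst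
theorem measurable_obsY : Measurable (obsY : Obs d → ℝ) := measurable_snd.snd

theorem sigmaX_le : sigmaX d ≤ (inferInstance : MeasurableSpace (Obs d)) :=
  measurable_obsX.comap_le

variable {P : ProbabilityMeasure (Obs d)}

theorem ae_obsX_mem (hX : (P : Measure (Obs d)).map obsX = volume.restrict (cube d)) :
    ∀ᵐ o ∂(P : Measure (Obs d)), obsX o ∈ cube d := by
  have h : ∀ᵐ x ∂((P : Measure (Obs d)).map obsX), x ∈ cube d := by
    rw [hX]; exact ae_restrict_mem (measurableSet_cube d)
  exact ae_of_ae_map measurable_obsX.aemeasurable h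

theorem integral_comp_obsX (hX : (P : Measure (Obs d)).map obsX = volume.restrict (cube d))
    {f : (Fin d → ℝ) → ℝ} (hf : ContinuousOn f (cube d)) :
    ∫ o, f (obsX o) ∂(P : Measure (Obs d)) = ∫ x in cube d, f x := by
  rw [← hX, integral_map measurable_obsX.aemeasurable]
  rw [hX]
  exact (integrable_cube hf).aestronglyMeasurable

/-- Regression functions are controlled only on the cube. Extension by zero makes them measurable
everywhere and leaves them unchanged where `X` takes its values. -/
theorem measurable_indicator_cube {f : (Fin d → ℝ) → ℝ} (hf : ContinuousOn f (cube d)) :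
    Measurable ((cube d).indicator f) := by
  classical
  rw [← Set.piecewise_eq_indicator]
  exact hf.measurable_piecewise continuousOn_const (measurableSet_cube d)

theorem exists_bound_indicator_cube {f : (Fin d → ℝ) → ℝ} (hf : ContinuousOn f (cube d)) :
    ∃ C, ∀ x, |(cube d).indicator f x| ≤ C := by
  obtain ⟨C, hC⟩ := (isCompact_cube d).exists_bound_of_continuousOn hf
  refine ⟨max 0 C, fun x => ?_⟩
  by_cases hx : x ∈ cube d
  · rw [indicator_of_mem hx]; exact (hC x hx).trans (le_max_right _ _)
  · rw [indicator_of_notMem hx, abs_zero]; exact le_max_left _ _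

/-- The tower property: `f(X)` is bounded and `σ(X)`-measurable, so it can be pulled out of the
conditional expectation of `Z`, which is `g(X)`. -/
theorem integral_mul_comp_obsX (hX : (P : Measure (Obs d)).map obsX = volume.restrict (cube d))
    {Z : Obs d → ℝ} (hZ : Integrable Z (P : Measure (Obs d))) {g f : (Fin d → ℝ) → ℝ}
    (hg : ContinuousOn g (cube d)) (hr : IsRegression P Z g) (hf : ContinuousOn f (cube d)) :
    ∫ o, Z o * f (obsX o) ∂(P : Measure (Obs d)) = inner2 g f := by
  set f' := (cube d).indicator f with hf'
  have hm : Measurable f' := measurable_indicator_cube hf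
  obtain ⟨C, hC⟩ := exists_bound_indicator_cube hf
  have hmX : StronglyMeasurable[sigmaX d] fun o : Obs d => f' (obsX o) :=
    (hm.comp (comap_measurable obsX)).stronglyMeasurable
  have h1 : ∀ᵐ o ∂(P : Measure (Obs d)), f (obsX o) = f' (obsX o) := by
    filter_upwards [ae_obsX_mem hX] with o ho
    rw [hf', indicator_of_mem ho]
  have hint : Integrable (Z * fun o => f' (obsX o)) (P : Measure (Obs d)) :=
    hZ.mul_bdd (c := C) (hm.comp measurable_obsX).aestronglyMeasurable
      (ae_of_all _ fun o => hC _)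
  calc ∫ o, Z o * f (obsX o) ∂(P : Measure (Obs d))
      = ∫ o, (Z * fun o => f' (obsX o)) o ∂(P : Measure (Obs d)) := by
        refine integral_congr_ae ?_
        filter_upwards [h1] with o ho
        simp [ho]
    _ = ∫ o, ((P : Measure (Obs d))[Z * fun o => f' (obsX o) | sigmaX d]) o
          ∂(P : Measure (Obs d)) := (integral_condExp sigmaX_le).symm
    _ = ∫ o, g (obsX o) * f (obsX o) ∂(P : Measure (Obs d)) := by
        refine integral_congr_ae ?_
        filter_upwards [condExp_mul_of_stronglyMeasurable_right hmX hint hZ, hr, h1]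
          with o h2 h3 h4
        rw [h2, Pi.mul_apply, h3, h4]
    _ = inner2 g f := integral_comp_obsX hX (hg.mul hf)

/-- Truncation to `[C₁, C₂]`. -/
def clip (C₁ C₂ z : ℝ) : ℝ := max C₁ (min z C₂)

theorem clip_of_mem {C₁ C₂ z : ℝ} (hz : z ∈ Icc C₁ C₂) : clip C₁ C₂ z = z := by
  rw [clip, min_eq_left hz.2, max_eq_right hz.1]

/-- A bound on the absolute values of the points of `[C₁, C₂]`. -/
def radius (C₁ C₂ : ℝ) : ℝ := 1 + |C₁| + |C₂|

theorem radius_pos (C₁ C₂ : ℝ) : 0 < radius C₁ C₂ := by unfold radius; positivity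

theorem abs_clip_le (C₁ C₂ z : ℝ) : |clip C₁ C₂ z| ≤ radius C₁ C₂ := by
  unfold clip radius
  have h1 := neg_abs_le C₁
  have h2 := le_abs_self C₁
  have h3 := neg_abs_le C₂
  have h4 := le_abs_self C₂
  have h5 := abs_nonneg C₁
  have h6 := abs_nonneg C₂
  rw [abs_le]
  constructor
  · exact le_trans (by linarith) (le_max_left _ _)
  · exact max_le (by linarith) ((min_le_right _ _).trans (by linarith))

theorem measurable_clip (C₁ C₂ : ℝ) : Measurable (clip C₁ C₂) := by
  unfold clip; fun_prop

theorem bddMeas_clip (C₁ C₂ : ℝ) : BddMeas (clip C₁ C₂) :=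
  ⟨measurable_clip C₁ C₂, radius C₁ C₂, abs_clip_le C₁ C₂⟩

/-- The truncated version of `A`. -/
def clipA (C₁ C₂ : ℝ) (o : Obs d) : ℝ := clip C₁ C₂ (obsA o)

/-- The truncated version of `Y`. -/
def clipY (C₁ C₂ : ℝ) (o : Obs d) : ℝ := clip C₁ C₂ (obsY o)

theorem bddMeas_clipA (C₁ C₂ : ℝ) : BddMeas (clipA C₁ C₂ : Obs d → ℝ) :=
  (bddMeas_clip C₁ C₂).comp measurable_obsA

theorem bddMeas_clipY (C₁ C₂ : ℝ) : BddMeas (clipY C₁ C₂ : Obs d → ℝ) :=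
  (bddMeas_clip C₁ C₂).comp measurable_obsY

/-- The properties that almost every observation from a distribution in the model has. -/
def Regular (C₁ C₂ : ℝ) (o : Obs d) : Prop :=
  obsX o ∈ cube d ∧ obsA o ∈ Icc C₁ C₂ ∧ obsY o ∈ Icc C₁ C₂

theorem Regular.clipA {C₁ C₂ : ℝ} {o : Obs d} (h : Regular C₁ C₂ o) : clipA C₁ C₂ o = obsA o :=
  clip_of_mem h.2.1

theorem Regular.clipY {C₁ C₂ : ℝ} {o : Obs d} (h : Regular C₁ C₂ o) : clipY C₁ C₂ o = obsY o :=
  clip_of_mem h.2.2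

variable {S : ℕ} {B : CDVBasis S} {C₁ C₂ α β M : ℝ}

theorem ae_regular (hP : P ∈ B.model d C₁ C₂ α β M) :
    ∀ᵐ o ∂(P : Measure (Obs d)), Regular C₁ C₂ o := by
  filter_upwards [ae_obsX_mem hP.1, hP.2.1] with o h1 h2
  exact ⟨h1, h2⟩

/-- Under the model `A` is bounded only almost surely. Truncation changes it on a null set and
yields integrands that are bounded everywhere, to which the `BddMeas` calculus applies. -/
theorem clipA_ae_eq (hP : P ∈ B.model d C₁ C₂ α β M) :
    (clipA C₁ C₂ : Obs d → ℝ) =ᵐ[(P : Measure (Obs d))] obsA := by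
  filter_upwards [ae_regular hP] with o h using h.clipA

theorem clipY_ae_eq (hP : P ∈ B.model d C₁ C₂ α β M) :
    (clipY C₁ C₂ : Obs d → ℝ) =ᵐ[(P : Measure (Obs d))] obsY := by
  filter_upwards [ae_regular hP] with o h using h.clipY

theorem integrable_obsA (hP : P ∈ B.model d C₁ C₂ α β M) :
    Integrable obsA (P : Measure (Obs d)) :=
  ((bddMeas_clipA C₁ C₂).integrable _).congr (clipA_ae_eq hP)

theorem integrable_obsY (hP : P ∈ B.model d C₁ C₂ α β M) :
    Integrable obsY (P : Measure (Obs d)) :=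
  ((bddMeas_clipY C₁ C₂).integrable _).congr (clipY_ae_eq hP)

theorem integral_clipA_mul (hP : P ∈ B.model d C₁ C₂ α β M) {p f : (Fin d → ℝ) → ℝ}
    (hp : p ∈ B.holderBall d α M) (hr : IsRegression P obsA p) (hf : ContinuousOn f (cube d)) :
    ∫ o, clipA C₁ C₂ o * f (obsX o) ∂(P : Measure (Obs d)) = inner2 p f := by
  rw [← integral_mul_comp_obsX hP.1 (integrable_obsA hP) hp.1.continuousOn hr hf]
  refine integral_congr_ae ?_
  filter_upwards [clipA_ae_eq hP] with o h
  rw [h]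

theorem integral_clipY_mul (hP : P ∈ B.model d C₁ C₂ α β M) {b f : (Fin d → ℝ) → ℝ}
    (hb : b ∈ B.holderBall d β M) (hr : IsRegression P obsY b) (hf : ContinuousOn f (cube d)) :
    ∫ o, clipY C₁ C₂ o * f (obsX o) ∂(P : Measure (Obs d)) = inner2 b f := by
  rw [← integral_mul_comp_obsX hP.1 (integrable_obsY hP) hb.1.continuousOn hr hf]
  refine integral_congr_ae ?_
  filter_upwards [clipY_ae_eq hP] with o h
  rw [h]

/-- On expanding `(A - p(X))(Y - b(X))`, each cross term and the product `p(X) b(X)` integrate to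
`⟨p, b⟩`; the signs leave a single `-⟨p, b⟩`. -/
theorem psi_eq (hP : P ∈ B.model d C₁ C₂ α β M) {p b : (Fin d → ℝ) → ℝ}
    (hp : p ∈ B.holderBall d α M) (hpr : IsRegression P obsA p)
    (hb : b ∈ B.holderBall d β M) (hbr : IsRegression P obsY b) :
    psi P = (∫ o, clipA C₁ C₂ o * clipY C₁ C₂ o ∂(P : Measure (Obs d))) - inner2 p b := by
  have hpc := hp.1.continuousOn
  have hbc := hb.1.continuousOn
  have hpm := measurable_indicator_cube hpc
  have hbm := measurable_indicator_cube hbc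
  set p' := (cube d).indicator p
  set b' := (cube d).indicator b
  have hP' : BddMeas fun o : Obs d => p' (obsX o) :=
    ⟨hpm.comp measurable_obsX, (exists_bound_indicator_cube hpc).imp fun C hC o => hC _⟩
  have hB' : BddMeas fun o : Obs d => b' (obsX o) :=
    ⟨hbm.comp measurable_obsX, (exists_bound_indicator_cube hbc).imp fun C hC o => hC _⟩
  have ha := bddMeas_clipA (d := d) C₁ C₂
  have hy := bddMeas_clipY (d := d) C₁ C₂
  have e1 : ContinuousOn p' (cube d) := hpc.congr fun x hx => indicator_of_mem hx p
  have e2 : ContinuousOn b' (cube d) := hbc.congr fun x hx => indicator_of_mem hx b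
  have i1 : inner2 p b' = inner2 p b := inner2_congr (fun _ _ => rfl)
    fun x hx => indicator_of_mem hx b
  have i2 : inner2 b p' = inner2 p b := (inner2_congr (fun _ _ => rfl)
    fun x hx => indicator_of_mem hx p).trans (inner2_comm _ _)
  have i3 : inner2 p' b' = inner2 p b := inner2_congr (fun x hx => indicator_of_mem hx p)
    fun x hx => indicator_of_mem hx b
  unfold psi condCovAY
  rw [integral_condExp sigmaX_le]
  have h1 : ∫ o, (obsA o - ((P : Measure (Obs d))[obsA | sigmaX d]) o) *
      (obsY o - ((P : Measure (Obs d))[obsY | sigmaX d]) o) ∂(P : Measure (Obs d)) =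
      ∫ o, (clipA C₁ C₂ o * clipY C₁ C₂ o - clipA C₁ C₂ o * b' (obsX o)
        - clipY C₁ C₂ o * p' (obsX o) + p' (obsX o) * b' (obsX o)) ∂(P : Measure (Obs d)) := by
    refine integral_congr_ae ?_
    filter_upwards [hpr, hbr, ae_regular hP] with o h2 h3 h4
    rw [h2, h3, h4.clipA, h4.clipY]
    simp only [p', b', indicator_of_mem h4.1]
    ring
  rw [h1, integral_add ((((ha.mul hy).sub (ha.mul hB')).sub (hy.mul hP')).integrable _)
      ((hP'.mul hB').integrable _),
    integral_sub (((ha.mul hy).sub (ha.mul hB')).integrable _) ((hy.mul hP').integrable _),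
    integral_sub ((ha.mul hy).integrable _) ((ha.mul hB').integrable _),
    integral_clipA_mul hP hp hpr e2, integral_clipY_mul hP hb hbr e1,
    integral_comp_obsX hP.1 (f := fun x => p' x * b' x) (e1.mul e2), i1, i2]
  rw [show ∫ x in cube d, p' x * b' x = inner2 p b from i3]
  ring

/-! ### The estimators as three-sample averages -/

theorem ae_sample {p : Obs d → Prop} (h : ∀ᵐ o ∂(P : Measure (Obs d)), p o) (m n : ℕ) :
    ∀ᵐ D ∂(sampleLaw P m n), ∀ i k, p (D i k) := by
  rw [ae_all_iff]
  intro i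
  rw [ae_all_iff]
  intro k
  have h1 := measurePreserving_eval (fun _ : Fin m => Measure.pi fun _ : Fin n =>
    (P : Measure (Obs d))) i
  have h2 := measurePreserving_eval (fun _ : Fin n => (P : Measure (Obs d))) k
  exact (h2.comp h1).quasiMeasurePreserving.ae h

instance (m n : ℕ) : IsProbabilityMeasure (sampleLaw P m n) := by
  unfold sampleLaw; infer_instance

theorem measurePreserving_three (n : ℕ) : MeasurePreserving
    (fun D : Sample d 3 n => (D 0, D 1, D 2)) (sampleLaw P 3 n)
      (threeLaw (P : Measure (Obs d)) n) := by
  have h1 := measurePreserving_piFinSuccAbove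
    (fun _ : Fin 3 => Measure.pi fun _ : Fin n => (P : Measure (Obs d))) 0
  have h2 := measurePreserving_piFinTwo
    (fun _ : Fin 2 => Measure.pi fun _ : Fin n => (P : Measure (Obs d)))
  exact ((MeasurePreserving.id _).prod h2).comp h1

/-- Subsample `2` is put first because it enters the Monte Carlo estimator only through the mean of
`A Y`, independently of the three samples that approximate the integral. -/
theorem measurePreserving_four (n : ℕ) : MeasurePreserving
    (fun D : Sample d 4 n => (D 2, D 0, D 1, D 3)) (sampleLaw P 4 n)
      ((iidLaw (P : Measure (Obs d)) n).prod (threeLaw (P : Measure (Obs d)) n)) := by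
  have h1 := measurePreserving_piFinSuccAbove
    (fun _ : Fin 4 => Measure.pi fun _ : Fin n => (P : Measure (Obs d))) 2
  exact ((MeasurePreserving.id _).prod (measurePreserving_three n)).comp h1

theorem avg_const {n : ℕ} (hn : 1 ≤ n) (c : ℝ) : avg (fun _ : Fin n => c) = c := by
  have : (n : ℝ) ≠ 0 := by positivity
  simp [avg]
  field_simp

theorem avg_sub {n : ℕ} (f g : Fin n → ℝ) : avg (fun i => f i - g i) = avg f - avg g := by
  simp [avg, mul_sub]

theorem avg_mul_const {n : ℕ} (f : Fin n → ℝ) (c : ℝ) : avg (fun i => f i * c) = avg f * c := by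
  simp [avg, ← Finset.sum_mul, mul_assoc]

theorem avg_const_mul {n : ℕ} (f : Fin n → ℝ) (c : ℝ) : avg (fun i => c * f i) = c * avg f := by
  simp_rw [mul_comm c, avg_mul_const]

theorem avg_comm {n : ℕ} (f : Fin n → Fin n → ℝ) :
    avg (fun i => avg fun k => f i k) = avg fun k => avg fun i => f i k := by
  simp only [avg, ← Finset.mul_sum]
  rw [Finset.sum_comm]

/-- A product of two sample means evaluated at the points of a third sample is a three-sample
average; this is how `ustat` arises. -/
theorem avg_mul_avg {n : ℕ} (f g : Fin n → Fin n → ℝ) :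
    avg (fun i => avg fun k => avg fun l => f i l * g k l) =
      avg fun l => avg (fun i => f i l) * avg fun k => g k l := by
  have h1 : ∀ i, avg (fun k => avg fun l => f i l * g k l) =
      avg fun l => f i l * avg fun k => g k l := fun i => by
    rw [avg_comm]; simp_rw [avg_const_mul]
  simp_rw [h1]
  rw [avg_comm]
  simp_rw [avg_mul_const]

variable (B) in
/-- Kernel of the integral-based estimator. -/
def CDVBasis.hINT (C₁ C₂ : ℝ) (j : ℕ) (o₁ o₂ o₃ : Obs d) : ℝ :=
  clipA C₁ C₂ o₃ * clipY C₁ C₂ o₃ -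
    clipA C₁ C₂ o₁ * clipY C₁ C₂ o₂ * B.kernel j (obsX o₁) (obsX o₂)

variable (B) in
/-- Kernel of the Monte Carlo approximation to the integral. -/
def CDVBasis.hMC (C₁ C₂ : ℝ) (j₁ j₂ : ℕ) (o₁ o₂ o₃ : Obs d) : ℝ :=
  (clipA C₁ C₂ o₁ * B.kernel j₁ (obsX o₁) (obsX o₃)) *
    (clipY C₁ C₂ o₂ * B.kernel j₂ (obsX o₂) (obsX o₃))

variable (B) in
/-- Kernel of the bias-corrected estimator. -/
def CDVBasis.hIF (C₁ C₂ : ℝ) (j₁ j₂ : ℕ) (o₁ o₂ o₃ : Obs d) : ℝ :=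
  (clipA C₁ C₂ o₃ - clipA C₁ C₂ o₁ * B.kernel j₁ (obsX o₁) (obsX o₃)) *
    (clipY C₁ C₂ o₃ - clipY C₁ C₂ o₂ * B.kernel j₂ (obsX o₂) (obsX o₃))

variable (B) in
theorem CDVBasis.bddMeas_kernel (j : ℕ) :
    BddMeas fun z : (Fin d → ℝ) × (Fin d → ℝ) => B.kernel j z.1 z.2 :=
  ⟨(B.continuous_kernel j).measurable, _, fun z => B.abs_kernel_le j z.1 z.2⟩

variable (B) in
theorem CDVBasis.bddMeas_kernel_comp {E : Type*} [MeasurableSpace E] (j : ℕ)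
    {f g : E → Obs d} (hf : Measurable f) (hg : Measurable g) :
    BddMeas fun z => B.kernel j (obsX (f z)) (obsX (g z)) :=
  BddMeas.comp (φ := fun z => (obsX (f z), obsX (g z))) (B.bddMeas_kernel j)
    ((measurable_obsX.comp hf).prodMk (measurable_obsX.comp hg))

theorem bddMeas_clipA_comp {E : Type*} [MeasurableSpace E] {f : E → Obs d} (hf : Measurable f) :
    BddMeas fun z => clipA C₁ C₂ (f z) := (bddMeas_clipA C₁ C₂).comp hf

theorem bddMeas_clipY_comp {E : Type*} [MeasurableSpace E] {f : E → Obs d} (hf : Measurable f) :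
    BddMeas fun z => clipY C₁ C₂ (f z) := (bddMeas_clipY C₁ C₂).comp hf

theorem measurable_coord_one : Measurable fun z : Obs d × Obs d × Obs d => z.1 := measurable_fst

theorem measurable_coord_two : Measurable fun z : Obs d × Obs d × Obs d => z.2.1 :=
  measurable_snd.fst

theorem measurable_coord_three : Measurable fun z : Obs d × Obs d × Obs d => z.2.2 :=
  measurable_snd.snd

theorem CDVBasis.bddMeas_hINT (j : ℕ) :
    BddMeas fun z : Obs d × Obs d × Obs d => B.hINT C₁ C₂ j z.1 z.2.1 z.2.2 :=
  ((bddMeas_clipA_comp measurable_coord_three).mul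
    (bddMeas_clipY_comp measurable_coord_three)).sub
    (((bddMeas_clipA_comp measurable_coord_one).mul
      (bddMeas_clipY_comp measurable_coord_two)).mul
      (B.bddMeas_kernel_comp j measurable_coord_one measurable_coord_two))

theorem CDVBasis.bddMeas_hMC (j₁ j₂ : ℕ) :
    BddMeas fun z : Obs d × Obs d × Obs d => B.hMC C₁ C₂ j₁ j₂ z.1 z.2.1 z.2.2 :=
  ((bddMeas_clipA_comp measurable_coord_one).mul
    (B.bddMeas_kernel_comp j₁ measurable_coord_one measurable_coord_three)).mul
    ((bddMeas_clipY_comp measurable_coord_two).mul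
      (B.bddMeas_kernel_comp j₂ measurable_coord_two measurable_coord_three))

theorem CDVBasis.bddMeas_hIF (j₁ j₂ : ℕ) :
    BddMeas fun z : Obs d × Obs d × Obs d => B.hIF C₁ C₂ j₁ j₂ z.1 z.2.1 z.2.2 :=
  ((bddMeas_clipA_comp measurable_coord_three).sub ((bddMeas_clipA_comp measurable_coord_one).mul
    (B.bddMeas_kernel_comp j₁ measurable_coord_one measurable_coord_three))).mul
    ((bddMeas_clipY_comp measurable_coord_three).sub
      ((bddMeas_clipY_comp measurable_coord_two).mul
      (B.bddMeas_kernel_comp j₂ measurable_coord_two measurable_coord_three)))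

theorem CDVBasis.projEst_eq_avg {n : ℕ} (Z : Obs d → ℝ) (j : ℕ) (D : Fin n → Obs d)
    (x : Fin d → ℝ) : B.projEst Z j D x = avg fun i => Z (D i) * B.kernel j (obsX (D i)) x := rfl

theorem integral_cube_avg {n : ℕ} {f : Fin n → (Fin d → ℝ) → ℝ}
    (hf : ∀ i, ContinuousOn (f i) (cube d)) :
    ∫ x in cube d, avg (fun i => f i x) = avg fun i => ∫ x in cube d, f i x := by
  simp_rw [avg]
  rw [integral_const_mul, integral_finsetSum _ fun i _ => integrable_cube (hf i)]

/-- The integral of a product of two kernels is the kernel of the coarser space, so the finer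
resolution disappears from the estimator altogether. This explains why only the minimum occurs in
both its bias and its variance. -/
theorem psiINT_ae_eq (hP : P ∈ B.model d C₁ C₂ α β M) {n : ℕ} (hn : 1 ≤ n) {j₁ j₂ : ℕ}
    (h₁ : B.J₀ ≤ j₁) (h₂ : B.J₀ ≤ j₂) :
    (B.psiINT j₁ j₂ : Sample d 3 n → ℝ) =ᵐ[sampleLaw P 3 n]
      fun D => ustat (B.hINT C₁ C₂ (min j₁ j₂)) (D 0, D 1, D 2) := by
  filter_upwards [ae_sample (ae_regular hP) 3 n] with D hD
  have hK : ∀ j (x : Fin d → ℝ), Continuous (B.kernel j x) := fun j x =>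
    B.continuous_kernel_right j x
  have h1 : ∫ x in cube d, B.projEst obsA j₁ (D 0) x * B.projEst obsY j₂ (D 1) x =
      avg fun i => avg fun k => obsA (D 0 i) * obsY (D 1 k) *
        B.kernel (min j₁ j₂) (obsX (D 0 i)) (obsX (D 1 k)) := by
    have h2 : ∀ x, B.projEst obsA j₁ (D 0) x * B.projEst obsY j₂ (D 1) x =
        avg fun i => avg fun k => (obsA (D 0 i) * obsY (D 1 k)) *
          (B.kernel j₁ (obsX (D 0 i)) x * B.kernel j₂ (obsX (D 1 k)) x) := by
      intro x
      rw [B.projEst_eq_avg, B.projEst_eq_avg, ← avg_mul_const]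
      simp_rw [← avg_const_mul]
      congr 1; ext i; congr 1; ext k; ring
    simp_rw [h2]
    have hc : ∀ i k, ContinuousOn (fun x => (obsA (D 0 i) * obsY (D 1 k)) *
          (B.kernel j₁ (obsX (D 0 i)) x * B.kernel j₂ (obsX (D 1 k)) x)) (cube d) := fun i k =>
      (continuous_const.mul ((hK _ _).mul (hK _ _))).continuousOn
    rw [integral_cube_avg]
    · congr 1; ext i
      rw [integral_cube_avg (hc i)]
      congr 1; ext k
      rw [integral_const_mul, B.integral_kernel_kernel h₁ h₂ (hD 0 i).1 (hD 1 k).1]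
    · intro i
      simp_rw [avg]
      exact continuousOn_const.mul (continuousOn_finsetSum _ fun k _ => hc i k)
  unfold CDVBasis.psiINT
  rw [h1]
  simp only [ustat, CDVBasis.hINT, avg_sub, avg_const hn, (hD _ _).clipA, (hD _ _).clipY]
  rfl

theorem psiMC_ae_eq (hP : P ∈ B.model d C₁ C₂ α β M) {n : ℕ} (j₁ j₂ : ℕ) :
    (B.psiMC j₁ j₂ : Sample d 4 n → ℝ) =ᵐ[sampleLaw P 4 n]
      fun D => avg (fun i => clipA C₁ C₂ (D 2 i) * clipY C₁ C₂ (D 2 i)) -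
        ustat (B.hMC C₁ C₂ j₁ j₂) (D 0, D 1, D 3) := by
  filter_upwards [ae_sample (ae_regular hP) 4 n] with D hD
  simp only [ustat, CDVBasis.hMC, avg_mul_avg, (hD _ _).clipA, (hD _ _).clipY]
  rfl

theorem psiIF_ae_eq (hP : P ∈ B.model d C₁ C₂ α β M) {n : ℕ} (hn : 1 ≤ n) (j₁ j₂ : ℕ) :
    (B.psiIF j₁ j₂ : Sample d 3 n → ℝ) =ᵐ[sampleLaw P 3 n]
      fun D => ustat (B.hIF C₁ C₂ j₁ j₂) (D 0, D 1, D 2) := by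
  filter_upwards [ae_sample (ae_regular hP) 3 n] with D hD
  simp only [ustat, CDVBasis.hIF, (hD _ _).clipA, (hD _ _).clipY]
  rw [avg_mul_avg (fun i l => obsA (D 2 l) - obsA (D 0 i) * B.kernel j₁ (obsX (D 0 i)) (obsX (D 2 l)))
    (fun k l => obsY (D 2 l) - obsY (D 1 k) * B.kernel j₂ (obsX (D 1 k)) (obsX (D 2 l)))]
  simp only [avg_sub, avg_const hn]
  rfl

/-! ### Square integrability -/

theorem memLp_psiINT (hP : P ∈ B.model d C₁ C₂ α β M) {n : ℕ} (hn : 1 ≤ n) {j₁ j₂ : ℕ}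
    (h₁ : B.J₀ ≤ j₁) (h₂ : B.J₀ ≤ j₂) :
    MemLp (B.psiINT j₁ j₂ : Sample d 3 n → ℝ) 2 (sampleLaw P 3 n) :=
  (memLp_congr_ae (psiINT_ae_eq hP hn h₁ h₂)).2 ((B.bddMeas_hINT _).ustat.comp
    (measurePreserving_three (P := P) n).measurable |>.memLp _)

theorem memLp_psiIF (hP : P ∈ B.model d C₁ C₂ α β M) {n : ℕ} (hn : 1 ≤ n) (j₁ j₂ : ℕ) :
    MemLp (B.psiIF j₁ j₂ : Sample d 3 n → ℝ) 2 (sampleLaw P 3 n) :=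
  (memLp_congr_ae (psiIF_ae_eq hP hn j₁ j₂)).2 ((B.bddMeas_hIF j₁ j₂).ustat.comp
    (measurePreserving_three (P := P) n).measurable |>.memLp _)

theorem bddMeas_four {n : ℕ} (j₁ j₂ : ℕ) : BddMeas fun w : (Fin n → Obs d) ×
    (Fin n → Obs d) × (Fin n → Obs d) × (Fin n → Obs d) =>
      avg (fun i => clipA C₁ C₂ (w.1 i) * clipY C₁ C₂ (w.1 i)) -
        ustat (B.hMC C₁ C₂ j₁ j₂) w.2 := by
  refine BddMeas.sub ?_ ((B.bddMeas_hMC j₁ j₂).ustat.comp measurable_snd)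
  exact BddMeas.avg fun i => ((bddMeas_clipA C₁ C₂).mul (bddMeas_clipY C₁ C₂)).comp
    (φ := fun w : (Fin n → Obs d) × (Fin n → Obs d) × (Fin n → Obs d) × (Fin n → Obs d) => w.1 i)
    (by fun_prop)

theorem memLp_psiMC (hP : P ∈ B.model d C₁ C₂ α β M) {n : ℕ} (j₁ j₂ : ℕ) :
    MemLp (B.psiMC j₁ j₂ : Sample d 4 n → ℝ) 2 (sampleLaw P 4 n) :=
  (memLp_congr_ae (psiMC_ae_eq hP j₁ j₂)).2 ((bddMeas_four (B := B) j₁ j₂).comp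
    (measurePreserving_four (P := P) n).measurable |>.memLp _)

/-! ### Variances -/

theorem variance_psiINT (hP : P ∈ B.model d C₁ C₂ α β M) {n : ℕ} (hn : 1 ≤ n) {j₁ j₂ : ℕ}
    (h₁ : B.J₀ ≤ j₁) (h₂ : B.J₀ ≤ j₂) :
    Var[(B.psiINT j₁ j₂ : Sample d 3 n → ℝ); sampleLaw P 3 n] =
      Var[ustat (B.hINT C₁ C₂ (min j₁ j₂)); threeLaw (P : Measure (Obs d)) n] := by
  rw [variance_congr (psiINT_ae_eq hP hn h₁ h₂)]
  exact (measurePreserving_three n).variance_fun_comp (B.bddMeas_hINT _).ustat.1.aemeasurable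

theorem variance_psiIF (hP : P ∈ B.model d C₁ C₂ α β M) {n : ℕ} (hn : 1 ≤ n) (j₁ j₂ : ℕ) :
    Var[(B.psiIF j₁ j₂ : Sample d 3 n → ℝ); sampleLaw P 3 n] =
      Var[ustat (B.hIF C₁ C₂ j₁ j₂); threeLaw (P : Measure (Obs d)) n] := by
  rw [variance_congr (psiIF_ae_eq hP hn j₁ j₂)]
  exact (measurePreserving_three n).variance_fun_comp (B.bddMeas_hIF _ _).ustat.1.aemeasurable

theorem variance_prod_sub {E F : Type*} [MeasurableSpace E] [MeasurableSpace F] (μ : Measure E)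
    (ν : Measure F) [IsProbabilityMeasure μ] [IsProbabilityMeasure ν] {f : E → ℝ} {g : F → ℝ}
    (hf : BddMeas f) (hg : BddMeas g) :
    Var[fun z : E × F => f z.1 - g z.2; μ.prod ν] = Var[f; μ] + Var[g; ν] := by
  have h := variance_add_prod (hf.memLp μ) (hg.memLp ν).neg
  rw [variance_neg] at h
  simpa [sub_eq_add_neg] using h

theorem variance_avg {E : Type*} [MeasurableSpace E] (μ : Measure E) [IsProbabilityMeasure μ]
    {n : ℕ} (hn : 1 ≤ n) {g : E → ℝ} (hg : BddMeas g) :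
    Var[fun D : Fin n → E => avg fun i => g (D i); iidLaw μ n] = Var[g; μ] / n := by
  have hb : BddMeas fun D : Fin n → E => avg fun i => g (D i) :=
    BddMeas.avg fun i => hg.comp (measurable_pi_apply i)
  rw [variance_eq_sub (hb.memLp _), variance_eq_sub (hg.memLp _)]
  simp only [Pi.pow_apply]
  rw [integral_avg_iidLaw μ hn hg, integral_avg_sq μ hn hg]
  ring

/-- The two pieces depend on disjoint subsamples, so their variances add. -/
theorem variance_psiMC (hP : P ∈ B.model d C₁ C₂ α β M) {n : ℕ} (hn : 1 ≤ n) (j₁ j₂ : ℕ) :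
    Var[(B.psiMC j₁ j₂ : Sample d 4 n → ℝ); sampleLaw P 4 n] =
      Var[fun o => clipA C₁ C₂ o * clipY C₁ C₂ o; (P : Measure (Obs d))] / n +
      Var[ustat (B.hMC C₁ C₂ j₁ j₂); threeLaw (P : Measure (Obs d)) n] := by
  have hg : BddMeas fun o : Obs d => clipA C₁ C₂ o * clipY C₁ C₂ o :=
    (bddMeas_clipA C₁ C₂).mul (bddMeas_clipY C₁ C₂)
  rw [variance_congr (psiMC_ae_eq hP j₁ j₂)]
  refine ((measurePreserving_four n).variance_fun_comp
    (bddMeas_four (B := B) j₁ j₂).1.aemeasurable).trans ?_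
  have hf : BddMeas fun D : Fin n → Obs d =>
      avg fun i => clipA C₁ C₂ (D i) * clipY C₁ C₂ (D i) :=
    BddMeas.avg fun i => hg.comp (φ := fun D : Fin n → Obs d => D i) (measurable_pi_apply i)
  have hu : BddMeas (ustat (n := n) (B.hMC (d := d) C₁ C₂ j₁ j₂)) := (B.bddMeas_hMC j₁ j₂).ustat
  rw [variance_prod_sub (iidLaw (P : Measure (Obs d)) n) (threeLaw (P : Measure (Obs d)) n) hf hu,
    variance_avg (P : Measure (Obs d)) hn hg]

end Model

/-! ### Biases -/

section Bias

variable {d : ℕ} {S : ℕ} {B : CDVBasis S}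

theorem CDVBasis.bddMeas_Phi (j : ℕ) (m : Fin d → Fin (2 ^ j)) : BddMeas (B.Phi j m) := by
  refine ⟨(B.continuous_Phi j m).measurable, (B.sumC * √(2 ^ j)) ^ d, fun x => ?_⟩
  rw [B.Phi_eq]
  exact (Finset.single_le_sum (f := fun m => |B.Psi j (fun _ => false) m x|)
    (fun _ _ => abs_nonneg _) (Finset.mem_univ m)).trans (B.sum_abs_Psi_le j _ x)

theorem CDVBasis.bddMeas_proj (j : ℕ) {u : (Fin d → ℝ) → ℝ} (hu : ContinuousOn u (cube d)) :
    BddMeas (B.proj j u) := by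
  rw [show B.proj j u = fun x => ∑ m, inner2 u (B.Phi j m) * B.Phi j m x from
    funext (B.proj_eq_sum j hu)]
  exact BddMeas.sum _ fun m _ => (BddMeas.const _).mul (B.bddMeas_Phi j m)

theorem CDVBasis.inner2_proj_comm (j : ℕ) {u v : (Fin d → ℝ) → ℝ} (hu : ContinuousOn u (cube d))
    (hv : ContinuousOn v (cube d)) : inner2 (B.proj j u) v = inner2 u (B.proj j v) := by
  rw [B.inner2_proj_left j hu hv, inner2_comm u, B.inner2_proj_left j hv hu]
  exact Finset.sum_congr rfl fun m _ => mul_comm _ _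

theorem CDVBasis.proj_proj_of_le {j j' : ℕ} (hj : B.J₀ ≤ j) (hjj' : j ≤ j')
    {u : (Fin d → ℝ) → ℝ} (hu : ContinuousOn u (cube d)) {x : Fin d → ℝ} (hx : x ∈ cube d) :
    B.proj j' (B.proj j u) x = B.proj j u x := by
  have h1 : B.proj j' (B.proj j u) x =
      ∫ y in cube d, ∑ m, inner2 u (B.Phi j m) * (B.Phi j m y * B.kernel j' x y) :=
    setIntegral_congr_fun (measurableSet_cube d) fun y _ => by
      simp only [B.proj_eq_sum j hu, Finset.sum_mul, mul_assoc]
  rw [h1, integral_finsetSum, B.proj_eq_sum j hu]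
  · exact Finset.sum_congr rfl fun m _ => by
      rw [integral_const_mul, B.integral_kernel_Phi hj hjj' m hx]
  · exact fun m _ => integrable_cube (continuous_const.mul
      ((B.continuous_Phi j m).mul (B.continuous_kernel_right j' x))).continuousOn

/-- By self-adjointness the finer projection can be moved onto the image of the coarser one, which
it fixes. -/
theorem CDVBasis.inner2_proj_proj {j j' : ℕ} (hj : B.J₀ ≤ j) (hj' : B.J₀ ≤ j')
    {u v : (Fin d → ℝ) → ℝ} (hu : ContinuousOn u (cube d)) (hv : ContinuousOn v (cube d)) :
    inner2 (B.proj j u) (B.proj j' v) = inner2 (B.proj (min j j') u) v := by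
  have hpu := (B.continuous_proj j hu).continuousOn (s := cube d)
  have hpv := (B.continuous_proj j' hv).continuousOn (s := cube d)
  rcases le_total j j' with h | h
  · rw [min_eq_left h, ← B.inner2_proj_comm j' hpu hv]
    exact inner2_congr (fun x hx => B.proj_proj_of_le hj h hu hx) fun _ _ => rfl
  · rw [min_eq_right h, B.inner2_proj_comm j hu hpv, B.inner2_proj_comm j' hu hv]
    exact inner2_congr (fun _ _ => rfl) fun x hx => B.proj_proj_of_le hj' h hv hx

variable {P : ProbabilityMeasure (Obs d)} {C₁ C₂ α β M : ℝ}

theorem integral_clipA_kernel (hP : P ∈ B.model d C₁ C₂ α β M) {p : (Fin d → ℝ) → ℝ}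
    (hp : p ∈ B.holderBall d α M) (hr : IsRegression P obsA p) (j : ℕ) (t : Fin d → ℝ) :
    ∫ o, clipA C₁ C₂ o * B.kernel j (obsX o) t ∂(P : Measure (Obs d)) = B.proj j p t := by
  simp_rw [B.kernel_comm j _ t]
  exact integral_clipA_mul hP hp hr (B.continuous_kernel_right j t).continuousOn

theorem integral_clipY_kernel (hP : P ∈ B.model d C₁ C₂ α β M) {b : (Fin d → ℝ) → ℝ}
    (hb : b ∈ B.holderBall d β M) (hr : IsRegression P obsY b) (j : ℕ) (t : Fin d → ℝ) :
    ∫ o, clipY C₁ C₂ o * B.kernel j (obsX o) t ∂(P : Measure (Obs d)) = B.proj j b t := by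
  simp_rw [B.kernel_comm j _ t]
  exact integral_clipY_mul hP hb hr (B.continuous_kernel_right j t).continuousOn

theorem bddMeas_clipA_kernel (j : ℕ) (t : Fin d → ℝ) :
    BddMeas fun o : Obs d => clipA C₁ C₂ o * B.kernel j (obsX o) t := by
  have h : BddMeas fun o : Obs d => B.kernel j (obsX o) t :=
    BddMeas.comp (φ := fun o : Obs d => (obsX o, t)) (B.bddMeas_kernel j)
      (measurable_obsX.prodMk measurable_const)
  exact (bddMeas_clipA C₁ C₂).mul h

theorem bddMeas_clipY_kernel (j : ℕ) (t : Fin d → ℝ) :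
    BddMeas fun o : Obs d => clipY C₁ C₂ o * B.kernel j (obsX o) t := by
  have h : BddMeas fun o : Obs d => B.kernel j (obsX o) t :=
    BddMeas.comp (φ := fun o : Obs d => (obsX o, t)) (B.bddMeas_kernel j)
      (measurable_obsX.prodMk measurable_const)
  exact (bddMeas_clipY C₁ C₂).mul h

variable {p b : (Fin d → ℝ) → ℝ}

theorem integral_hINT (hP : P ∈ B.model d C₁ C₂ α β M) (hp : p ∈ B.holderBall d α M)
    (hpr : IsRegression P obsA p) (hb : b ∈ B.holderBall d β M) (hbr : IsRegression P obsY b)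
    (j : ℕ) :
    ∫ z, ∫ y, ∫ x, B.hINT C₁ C₂ j x y z ∂(P : Measure (Obs d)) ∂(P : Measure (Obs d))
      ∂(P : Measure (Obs d)) =
      (∫ o, clipA C₁ C₂ o * clipY C₁ C₂ o ∂(P : Measure (Obs d))) - inner2 (B.proj j p) b := by
  have hAY : BddMeas fun o : Obs d => clipA C₁ C₂ o * clipY C₁ C₂ o :=
    (bddMeas_clipA C₁ C₂).mul (bddMeas_clipY C₁ C₂)
  have h1 : ∀ y z, ∫ x, B.hINT C₁ C₂ j x y z ∂(P : Measure (Obs d)) =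
      clipA C₁ C₂ z * clipY C₁ C₂ z - clipY C₁ C₂ y * B.proj j p (obsX y) := by
    intro y z
    have h2 : ∀ x, B.hINT C₁ C₂ j x y z = clipA C₁ C₂ z * clipY C₁ C₂ z -
        clipY C₁ C₂ y * (clipA C₁ C₂ x * B.kernel j (obsX x) (obsX y)) := fun x => by
      unfold CDVBasis.hINT; ring
    simp_rw [h2]
    rw [integral_sub (integrable_const _)
      (((BddMeas.const _).mul (bddMeas_clipA_kernel j (obsX y))).integrable _),
      integral_const, integral_const_mul, integral_clipA_kernel hP hp hpr]
    simp
  simp_rw [h1]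
  have h3 : BddMeas fun y : Obs d => clipY C₁ C₂ y * B.proj j p (obsX y) :=
    (bddMeas_clipY C₁ C₂).mul ((B.bddMeas_proj j hp.1.continuousOn).comp measurable_obsX)
  simp_rw [integral_sub (integrable_const _) (h3.integrable _)]
  rw [integral_clipY_mul hP hb hbr (B.continuous_proj j hp.1.continuousOn).continuousOn]
  simp only [integral_const, probReal_univ, one_smul]
  rw [integral_sub (hAY.integrable _) (integrable_const _), inner2_comm b]
  simp

theorem integral_hMC (hP : P ∈ B.model d C₁ C₂ α β M) (hp : p ∈ B.holderBall d α M)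
    (hpr : IsRegression P obsA p) (hb : b ∈ B.holderBall d β M) (hbr : IsRegression P obsY b)
    {j₁ j₂ : ℕ} (h₁ : B.J₀ ≤ j₁) (h₂ : B.J₀ ≤ j₂) :
    ∫ z, ∫ y, ∫ x, B.hMC C₁ C₂ j₁ j₂ x y z ∂(P : Measure (Obs d)) ∂(P : Measure (Obs d))
      ∂(P : Measure (Obs d)) = inner2 (B.proj (min j₁ j₂) p) b := by
  have hpc := hp.1.continuousOn
  have hbc := hb.1.continuousOn
  simp_rw [CDVBasis.hMC, integral_mul_const, integral_const_mul, integral_clipA_kernel hP hp hpr,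
    integral_clipY_kernel hP hb hbr]
  rw [integral_comp_obsX hP.1 (f := fun x => B.proj j₁ p x * B.proj j₂ b x)
    ((B.continuous_proj j₁ hpc).mul (B.continuous_proj j₂ hbc)).continuousOn]
  exact B.inner2_proj_proj h₁ h₂ hpc hbc

/-- Given the third observation the two factors are independent, with means `A - Π_{j₁} p(X)` and `Y
- Π_{j₂} b(X)`. -/
theorem integral_hIF (hP : P ∈ B.model d C₁ C₂ α β M) (hp : p ∈ B.holderBall d α M)
    (hpr : IsRegression P obsA p) (hb : b ∈ B.holderBall d β M) (hbr : IsRegression P obsY b)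
    {j₁ j₂ : ℕ} (h₁ : B.J₀ ≤ j₁) (h₂ : B.J₀ ≤ j₂) :
    ∫ z, ∫ y, ∫ x, B.hIF C₁ C₂ j₁ j₂ x y z ∂(P : Measure (Obs d)) ∂(P : Measure (Obs d))
      ∂(P : Measure (Obs d)) =
      (∫ o, clipA C₁ C₂ o * clipY C₁ C₂ o ∂(P : Measure (Obs d))) -
        inner2 (B.proj (max j₁ j₂) p) b := by
  have hpc := hp.1.continuousOn
  have hbc := hb.1.continuousOn
  have hcp := (B.continuous_proj j₁ hpc).continuousOn (s := cube d)
  have hcb := (B.continuous_proj j₂ hbc).continuousOn (s := cube d)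
  have ha := bddMeas_clipA (d := d) C₁ C₂
  have hy := bddMeas_clipY (d := d) C₁ C₂
  have hpp := (B.bddMeas_proj j₁ hpc).comp measurable_obsX
  have hbp := (B.bddMeas_proj j₂ hbc).comp measurable_obsX
  have e1 : ∀ z : Obs d, ∫ x, (clipA C₁ C₂ z - clipA C₁ C₂ x * B.kernel j₁ (obsX x) (obsX z))
      ∂(P : Measure (Obs d)) = clipA C₁ C₂ z - B.proj j₁ p (obsX z) := fun z => by
    rw [integral_sub (integrable_const _) ((bddMeas_clipA_kernel j₁ (obsX z)).integrable _),
      integral_clipA_kernel hP hp hpr]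
    simp
  have e2 : ∀ z : Obs d, ∫ x, (clipY C₁ C₂ z - clipY C₁ C₂ x * B.kernel j₂ (obsX x) (obsX z))
      ∂(P : Measure (Obs d)) = clipY C₁ C₂ z - B.proj j₂ b (obsX z) := fun z => by
    rw [integral_sub (integrable_const _) ((bddMeas_clipY_kernel j₂ (obsX z)).integrable _),
      integral_clipY_kernel hP hb hbr]
    simp
  simp_rw [CDVBasis.hIF, integral_mul_const, integral_const_mul, e1, e2]
  have e3 : ∀ z : Obs d, (clipA C₁ C₂ z - B.proj j₁ p (obsX z)) *
      (clipY C₁ C₂ z - B.proj j₂ b (obsX z)) = clipA C₁ C₂ z * clipY C₁ C₂ z -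
        clipA C₁ C₂ z * B.proj j₂ b (obsX z) - clipY C₁ C₂ z * B.proj j₁ p (obsX z) +
        B.proj j₁ p (obsX z) * B.proj j₂ b (obsX z) := fun z => by ring
  simp_rw [e3]
  rw [integral_add ((((ha.mul hy).sub (ha.mul hbp)).sub (hy.mul hpp)).integrable _)
      ((hpp.mul hbp).integrable _),
    integral_sub (((ha.mul hy).sub (ha.mul hbp)).integrable _) ((hy.mul hpp).integrable _),
    integral_sub ((ha.mul hy).integrable _) ((ha.mul hbp).integrable _),
    integral_clipA_mul hP hp hpr hcb, integral_clipY_mul hP hb hbr hcp,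
    integral_comp_obsX hP.1 (f := fun x => B.proj j₁ p x * B.proj j₂ b x) (hcp.mul hcb),
    show ∫ x in cube d, B.proj j₁ p x * B.proj j₂ b x = inner2 (B.proj (min j₁ j₂) p) b from
      B.inner2_proj_proj h₁ h₂ hpc hbc, ← B.inner2_proj_comm j₂ hpc hbc, inner2_comm b]
  -- The cross terms give `⟨Π_{j₁} p, b⟩` and `⟨Π_{j₂} p, b⟩` with a minus sign, the product of
  -- projections gives the one of lower resolution with a plus sign; the one of higher resolution
  -- survives.
  rcases le_total j₁ j₂ with h | h
  · rw [min_eq_left h, max_eq_right h]; ring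
  · rw [min_eq_right h, max_eq_left h]; ring

theorem bias_eq_sub {m n : ℕ} {est : Sample d m n → ℝ} (h : MemLp est 2 (sampleLaw P m n)) :
    bias P est = (∫ D, est D ∂(sampleLaw P m n)) - psi P := by
  rw [bias, integral_sub (h.integrable one_le_two) (integrable_const _)]
  simp

theorem integral_three {n : ℕ} (hn : 1 ≤ n) {h : Obs d → Obs d → Obs d → ℝ}
    (hh : BddMeas fun z : Obs d × Obs d × Obs d => h z.1 z.2.1 z.2.2) :
    ∫ D : Sample d 3 n, ustat h (D 0, D 1, D 2) ∂(sampleLaw P 3 n) =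
      ∫ z, ∫ y, ∫ x, h x y z ∂(P : Measure (Obs d)) ∂(P : Measure (Obs d))
        ∂(P : Measure (Obs d)) := by
  rw [← integral_ustat (P : Measure (Obs d)) hn hh, ← (measurePreserving_three (P := P) n).map_eq,
    integral_map (measurePreserving_three (P := P) n).measurable.aemeasurable
      hh.ustat.1.aestronglyMeasurable]

theorem bias_psiINT (hP : P ∈ B.model d C₁ C₂ α β M) (hp : p ∈ B.holderBall d α M)
    (hpr : IsRegression P obsA p) (hb : b ∈ B.holderBall d β M) (hbr : IsRegression P obsY b)
    {n : ℕ} (hn : 1 ≤ n) {j₁ j₂ : ℕ} (h₁ : B.J₀ ≤ j₁) (h₂ : B.J₀ ≤ j₂) :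
    bias P (B.psiINT j₁ j₂ : Sample d 3 n → ℝ) = B.gap (min j₁ j₂) p b := by
  rw [bias_eq_sub (memLp_psiINT hP hn h₁ h₂), integral_congr_ae (psiINT_ae_eq hP hn h₁ h₂),
    integral_three hn (B.bddMeas_hINT _), integral_hINT hP hp hpr hb hbr,
    psi_eq hP hp hpr hb hbr, CDVBasis.gap]
  ring

theorem bias_psiIF (hP : P ∈ B.model d C₁ C₂ α β M) (hp : p ∈ B.holderBall d α M)
    (hpr : IsRegression P obsA p) (hb : b ∈ B.holderBall d β M) (hbr : IsRegression P obsY b)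
    {n : ℕ} (hn : 1 ≤ n) {j₁ j₂ : ℕ} (h₁ : B.J₀ ≤ j₁) (h₂ : B.J₀ ≤ j₂) :
    bias P (B.psiIF j₁ j₂ : Sample d 3 n → ℝ) = B.gap (max j₁ j₂) p b := by
  rw [bias_eq_sub (memLp_psiIF hP hn j₁ j₂), integral_congr_ae (psiIF_ae_eq hP hn j₁ j₂),
    integral_three hn (B.bddMeas_hIF _ _), integral_hIF hP hp hpr hb hbr h₁ h₂,
    psi_eq hP hp hpr hb hbr, CDVBasis.gap]
  ring

theorem bias_psiMC (hP : P ∈ B.model d C₁ C₂ α β M) (hp : p ∈ B.holderBall d α M)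
    (hpr : IsRegression P obsA p) (hb : b ∈ B.holderBall d β M) (hbr : IsRegression P obsY b)
    {n : ℕ} (hn : 1 ≤ n) {j₁ j₂ : ℕ} (h₁ : B.J₀ ≤ j₁) (h₂ : B.J₀ ≤ j₂) :
    bias P (B.psiMC j₁ j₂ : Sample d 4 n → ℝ) = B.gap (min j₁ j₂) p b := by
  have hg : BddMeas fun o : Obs d => clipA C₁ C₂ o * clipY C₁ C₂ o :=
    (bddMeas_clipA C₁ C₂).mul (bddMeas_clipY C₁ C₂)
  have hf : BddMeas fun D : Fin n → Obs d =>
      avg fun i => clipA C₁ C₂ (D i) * clipY C₁ C₂ (D i) :=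
    BddMeas.avg fun i => hg.comp (φ := fun D : Fin n → Obs d => D i) (measurable_pi_apply i)
  have hu : BddMeas (ustat (n := n) (B.hMC (d := d) C₁ C₂ j₁ j₂)) := (B.bddMeas_hMC j₁ j₂).ustat
  have h4 := measurePreserving_four (P := P) n
  have h3 : ∫ D : Sample d 4 n, (avg (fun i => clipA C₁ C₂ (D 2 i) * clipY C₁ C₂ (D 2 i)) -
        ustat (B.hMC C₁ C₂ j₁ j₂) (D 0, D 1, D 3)) ∂(sampleLaw P 4 n) =
      ∫ w, (avg (fun i => clipA C₁ C₂ (w.1 i) * clipY C₁ C₂ (w.1 i)) -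
        ustat (B.hMC C₁ C₂ j₁ j₂) w.2)
        ∂((iidLaw (P : Measure (Obs d)) n).prod (threeLaw (P : Measure (Obs d)) n)) := by
    rw [← h4.map_eq, integral_map h4.measurable.aemeasurable]
    exact (bddMeas_four (B := B) j₁ j₂).1.aestronglyMeasurable
  rw [bias_eq_sub (memLp_psiMC hP j₁ j₂), integral_congr_ae (psiMC_ae_eq hP j₁ j₂), h3,
    integral_sub ((hf.comp measurable_fst).integrable _) ((hu.comp measurable_snd).integrable _),
    integral_fun_fst (fun D : Fin n → Obs d =>
      avg fun i => clipA C₁ C₂ (D i) * clipY C₁ C₂ (D i)),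
    integral_fun_snd (ustat (n := n) (B.hMC (d := d) C₁ C₂ j₁ j₂)),
    integral_ustat (P : Measure (Obs d)) hn (B.bddMeas_hMC j₁ j₂),
    integral_hMC hP hp hpr hb hbr h₁ h₂, integral_avg_iidLaw (P : Measure (Obs d)) hn hg,
    psi_eq hP hp hpr hb hbr, CDVBasis.gap]
  simp

end Bias

/-! ### Bounds for variances of three-sample averages -/

section VarianceBounds

variable {E : Type*} [MeasurableSpace E] (μ : Measure E) [IsProbabilityMeasure μ]
  {h g : E → E → E → ℝ}

theorem integral_le_of_le_const {f : E → ℝ} (hf : BddMeas f) {c : ℝ} (h : ∀ x, f x ≤ c) :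
    ∫ x, f x ∂μ ≤ c := by
  simpa using hf.integral_mono (BddMeas.const c) μ h

/-- One factor of the square is replaced by its bound `t`; the other stays an integral, so that the
remaining variables can still be integrated against a kernel of bounded mass. -/
theorem sq_integral_le {f k : E → ℝ} (hf : BddMeas f) (hk : BddMeas k) (hfk : ∀ x, |f x| ≤ k x)
    {t : ℝ} (ht : ∫ x, k x ∂μ ≤ t) : (∫ x, f x ∂μ) ^ 2 ≤ t * ∫ x, k x ∂μ := by
  have h1 : |∫ x, f x ∂μ| ≤ ∫ x, k x ∂μ :=
    abs_integral_le_integral_abs.trans (hf.abs.integral_mono hk μ hfk)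
  have h0 : 0 ≤ ∫ x, k x ∂μ := (abs_nonneg _).trans h1
  rw [← sq_abs, sq]
  exact mul_le_mul (h1.trans ht) h1 (abs_nonneg _) (h0.trans ht)

theorem abs_integral_le_integral {f k : E → ℝ} (hf : BddMeas f) (hk : BddMeas k)
    (hfk : ∀ x, |f x| ≤ k x) : |∫ x, f x ∂μ| ≤ ∫ x, k x ∂μ :=
  abs_integral_le_integral_abs.trans (hf.abs.integral_mono hk μ hfk)

theorem abs_integral_three_le (hh : BddMeas fun z : E × E × E => h z.1 z.2.1 z.2.2)
    (hg : BddMeas fun z : E × E × E => g z.1 z.2.1 z.2.2) (hhg : ∀ x y z, |h x y z| ≤ g x y z)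
    {s : ℝ} (h3 : ∀ z, ∫ y, ∫ x, g x y z ∂μ ∂μ ≤ s) :
    |∫ z, ∫ y, ∫ x, h x y z ∂μ ∂μ ∂μ| ≤ s := by
  have bh := (hh.integral_first μ).swap (h := fun y z => ∫ x, h x y z ∂μ)
  have bg := (hg.integral_first μ).swap (h := fun y z => ∫ x, g x y z ∂μ)
  have b1 := BddMeas.integral (h := fun z y => ∫ x, h x y z ∂μ) bh μ
  have b2 := BddMeas.integral (h := fun z y => ∫ x, g x y z ∂μ) bg μ
  refine (abs_integral_le_integral μ b1 b2 fun z => ?_).trans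
    (integral_le_of_le_const μ b2 h3)
  refine abs_integral_le_integral μ (BddMeas.right (h := fun z y => ∫ x, h x y z ∂μ) bh z)
    (BddMeas.right (h := fun z y => ∫ x, g x y z ∂μ) bg z) fun y => ?_
  exact abs_integral_le_integral μ
    (hh.comp (φ := fun x => (x, y, z)) (by fun_prop))
    (hg.comp (φ := fun x => (x, y, z)) (by fun_prop)) fun x => hhg x y z

/-- Every square in `variance_ustat_le` is treated as bound times total mass. The projections on one
variable are at most `s`, giving `s²`; those on two variables give `t s`; the full second moment
gives `q s`. -/
theorem variance_ustat_le_of_bounds {n : ℕ} (hn : 1 ≤ n)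
    (hh : BddMeas fun z : E × E × E => h z.1 z.2.1 z.2.2)
    (hg : BddMeas fun z : E × E × E => g z.1 z.2.1 z.2.2) (hhg : ∀ x y z, |h x y z| ≤ g x y z)
    {s t₁₂ t₁₃ t₂₃ q : ℝ} (h1 : ∀ x, ∫ z, ∫ y, g x y z ∂μ ∂μ ≤ s)
    (h2 : ∀ y, ∫ z, ∫ x, g x y z ∂μ ∂μ ≤ s) (h3 : ∀ z, ∫ y, ∫ x, g x y z ∂μ ∂μ ≤ s)
    (h12 : ∀ x y, ∫ z, g x y z ∂μ ≤ t₁₂) (h13 : ∀ x z, ∫ y, g x y z ∂μ ≤ t₁₃)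
    (h23 : ∀ y z, ∫ x, g x y z ∂μ ≤ t₂₃) (h123 : ∀ x y z, g x y z ≤ q) :
    Var[ustat h; threeLaw μ n] ≤
      3 * s ^ 2 / n + s * (t₁₂ + t₁₃ + t₂₃) / n ^ 2 + s * q / n ^ 3 := by
  -- A point is needed only to deduce from the hypotheses that the bounds `t₁₂`, `t₁₃`, `t₂₃`, `q`
  -- are nonnegative.
  obtain ⟨e⟩ : Nonempty E := nonempty_of_isProbabilityMeasure μ
  have g0 : ∀ x y z, 0 ≤ g x y z := fun x y z => (abs_nonneg _).trans (hhg x y z)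
  have ht12 : 0 ≤ t₁₂ := (integral_nonneg fun z => g0 e e z).trans (h12 e e)
  have ht13 : 0 ≤ t₁₃ := (integral_nonneg fun z => g0 e z e).trans (h13 e e)
  have ht23 : 0 ≤ t₂₃ := (integral_nonneg fun z => g0 z e e).trans (h23 e e)
  have hq : 0 ≤ q := (g0 e e e).trans (h123 e e e)
  -- measurability of the sections
  have bx := fun y z => hh.comp (φ := fun x => (x, y, z)) (by fun_prop)
  have bx' := fun y z => hg.comp (φ := fun x => (x, y, z)) (by fun_prop)
  have by' := fun x z => hh.comp (φ := fun y => (x, y, z)) (by fun_prop)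
  have by'' := fun x z => hg.comp (φ := fun y => (x, y, z)) (by fun_prop)
  have bz := fun x y => hh.comp (φ := fun z => (x, y, z)) (by fun_prop)
  have bz' := fun x y => hg.comp (φ := fun z => (x, y, z)) (by fun_prop)
  have f1 := hh.integral_first μ
  have f2 := hh.integral_second μ
  have f3 := hh.integral_third μ
  have g1 := hg.integral_first μ
  have g2 := hg.integral_second μ
  have g3 := hg.integral_third μ
  have sqs : ∀ {a : ℝ}, |a| ≤ s → a ^ 2 ≤ s ^ 2 := fun {a} ha => by
    rw [← sq_abs]; exact pow_le_pow_left₀ (abs_nonneg _) ha 2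
  have v1 : ∫ x, (∫ z, ∫ y, h x y z ∂μ ∂μ) ^ 2 ∂μ ≤ s ^ 2 := by
    refine integral_le_of_le_const μ
      (BddMeas.integral (h := fun x z => ∫ y, h x y z ∂μ) f2 μ).sq fun x => sqs ?_
    refine (abs_integral_le_integral μ (BddMeas.right (h := fun x z => ∫ y, h x y z ∂μ) f2 x)
      (BddMeas.right (h := fun x z => ∫ y, g x y z ∂μ) g2 x) fun z => ?_).trans (h1 x)
    exact abs_integral_le_integral μ (by' x z) (by'' x z) fun y => hhg x y z
  have v2 : ∫ y, (∫ z, ∫ x, h x y z ∂μ ∂μ) ^ 2 ∂μ ≤ s ^ 2 := by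
    refine integral_le_of_le_const μ
      (BddMeas.integral (h := fun y z => ∫ x, h x y z ∂μ) f1 μ).sq fun y => sqs ?_
    refine (abs_integral_le_integral μ (BddMeas.right (h := fun y z => ∫ x, h x y z ∂μ) f1 y)
      (BddMeas.right (h := fun y z => ∫ x, g x y z ∂μ) g1 y) fun z => ?_).trans (h2 y)
    exact abs_integral_le_integral μ (bx y z) (bx' y z) fun x => hhg x y z
  have f1s := f1.swap (h := fun y z => ∫ x, h x y z ∂μ)
  have g1s := g1.swap (h := fun y z => ∫ x, g x y z ∂μ)
  have v3 : ∫ z, (∫ y, ∫ x, h x y z ∂μ ∂μ) ^ 2 ∂μ ≤ s ^ 2 := by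
    refine integral_le_of_le_const μ
      (BddMeas.integral (h := fun z y => ∫ x, h x y z ∂μ) f1s μ).sq fun z => sqs ?_
    refine (abs_integral_le_integral μ (BddMeas.right (h := fun z y => ∫ x, h x y z ∂μ) f1s z)
      (BddMeas.right (h := fun z y => ∫ x, g x y z ∂μ) g1s z) fun y => ?_).trans (h3 z)
    exact abs_integral_le_integral μ (bx y z) (bx' y z) fun x => hhg x y z
  have m2 : ∫ x, ∫ z, ∫ y, g x y z ∂μ ∂μ ∂μ ≤ s := integral_le_of_le_const μ
    (BddMeas.integral (h := fun x z => ∫ y, g x y z ∂μ) g2 μ) h1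
  have m1 : ∫ y, ∫ z, ∫ x, g x y z ∂μ ∂μ ∂μ ≤ s := integral_le_of_le_const μ
    (BddMeas.integral (h := fun y z => ∫ x, g x y z ∂μ) g1 μ) h2
  have m3 : ∫ x, ∫ y, ∫ z, g x y z ∂μ ∂μ ∂μ ≤ s := by
    refine le_of_eq_of_le ?_ m2
    congr 1; ext x
    exact BddMeas.integral_swap (h := fun y z => g x y z) (hg.section_right x) μ μ
  have v12 : ∫ x, ∫ y, (∫ z, h x y z ∂μ) ^ 2 ∂μ ∂μ ≤ t₁₂ * s := by
    calc ∫ x, ∫ y, (∫ z, h x y z ∂μ) ^ 2 ∂μ ∂μ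
        ≤ ∫ x, ∫ y, t₁₂ * ∫ z, g x y z ∂μ ∂μ ∂μ := by
          refine BddMeas.integral_mono (BddMeas.integral (h := fun x y => (∫ z, h x y z ∂μ) ^ 2)
            f3.sq μ) (BddMeas.integral (h := fun x y => t₁₂ * ∫ z, g x y z ∂μ)
            ((BddMeas.const _).mul g3) μ) μ fun x => ?_
          refine BddMeas.integral_mono (BddMeas.right (h := fun x y => (∫ z, h x y z ∂μ) ^ 2)
            f3.sq x) (BddMeas.right (h := fun x y => t₁₂ * ∫ z, g x y z ∂μ)
            ((BddMeas.const _).mul g3) x) μ fun y => ?_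
          exact sq_integral_le μ (bz x y) (bz' x y) (fun z => hhg x y z) (h12 x y)
      _ ≤ t₁₂ * s := by
          simp_rw [integral_const_mul]
          exact mul_le_mul_of_nonneg_left m3 ht12
  have v13 : ∫ x, ∫ z, (∫ y, h x y z ∂μ) ^ 2 ∂μ ∂μ ≤ t₁₃ * s := by
    calc ∫ x, ∫ z, (∫ y, h x y z ∂μ) ^ 2 ∂μ ∂μ
        ≤ ∫ x, ∫ z, t₁₃ * ∫ y, g x y z ∂μ ∂μ ∂μ := by
          refine BddMeas.integral_mono (BddMeas.integral (h := fun x z => (∫ y, h x y z ∂μ) ^ 2)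
            f2.sq μ) (BddMeas.integral (h := fun x z => t₁₃ * ∫ y, g x y z ∂μ)
            ((BddMeas.const _).mul g2) μ) μ fun x => ?_
          refine BddMeas.integral_mono (BddMeas.right (h := fun x z => (∫ y, h x y z ∂μ) ^ 2)
            f2.sq x) (BddMeas.right (h := fun x z => t₁₃ * ∫ y, g x y z ∂μ)
            ((BddMeas.const _).mul g2) x) μ fun z => ?_
          exact sq_integral_le μ (by' x z) (by'' x z) (fun y => hhg x y z) (h13 x z)
      _ ≤ t₁₃ * s := by
          simp_rw [integral_const_mul]
          exact mul_le_mul_of_nonneg_left m2 ht13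
  have v23 : ∫ y, ∫ z, (∫ x, h x y z ∂μ) ^ 2 ∂μ ∂μ ≤ t₂₃ * s := by
    calc ∫ y, ∫ z, (∫ x, h x y z ∂μ) ^ 2 ∂μ ∂μ
        ≤ ∫ y, ∫ z, t₂₃ * ∫ x, g x y z ∂μ ∂μ ∂μ := by
          refine BddMeas.integral_mono (BddMeas.integral (h := fun y z => (∫ x, h x y z ∂μ) ^ 2)
            f1.sq μ) (BddMeas.integral (h := fun y z => t₂₃ * ∫ x, g x y z ∂μ)
            ((BddMeas.const _).mul g1) μ) μ fun y => ?_
          refine BddMeas.integral_mono (BddMeas.right (h := fun y z => (∫ x, h x y z ∂μ) ^ 2)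
            f1.sq y) (BddMeas.right (h := fun y z => t₂₃ * ∫ x, g x y z ∂μ)
            ((BddMeas.const _).mul g1) y) μ fun z => ?_
          exact sq_integral_le μ (bx y z) (bx' y z) (fun x => hhg x y z) (h23 y z)
      _ ≤ t₂₃ * s := by
          simp_rw [integral_const_mul]
          exact mul_le_mul_of_nonneg_left m1 ht23
  have v123 : ∫ x, ∫ y, ∫ z, h x y z ^ 2 ∂μ ∂μ ∂μ ≤ q * s := by
    have k1 := BddMeas.integral_third (h := fun x y z => h x y z ^ 2) μ hh.sq
    have k2 := BddMeas.integral_third (h := fun x y z => q * g x y z) μ ((BddMeas.const q).mul hg)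
    calc ∫ x, ∫ y, ∫ z, h x y z ^ 2 ∂μ ∂μ ∂μ
        ≤ ∫ x, ∫ y, ∫ z, q * g x y z ∂μ ∂μ ∂μ := by
          refine BddMeas.integral_mono (BddMeas.integral (h := fun x y => ∫ z, h x y z ^ 2 ∂μ) k1 μ)
            (BddMeas.integral (h := fun x y => ∫ z, q * g x y z ∂μ) k2 μ) μ fun x => ?_
          refine BddMeas.integral_mono (BddMeas.right (h := fun x y => ∫ z, h x y z ^ 2 ∂μ) k1 x)
            (BddMeas.right (h := fun x y => ∫ z, q * g x y z ∂μ) k2 x) μ fun y => ?_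
          refine BddMeas.integral_mono (bz x y).sq ((BddMeas.const q).mul (bz' x y)) μ fun z => ?_
          show h x y z ^ 2 ≤ q * g x y z
          rw [← sq_abs, sq]
          exact mul_le_mul ((hhg x y z).trans (h123 x y z)) (hhg x y z) (abs_nonneg _) hq
      _ ≤ q * s := by
          simp_rw [integral_const_mul]
          exact mul_le_mul_of_nonneg_left m3 hq
  have hn0 : (0 : ℝ) < n := by exact_mod_cast hn
  refine (variance_ustat_le μ hn hh).trans ?_
  gcongr
  · linarith
  · linarith
  · linarith

/-- For fixed `z` the integrals over `x` and `y` separate. Integrating over `z` last, the product of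
the two lower bounds holds for almost every `z`. -/
theorem le_integral_sq_of_factors {f₁ f₂ : E → E → ℝ} (hf₁ : BddMeas fun z : E × E => f₁ z.1 z.2)
    (hf₂ : BddMeas fun z : E × E => f₂ z.1 z.2) {c₁ c₂ : ℝ} (hc₁ : 0 ≤ c₁) (hc₂ : 0 ≤ c₂)
    (h₁ : ∀ᵐ z ∂μ, c₁ ≤ ∫ x, f₁ x z ^ 2 ∂μ) (h₂ : ∀ᵐ z ∂μ, c₂ ≤ ∫ x, f₂ x z ^ 2 ∂μ) :
    c₁ * c₂ ≤ ∫ x, ∫ y, ∫ z, (f₁ x z * f₂ y z) ^ 2 ∂μ ∂μ ∂μ := by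
  have hb : BddMeas fun z : E × E × E => f₁ z.1 z.2.2 * f₂ z.2.1 z.2.2 :=
    (hf₁.comp (φ := fun z : E × E × E => (z.1, z.2.2)) (by fun_prop)).mul
      (hf₂.comp (φ := fun z : E × E × E => (z.2.1, z.2.2)) (by fun_prop))
  have s1 : ∫ x, ∫ y, ∫ z, (f₁ x z * f₂ y z) ^ 2 ∂μ ∂μ ∂μ =
      ∫ x, ∫ z, f₁ x z ^ 2 * ∫ y, f₂ y z ^ 2 ∂μ ∂μ ∂μ := by
    congr 1; ext x
    rw [BddMeas.integral_swap (h := fun y z => (f₁ x z * f₂ y z) ^ 2)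
      (BddMeas.section_right (h := fun x y z => (f₁ x z * f₂ y z) ^ 2) hb.sq x) μ μ]
    simp_rw [mul_pow, integral_const_mul]
  have F2 : BddMeas fun z => ∫ y, f₂ y z ^ 2 ∂μ :=
    BddMeas.integral (h := fun z y => f₂ y z ^ 2) (BddMeas.swap (h := fun y z => f₂ y z ^ 2)
      hf₂.sq) μ
  have F1 : BddMeas fun z => ∫ y, f₁ y z ^ 2 ∂μ :=
    BddMeas.integral (h := fun z y => f₁ y z ^ 2) (BddMeas.swap (h := fun y z => f₁ y z ^ 2)
      hf₁.sq) μ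
  rw [s1, BddMeas.integral_swap (h := fun x z => f₁ x z ^ 2 * ∫ y, f₂ y z ^ 2 ∂μ)
    (hf₁.sq.mul (F2.comp measurable_snd)) μ μ]
  simp_rw [integral_mul_const]
  have : c₁ * c₂ = ∫ _ : E, c₁ * c₂ ∂μ := by simp
  rw [this]
  refine integral_mono_ae (integrable_const _) ((F1.mul F2).integrable μ) ?_
  filter_upwards [h₁, h₂] with z hz₁ hz₂
  exact mul_le_mul hz₁ hz₂ hc₂ (hc₁.trans hz₁)

end VarianceBounds

/-! ### Variance bounds from majorants of bounded mass -/

section KernelVariance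

variable {E : Type*} [MeasurableSpace E] (μ : Measure E)
  {h : E → E → E → ℝ} {κ κ₁ κ₂ : E → E → ℝ} {r Λ q q₁ q₂ : ℝ}

theorem integral_const_mul_le {f : E → ℝ} {c t : ℝ} (hc : 0 ≤ c) (hf : ∫ x, f x ∂μ ≤ t) :
    ∫ x, c * f x ∂μ ≤ c * t := by
  rw [integral_const_mul]; exact mul_le_mul_of_nonneg_left hf hc

variable [IsProbabilityMeasure μ]

/-- Whichever single variable is integrated out, one kernel is integrated to mass `Λ` and only the
other is bounded by its maximum. Hence the order `n⁻²` carries one power of a resolution, and the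
product `q₁ q₂` occurs only at order `n⁻³`. -/
theorem variance_ustat_le_of_two_kernels {n : ℕ} (hn : 1 ≤ n)
    (hh : BddMeas fun z : E × E × E => h z.1 z.2.1 z.2.2)
    (m₁ : BddMeas fun z : E × E => κ₁ z.1 z.2) (m₂ : BddMeas fun z : E × E => κ₂ z.1 z.2)
    (hr : 0 ≤ r) (hΛ : 0 ≤ Λ) (p₁ : ∀ x y, 0 ≤ κ₁ x y) (p₂ : ∀ x y, 0 ≤ κ₂ x y)
    (b₁ : ∀ x y, κ₁ x y ≤ q₁) (b₂ : ∀ x y, κ₂ x y ≤ q₂)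
    (l₁ : ∀ y, ∫ x, κ₁ x y ∂μ ≤ Λ) (l₂ : ∀ y, ∫ x, κ₂ x y ∂μ ≤ Λ)
    (l₁' : ∀ x, ∫ y, κ₁ x y ∂μ ≤ Λ) (l₂' : ∀ x, ∫ y, κ₂ x y ∂μ ≤ Λ)
    (hle : ∀ x y z, |h x y z| ≤ r * κ₁ x z * κ₂ y z) :
    Var[ustat h; threeLaw μ n] ≤ 3 * (r * Λ * Λ) ^ 2 / n +
      r * Λ * Λ * (r * q₁ * Λ + r * q₁ * Λ + r * q₂ * Λ) / n ^ 2 +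
      r * Λ * Λ * (r * q₁ * q₂) / n ^ 3 := by
  obtain ⟨e⟩ : Nonempty E := nonempty_of_isProbabilityMeasure μ
  have hq₁ : 0 ≤ q₁ := (p₁ e e).trans (b₁ e e)
  have hg : BddMeas fun z : E × E × E => r * κ₁ z.1 z.2.2 * κ₂ z.2.1 z.2.2 :=
    ((BddMeas.const r).mul (m₁.comp (φ := fun z : E × E × E => (z.1, z.2.2)) (by fun_prop))).mul
      (m₂.comp (φ := fun z : E × E × E => (z.2.1, z.2.2)) (by fun_prop))
  have i2 : ∀ x z, ∫ y, r * κ₁ x z * κ₂ y z ∂μ ≤ r * κ₁ x z * Λ := fun x z =>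
    integral_const_mul_le μ (mul_nonneg hr (p₁ x z)) (l₂ z)
  have i1 : ∀ y z, ∫ x, r * κ₁ x z * κ₂ y z ∂μ ≤ r * Λ * κ₂ y z := fun y z => by
    rw [integral_mul_const, integral_const_mul]
    exact mul_le_mul_of_nonneg_right (mul_le_mul_of_nonneg_left (l₁ z) hr) (p₂ y z)
  have g1 := hg.integral_first μ (h := fun x y z => r * κ₁ x z * κ₂ y z)
  have g2 := hg.integral_second μ (h := fun x y z => r * κ₁ x z * κ₂ y z)
  refine variance_ustat_le_of_bounds μ hn hh (g := fun x y z => r * κ₁ x z * κ₂ y z) hg hle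
    (fun x => ?_) (fun y => ?_) (fun z => ?_) (fun x y => ?_) (fun x z => ?_) (fun y z => ?_)
    fun x y z => ?_
  · calc ∫ z, ∫ y, r * κ₁ x z * κ₂ y z ∂μ ∂μ ≤ ∫ z, r * κ₁ x z * Λ ∂μ :=
        BddMeas.integral_mono (BddMeas.right (h := fun x z => ∫ y, r * κ₁ x z * κ₂ y z ∂μ) g2 x)
          (((BddMeas.const r).mul (m₁.right x)).mul (BddMeas.const Λ)) μ fun z => i2 x z
      _ ≤ r * Λ * Λ := by
        rw [integral_mul_const, integral_const_mul]
        exact mul_le_mul_of_nonneg_right (mul_le_mul_of_nonneg_left (l₁' x) hr) hΛ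
  · calc ∫ z, ∫ x, r * κ₁ x z * κ₂ y z ∂μ ∂μ ≤ ∫ z, r * Λ * κ₂ y z ∂μ :=
        BddMeas.integral_mono (BddMeas.right (h := fun y z => ∫ x, r * κ₁ x z * κ₂ y z ∂μ) g1 y)
          ((BddMeas.const (r * Λ)).mul (m₂.right y)) μ fun z => i1 y z
      _ ≤ r * Λ * Λ := integral_const_mul_le μ (mul_nonneg hr hΛ) (l₂' y)
  · calc ∫ y, ∫ x, r * κ₁ x z * κ₂ y z ∂μ ∂μ ≤ ∫ y, r * Λ * κ₂ y z ∂μ :=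
        BddMeas.integral_mono (BddMeas.left (h := fun y z => ∫ x, r * κ₁ x z * κ₂ y z ∂μ) g1 z)
          ((BddMeas.const (r * Λ)).mul (m₂.left z)) μ fun y => i1 y z
      _ ≤ r * Λ * Λ := integral_const_mul_le μ (mul_nonneg hr hΛ) (l₂ z)
  · calc ∫ z, r * κ₁ x z * κ₂ y z ∂μ ≤ ∫ z, r * q₁ * κ₂ y z ∂μ :=
        BddMeas.integral_mono (((BddMeas.const r).mul (m₁.right x)).mul (m₂.right y))
          ((BddMeas.const (r * q₁)).mul (m₂.right y)) μ fun z =>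
          mul_le_mul_of_nonneg_right (mul_le_mul_of_nonneg_left (b₁ x z) hr) (p₂ y z)
      _ ≤ r * q₁ * Λ := integral_const_mul_le μ (mul_nonneg hr hq₁) (l₂' y)
  · exact (i2 x z).trans (mul_le_mul_of_nonneg_right (mul_le_mul_of_nonneg_left (b₁ x z) hr) hΛ)
  · refine (i1 y z).trans ((mul_le_mul_of_nonneg_left (b₂ y z) (mul_nonneg hr hΛ)).trans
      (le_of_eq ?_))
    ring
  · exact mul_le_mul (mul_le_mul_of_nonneg_left (b₁ x z) hr) (b₂ y z) (p₂ y z)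
      (mul_nonneg hr hq₁)

/-- The majorant does not involve the third variable, so the height `q` already occurs at order
`n⁻²` and no higher power of it at order `n⁻³`. -/
theorem variance_ustat_le_of_kernel {n : ℕ} (hn : 1 ≤ n)
    (hh : BddMeas fun z : E × E × E => h z.1 z.2.1 z.2.2)
    (m : BddMeas fun z : E × E => κ z.1 z.2) (hr : 0 ≤ r)
    (b : ∀ x y, κ x y ≤ q) (l : ∀ y, ∫ x, κ x y ∂μ ≤ Λ) (l' : ∀ x, ∫ y, κ x y ∂μ ≤ Λ)
    (hle : ∀ x y z, |h x y z| ≤ r * κ x y) :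
    Var[ustat h; threeLaw μ n] ≤ 3 * (r * Λ) ^ 2 / n +
      r * Λ * (r * q + r * Λ + r * Λ) / n ^ 2 + r * Λ * (r * q) / n ^ 3 := by
  have hg : BddMeas fun z : E × E × E => r * κ z.1 z.2.1 :=
    (BddMeas.const r).mul (m.comp (φ := fun z : E × E × E => (z.1, z.2.1)) (by fun_prop))
  have i1 : ∀ y, ∫ x, r * κ x y ∂μ ≤ r * Λ := fun y => integral_const_mul_le μ hr (l y)
  have i2 : ∀ x, ∫ y, r * κ x y ∂μ ≤ r * Λ := fun x => integral_const_mul_le μ hr (l' x)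
  have g1 : BddMeas fun y => ∫ x, r * κ x y ∂μ :=
    BddMeas.integral (h := fun y x => r * κ x y) ((BddMeas.const r).mul m.swap) μ
  refine variance_ustat_le_of_bounds μ hn hh (g := fun x y _ => r * κ x y) hg hle
    (fun x => ?_) (fun y => ?_) (fun z => ?_) (fun x y => ?_) (fun x z => ?_) (fun y z => ?_)
    fun x y z => ?_
  · simpa using i2 x
  · simpa using i1 y
  · exact integral_le_of_le_const μ g1 i1
  · simpa using mul_le_mul_of_nonneg_left (b x y) hr
  · exact i2 x
  · exact i1 y
  · exact mul_le_mul_of_nonneg_left (b x y) hr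

end KernelVariance

/-! ### Variance bounds for the estimators -/

section Estimators

variable {d S : ℕ} (B : CDVBasis S)

/-- A majorant of the kernel of the projection onto `V_j`. -/
def CDVBasis.majorant (j : ℕ) (o o' : Obs d) : ℝ := 1 + |B.kernel j (obsX o) (obsX o')|

theorem CDVBasis.one_le_majorant (j : ℕ) (o o' : Obs d) : 1 ≤ B.majorant j o o' := by
  unfold CDVBasis.majorant; linarith [abs_nonneg (B.kernel j (obsX o) (obsX o'))]

theorem CDVBasis.bddMeas_majorant (j : ℕ) :
    BddMeas fun z : Obs d × Obs d => B.majorant j z.1 z.2 :=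
  (BddMeas.const 1).add (B.bddMeas_kernel_comp j measurable_fst measurable_snd).abs

/-- The constant in the uniform bound on the integrals of the majorants. -/
def CDVBasis.massC (d : ℕ) : ℝ := 1 + B.L1C ^ d

/-- The constant in the bound on the size of the majorants. -/
def CDVBasis.sizeC (d : ℕ) : ℝ := 1 + B.supC d

theorem CDVBasis.one_le_massC (d : ℕ) : 1 ≤ B.massC d := by
  have := B.L1C_pos
  unfold CDVBasis.massC
  linarith [pow_pos this d]

theorem CDVBasis.one_le_sizeC (d : ℕ) : 1 ≤ B.sizeC d := by
  have := B.supC_pos d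
  unfold CDVBasis.sizeC
  linarith

theorem CDVBasis.majorant_le (j : ℕ) (o o' : Obs d) :
    B.majorant j o o' ≤ B.sizeC d * res d j := by
  have h1 := one_le_res d j
  have h2 := B.abs_kernel_le j (obsX o) (obsX o')
  unfold CDVBasis.majorant CDVBasis.sizeC
  rw [add_mul]
  linarith

variable {B} {P : ProbabilityMeasure (Obs d)} {C₁ C₂ α β M : ℝ}

theorem integral_majorant_right_le
    (hX : (P : Measure (Obs d)).map obsX = volume.restrict (cube d)) (j : ℕ) (o : Obs d) :
    ∫ o', B.majorant j o o' ∂(P : Measure (Obs d)) ≤ B.massC d := by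
  have h : BddMeas fun o' : Obs d => |B.kernel j (obsX o) (obsX o')| :=
    (BddMeas.comp (φ := fun o' : Obs d => (obsX o, obsX o')) (B.bddMeas_kernel j)
      (measurable_const.prodMk measurable_obsX)).abs
  unfold CDVBasis.majorant
  rw [integral_add (integrable_const _) (h.integrable _), integral_comp_obsX hX
    (f := fun x => |B.kernel j (obsX o) x|) (B.continuous_kernel_right j _).abs.continuousOn]
  simpa [CDVBasis.massC] using B.integral_abs_kernel_le j (obsX o)

theorem integral_majorant_left_le
    (hX : (P : Measure (Obs d)).map obsX = volume.restrict (cube d)) (j : ℕ) (o : Obs d) :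
    ∫ o', B.majorant j o' o ∂(P : Measure (Obs d)) ≤ B.massC d := by
  have h : ∀ o', B.majorant j o' o = B.majorant j o o' := fun o' => by
    unfold CDVBasis.majorant; rw [B.kernel_comm]
  simp_rw [h]
  exact integral_majorant_right_le hX j o

theorem abs_mul_kernel_le {a : ℝ} (ha : |a| ≤ radius C₁ C₂) (j : ℕ) (o o' : Obs d) :
    |a * B.kernel j (obsX o) (obsX o')| ≤ radius C₁ C₂ * B.majorant j o o' := by
  rw [abs_mul]
  refine mul_le_mul ha ?_ (abs_nonneg _) (radius_pos C₁ C₂).le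
  unfold CDVBasis.majorant
  linarith

theorem abs_sub_mul_kernel_le {a a' : ℝ} (ha : |a| ≤ radius C₁ C₂) (ha' : |a'| ≤ radius C₁ C₂)
    (j : ℕ) (o o' : Obs d) :
    |a' - a * B.kernel j (obsX o) (obsX o')| ≤ radius C₁ C₂ * B.majorant j o o' := by
  refine (abs_sub _ _).trans ?_
  rw [abs_mul]
  unfold CDVBasis.majorant
  rw [mul_add, mul_one]
  exact add_le_add ha' (mul_le_mul_of_nonneg_right ha (abs_nonneg _))

theorem abs_hMC_le (j₁ j₂ : ℕ) (x y z : Obs d) : |B.hMC C₁ C₂ j₁ j₂ x y z| ≤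
    radius C₁ C₂ ^ 2 * B.majorant j₁ x z * B.majorant j₂ y z := by
  unfold CDVBasis.hMC
  rw [abs_mul]
  have h0 := radius_pos C₁ C₂
  have h1 := B.one_le_majorant j₁ x z
  calc _ ≤ (radius C₁ C₂ * B.majorant j₁ x z) * (radius C₁ C₂ * B.majorant j₂ y z) :=
        mul_le_mul (abs_mul_kernel_le (abs_clip_le _ _ _) _ _ _)
          (abs_mul_kernel_le (abs_clip_le _ _ _) _ _ _) (abs_nonneg _) (by positivity)
    _ = _ := by ring

theorem abs_hIF_le (j₁ j₂ : ℕ) (x y z : Obs d) : |B.hIF C₁ C₂ j₁ j₂ x y z| ≤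
    radius C₁ C₂ ^ 2 * B.majorant j₁ x z * B.majorant j₂ y z := by
  unfold CDVBasis.hIF
  rw [abs_mul]
  have h0 := radius_pos C₁ C₂
  have h1 := B.one_le_majorant j₁ x z
  calc _ ≤ (radius C₁ C₂ * B.majorant j₁ x z) * (radius C₁ C₂ * B.majorant j₂ y z) :=
        mul_le_mul (abs_sub_mul_kernel_le (abs_clip_le _ _ _) (abs_clip_le _ _ _) _ _ _)
          (abs_sub_mul_kernel_le (abs_clip_le _ _ _) (abs_clip_le _ _ _) _ _ _)
          (abs_nonneg _) (by positivity)
    _ = _ := by ring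

theorem abs_hINT_le (j : ℕ) (x y z : Obs d) : |B.hINT C₁ C₂ j x y z| ≤
    radius C₁ C₂ ^ 2 * B.majorant j x y := by
  unfold CDVBasis.hINT CDVBasis.majorant
  have h0 := radius_pos C₁ C₂
  have h : ∀ u v : Obs d, |clipA C₁ C₂ u * clipY C₁ C₂ v| ≤ radius C₁ C₂ ^ 2 := fun u v => by
    rw [abs_mul, sq]
    exact mul_le_mul (abs_clip_le _ _ _) (abs_clip_le _ _ _) (abs_nonneg _) h0.le
  refine (abs_sub _ _).trans ?_
  rw [abs_mul (clipA C₁ C₂ x * clipY C₁ C₂ y), mul_add, mul_one]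
  exact add_le_add (h z z) (mul_le_mul_of_nonneg_right (h x y) (abs_nonneg _))

/-- The constant in the upper bounds on the variances. -/
def CDVBasis.varC (B : CDVBasis S) (d : ℕ) (C₁ C₂ : ℝ) : ℝ :=
  radius C₁ C₂ ^ 4 * B.massC d ^ 4 * B.sizeC d ^ 2

theorem CDVBasis.varC_pos (B : CDVBasis S) (d : ℕ) (C₁ C₂ : ℝ) : 0 < B.varC d C₁ C₂ := by
  have := B.one_le_massC d
  have := B.one_le_sizeC d
  have := radius_pos C₁ C₂
  unfold CDVBasis.varC
  positivity

theorem variance_ustat_le_of_le_majorants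
    (hX : (P : Measure (Obs d)).map obsX = volume.restrict (cube d)) {n : ℕ} (hn : 1 ≤ n)
    {j₁ j₂ : ℕ} {h : Obs d → Obs d → Obs d → ℝ}
    (hh : BddMeas fun z : Obs d × Obs d × Obs d => h z.1 z.2.1 z.2.2)
    (hle : ∀ x y z, |h x y z| ≤ radius C₁ C₂ ^ 2 * B.majorant j₁ x z * B.majorant j₂ y z) :
    Var[ustat h; threeLaw (P : Measure (Obs d)) n] ≤ 3 * B.varC d C₁ C₂ *
      (1 / (n : ℝ) + max (res d j₁) (res d j₂) / (n : ℝ) ^ 2 +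
        res d j₁ * res d j₂ / (n : ℝ) ^ 3) := by
  have hΛ := B.one_le_massC d
  have hQ := B.one_le_sizeC d
  have hR := radius_pos C₁ C₂
  have k₁ := res_pos d j₁
  have k₂ := res_pos d j₂
  have hn0 : (0 : ℝ) < n := by exact_mod_cast hn
  refine (variance_ustat_le_of_two_kernels (P : Measure (Obs d)) (Λ := B.massC d)
    (q₁ := B.sizeC d * res d j₁) (q₂ := B.sizeC d * res d j₂) hn hh
    (B.bddMeas_majorant j₁) (B.bddMeas_majorant j₂) (by positivity) (by positivity)
    (fun x y => zero_le_one.trans (B.one_le_majorant j₁ x y))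
    (fun x y => zero_le_one.trans (B.one_le_majorant j₂ x y))
    (B.majorant_le j₁) (B.majorant_le j₂) (integral_majorant_left_le hX j₁)
    (integral_majorant_left_le hX j₂) (integral_majorant_right_le hX j₁)
    (integral_majorant_right_le hX j₂) hle).trans ?_
  set Λ := B.massC d
  set Q := B.sizeC d
  set R := radius C₁ C₂
  set x := res d j₁
  set y := res d j₂
  have hx : x ≤ max x y := le_max_left _ _
  have hy : y ≤ max x y := le_max_right _ _
  -- Since `Λ` and `Q` are at least one, `varC = R⁴ Λ⁴ Q²` dominates the three monomials that occur
  -- at the orders `n⁻¹`, `n⁻²`, `n⁻³`.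
  have e1 : R ^ 4 * Λ ^ 4 ≤ B.varC d C₁ C₂ := by
    unfold CDVBasis.varC
    exact le_mul_of_one_le_right (by positivity) (one_le_pow₀ hQ)
  have e2 : R ^ 4 * Λ ^ 3 * Q ≤ B.varC d C₁ C₂ := by
    unfold CDVBasis.varC
    gcongr
    · norm_num
    · exact le_self_pow₀ hQ two_ne_zero
  have e3 : R ^ 4 * Λ ^ 2 * Q ^ 2 ≤ B.varC d C₁ C₂ := by
    unfold CDVBasis.varC
    gcongr
    norm_num
  have e0 := B.varC_pos d C₁ C₂
  set W := B.varC d C₁ C₂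
  have t1 : 3 * (R ^ 2 * Λ * Λ) ^ 2 / n ≤ 3 * W * (1 / n) := by
    rw [mul_one_div]
    refine div_le_div_of_nonneg_right ?_ (by positivity)
    linarith
  have t2 : R ^ 2 * Λ * Λ * (R ^ 2 * (Q * x) * Λ + R ^ 2 * (Q * x) * Λ + R ^ 2 * (Q * y) * Λ) /
      n ^ 2 ≤ 3 * W * (max x y / n ^ 2) := by
    rw [← mul_div_assoc]
    refine div_le_div_of_nonneg_right ?_ (by positivity)
    calc _ = R ^ 4 * Λ ^ 3 * Q * (x + x + y) := by ring
      _ ≤ W * (max x y + max x y + max x y) := by gcongr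
      _ = _ := by ring
  have t3 : R ^ 2 * Λ * Λ * (R ^ 2 * (Q * x) * (Q * y)) / n ^ 3 ≤ 3 * W * (x * y / n ^ 3) := by
    rw [← mul_div_assoc]
    refine div_le_div_of_nonneg_right ?_ (by positivity)
    calc _ = R ^ 4 * Λ ^ 2 * Q ^ 2 * (x * y) := by ring
      _ ≤ W * (x * y) := by gcongr
      _ ≤ 3 * W * (x * y) := by gcongr; linarith
  refine le_trans (add_le_add (add_le_add t1 t2) t3) (le_of_eq ?_)
  ring

theorem variance_hINT_le (hX : (P : Measure (Obs d)).map obsX = volume.restrict (cube d)) {n : ℕ}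
    (hn : 1 ≤ n) (j : ℕ) :
    Var[ustat (B.hINT C₁ C₂ j); threeLaw (P : Measure (Obs d)) n] ≤ 4 * B.varC d C₁ C₂ *
      (1 / (n : ℝ) + res d j / (n : ℝ) ^ 2) := by
  have hΛ := B.one_le_massC d
  have hQ := B.one_le_sizeC d
  have hR := radius_pos C₁ C₂
  have k := one_le_res d j
  have hn1 : (1 : ℝ) ≤ n := by exact_mod_cast hn
  have hn0 : (0 : ℝ) < n := by exact_mod_cast hn
  refine (variance_ustat_le_of_kernel (P : Measure (Obs d)) (Λ := B.massC d)
    (q := B.sizeC d * res d j) hn (B.bddMeas_hINT j)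
    (B.bddMeas_majorant j) (by positivity) (B.majorant_le j)
    (integral_majorant_left_le hX j) (integral_majorant_right_le hX j) (abs_hINT_le j)).trans ?_
  set Λ := B.massC d
  set Q := B.sizeC d
  set R := radius C₁ C₂
  set x := res d j
  have hx0 : 0 < x := by linarith
  have e1 : R ^ 4 * Λ ^ 2 ≤ B.varC d C₁ C₂ := by
    unfold CDVBasis.varC
    calc R ^ 4 * Λ ^ 2 ≤ R ^ 4 * Λ ^ 4 := by gcongr; norm_num
      _ ≤ _ := le_mul_of_one_le_right (by positivity) (one_le_pow₀ hQ)
  have e2 : R ^ 4 * Λ * Q ≤ B.varC d C₁ C₂ := by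
    unfold CDVBasis.varC
    gcongr
    · exact le_self_pow₀ hΛ (by norm_num)
    · exact le_self_pow₀ hQ two_ne_zero
  have e0 := B.varC_pos d C₁ C₂
  set W := B.varC d C₁ C₂
  have t1 : 3 * (R ^ 2 * Λ) ^ 2 / n ≤ 4 * W * (1 / n) := by
    rw [mul_one_div]
    refine div_le_div_of_nonneg_right ?_ (by positivity)
    have e3 : (R ^ 2 * Λ) ^ 2 = R ^ 4 * Λ ^ 2 := by ring
    linarith
  have t2 : R ^ 2 * Λ * (R ^ 2 * (Q * x) + R ^ 2 * Λ + R ^ 2 * Λ) / n ^ 2 ≤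
      3 * W * (x / n ^ 2) := by
    rw [← mul_div_assoc]
    refine div_le_div_of_nonneg_right ?_ (by positivity)
    calc _ = R ^ 4 * Λ * Q * x + R ^ 4 * Λ ^ 2 * 1 + R ^ 4 * Λ ^ 2 * 1 := by ring
      _ ≤ W * x + W * x + W * x := by gcongr
      _ = _ := by ring
  -- Because the resolution occurs only to the first power here, the third-order term is absorbed
  -- into the second-order one.
  have t3 : R ^ 2 * Λ * (R ^ 2 * (Q * x)) / n ^ 3 ≤ W * (x / n ^ 2) := by
    rw [← mul_div_assoc]
    refine (div_le_div_of_nonneg_left (by positivity) (by positivity)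
      (pow_le_pow_right₀ hn1 (by norm_num : 2 ≤ 3))).trans ?_
    refine div_le_div_of_nonneg_right ?_ (by positivity)
    calc _ = R ^ 4 * Λ * Q * x := by ring
      _ ≤ W * x := by gcongr
  refine le_trans (add_le_add (add_le_add t1 t2) t3) (le_of_eq ?_)
  ring

theorem variance_clip_mul_le : Var[fun o => clipA C₁ C₂ o * clipY C₁ C₂ o; (P : Measure (Obs d))] ≤
    B.varC d C₁ C₂ := by
  have hΛ := B.one_le_massC d
  have hQ := B.one_le_sizeC d
  have hR := radius_pos C₁ C₂
  have hg : BddMeas fun o : Obs d => clipA C₁ C₂ o * clipY C₁ C₂ o :=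
    (bddMeas_clipA C₁ C₂).mul (bddMeas_clipY C₁ C₂)
  refine (variance_le_expectation_sq hg.1.aestronglyMeasurable).trans ?_
  refine (integral_le_of_le_const (P : Measure (Obs d)) hg.sq (c := radius C₁ C₂ ^ 4)
    fun o => ?_).trans ?_
  · rw [← sq_abs, abs_mul]
    calc _ ≤ (radius C₁ C₂ * radius C₁ C₂) ^ 2 := by
          gcongr
          · exact abs_clip_le _ _ _
          · exact abs_clip_le _ _ _
      _ = _ := by ring
  · unfold CDVBasis.varC
    rw [mul_assoc]
    refine le_mul_of_one_le_right (by positivity) ?_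
    exact one_le_mul_of_one_le_of_one_le (one_le_pow₀ hΛ) (one_le_pow₀ hQ)

theorem variance_psiINT_le (hP : P ∈ B.model d C₁ C₂ α β M) {n : ℕ} (hn : 1 ≤ n) {j₁ j₂ : ℕ}
    (h₁ : B.J₀ ≤ j₁) (h₂ : B.J₀ ≤ j₂) :
    Var[(B.psiINT j₁ j₂ : Sample d 3 n → ℝ); sampleLaw P 3 n] ≤ 4 * B.varC d C₁ C₂ *
      (1 / (n : ℝ) + min (res d j₁) (res d j₂) / (n : ℝ) ^ 2) := by
  rw [variance_psiINT hP hn h₁ h₂, ← res_min]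
  exact variance_hINT_le hP.1 hn _

theorem variance_psiIF_le (hP : P ∈ B.model d C₁ C₂ α β M) {n : ℕ} (hn : 1 ≤ n) (j₁ j₂ : ℕ) :
    Var[(B.psiIF j₁ j₂ : Sample d 3 n → ℝ); sampleLaw P 3 n] ≤ 4 * B.varC d C₁ C₂ *
      (1 / (n : ℝ) + max (res d j₁) (res d j₂) / (n : ℝ) ^ 2 +
        res d j₁ * res d j₂ / (n : ℝ) ^ 3) := by
  rw [variance_psiIF hP hn j₁ j₂]
  refine (variance_ustat_le_of_le_majorants hP.1 hn (B.bddMeas_hIF j₁ j₂)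
    (abs_hIF_le j₁ j₂)).trans ?_
  have := B.varC_pos d C₁ C₂
  have := res_pos d j₁
  have := res_pos d j₂
  gcongr
  norm_num

theorem variance_psiMC_le (hP : P ∈ B.model d C₁ C₂ α β M) {n : ℕ} (hn : 1 ≤ n) (j₁ j₂ : ℕ) :
    Var[(B.psiMC j₁ j₂ : Sample d 4 n → ℝ); sampleLaw P 4 n] ≤ 4 * B.varC d C₁ C₂ *
      (1 / (n : ℝ) + max (res d j₁) (res d j₂) / (n : ℝ) ^ 2 +
        res d j₁ * res d j₂ / (n : ℝ) ^ 3) := by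
  rw [variance_psiMC hP hn j₁ j₂]
  have h1 := variance_ustat_le_of_le_majorants (P := P) hP.1 hn (B.bddMeas_hMC j₁ j₂)
    (abs_hMC_le (C₁ := C₁) (C₂ := C₂) j₁ j₂)
  have h2 := variance_clip_mul_le (B := B) (P := P) (C₁ := C₁) (C₂ := C₂)
  have h3 := B.varC_pos d C₁ C₂
  have h4 := res_pos d j₁
  have h5 := res_pos d j₂
  have hn0 : (0 : ℝ) < n := by exact_mod_cast hn
  have h6 : Var[fun o => clipA C₁ C₂ o * clipY C₁ C₂ o; (P : Measure (Obs d))] / n ≤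
      B.varC d C₁ C₂ * (1 / n) := by
    rw [mul_one_div]; gcongr
  have h7 : B.varC d C₁ C₂ * (1 / n) ≤ B.varC d C₁ C₂ * (1 / (n : ℝ) +
      max (res d j₁) (res d j₂) / (n : ℝ) ^ 2 + res d j₁ * res d j₂ / (n : ℝ) ^ 3) := by
    gcongr
    rw [add_assoc]
    exact le_add_of_nonneg_right (by positivity)
  linarith

/-! ### Lower bounds for variances -/

/-- The reproducing property gives `E K(X, t)² = K(t, t)`, and the diagonal is bounded below by a
multiple of the resolution. -/
theorem le_integral_sq_mul_kernel (hS : 0 < S)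
    (hX : (P : Measure (Obs d)).map obsX = volume.restrict (cube d)) {j : ℕ} (hj : B.J₀ ≤ j)
    {a : Obs d → ℝ} (ha : BddMeas a) {δ : ℝ}
    (hδ : ∀ᵐ o ∂(P : Measure (Obs d)), δ ≤ |a o|) (hδ0 : 0 ≤ δ) {t : Fin d → ℝ} (ht : t ∈ cube d) :
    δ ^ 2 * B.diagC ^ d * res d j ≤
      ∫ o, (a o * B.kernel j (obsX o) t) ^ 2 ∂(P : Measure (Obs d)) := by
  have hK : BddMeas fun o : Obs d => B.kernel j (obsX o) t :=
    BddMeas.comp (φ := fun o : Obs d => (obsX o, t)) (B.bddMeas_kernel j)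
      (measurable_obsX.prodMk measurable_const)
  have h1 : ∫ o, B.kernel j (obsX o) t ^ 2 ∂(P : Measure (Obs d)) = B.kernel j t t := by
    simp_rw [B.kernel_comm j _ t]
    rw [integral_comp_obsX hX (f := fun x => B.kernel j t x ^ 2)
      ((B.continuous_kernel_right j t).pow 2).continuousOn, B.integral_kernel_sq hj ht]
  calc δ ^ 2 * B.diagC ^ d * res d j ≤ δ ^ 2 * B.kernel j t t := by
        rw [mul_assoc]
        exact mul_le_mul_of_nonneg_left (B.le_kernel_diag hS hj ht) (sq_nonneg _)
    _ = ∫ o, δ ^ 2 * B.kernel j (obsX o) t ^ 2 ∂(P : Measure (Obs d)) := by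
        rw [integral_const_mul, h1]
    _ ≤ _ := by
        refine integral_mono_ae (((BddMeas.const _).mul hK.sq).integrable _)
          ((ha.mul hK).sq.integrable _) ?_
        filter_upwards [hδ] with o ho
        simp only [mul_pow]
        refine mul_le_mul_of_nonneg_right ?_ (sq_nonneg _)
        rw [← sq_abs (a o)]
        exact pow_le_pow_left₀ hδ0 ho 2

/-- Uses `(c - u)² ≥ u² / 2 - c²`. The condition on the resolution makes `R²` at most half of the
main term `δ² D k / 2`, where `D` stands for `diagC ^ d`, which leaves a quarter. -/
theorem le_integral_sq_sub_mul_kernel (hS : 0 < S)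
    (hX : (P : Measure (Obs d)).map obsX = volume.restrict (cube d)) {j : ℕ} (hj : B.J₀ ≤ j)
    {a : Obs d → ℝ} (ha : BddMeas a) {δ : ℝ}
    (hδ : ∀ᵐ o ∂(P : Measure (Obs d)), δ ≤ |a o|) (hδ0 : 0 ≤ δ) {t : Fin d → ℝ} (ht : t ∈ cube d)
    {c R : ℝ} (hc : |c| ≤ R) (hj' : 4 * R ^ 2 ≤ δ ^ 2 * B.diagC ^ d * res d j) :
    δ ^ 2 * B.diagC ^ d * res d j / 4 ≤
      ∫ o, (c - a o * B.kernel j (obsX o) t) ^ 2 ∂(P : Measure (Obs d)) := by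
  have hK : BddMeas fun o : Obs d => B.kernel j (obsX o) t :=
    BddMeas.comp (φ := fun o : Obs d => (obsX o, t)) (B.bddMeas_kernel j)
      (measurable_obsX.prodMk measurable_const)
  have h1 := le_integral_sq_mul_kernel hS hX hj ha hδ hδ0 ht
  have h2 : ∫ o, (1 / 2 * (a o * B.kernel j (obsX o) t) ^ 2 - c ^ 2) ∂(P : Measure (Obs d)) ≤
      ∫ o, (c - a o * B.kernel j (obsX o) t) ^ 2 ∂(P : Measure (Obs d)) := by
    refine BddMeas.integral_mono (((BddMeas.const _).mul (ha.mul hK).sq).sub (BddMeas.const _))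
      ((BddMeas.const c).sub (ha.mul hK)).sq _ fun o => ?_
    nlinarith [sq_nonneg (a o * B.kernel j (obsX o) t - 2 * c)]
  rw [integral_sub (((BddMeas.const _).mul (ha.mul hK).sq).integrable _) (integrable_const _),
    integral_const_mul] at h2
  simp only [integral_const, probReal_univ, one_smul] at h2
  have h3 : c ^ 2 ≤ R ^ 2 := by
    rw [← sq_abs]; exact pow_le_pow_left₀ (abs_nonneg _) hc 2
  linarith

/-- The mean of the kernel is bounded independently of the resolutions, in contrast to its second
moment; the variance lower bounds rest on this contrast. -/
theorem abs_integral_le_of_le_majorants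
    (hX : (P : Measure (Obs d)).map obsX = volume.restrict (cube d))
    {j₁ j₂ : ℕ} {h : Obs d → Obs d → Obs d → ℝ} {r : ℝ} (hr : 0 ≤ r)
    (hh : BddMeas fun z : Obs d × Obs d × Obs d => h z.1 z.2.1 z.2.2)
    (hle : ∀ x y z, |h x y z| ≤ r * B.majorant j₁ x z * B.majorant j₂ y z) :
    |∫ z, ∫ y, ∫ x, h x y z ∂(P : Measure (Obs d)) ∂(P : Measure (Obs d))
      ∂(P : Measure (Obs d))| ≤ r * B.massC d * B.massC d := by
  have m₁ := B.bddMeas_majorant (d := d) j₁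
  have m₂ := B.bddMeas_majorant (d := d) j₂
  have hΛ := B.one_le_massC d
  have hg : BddMeas fun z : Obs d × Obs d × Obs d =>
      r * B.majorant j₁ z.1 z.2.2 * B.majorant j₂ z.2.1 z.2.2 :=
    ((BddMeas.const r).mul (m₁.comp (φ := fun z : Obs d × Obs d × Obs d => (z.1, z.2.2))
      (by fun_prop))).mul
      (m₂.comp (φ := fun z : Obs d × Obs d × Obs d => (z.2.1, z.2.2)) (by fun_prop))
  refine abs_integral_three_le (P : Measure (Obs d)) hh
    (g := fun x y z => r * B.majorant j₁ x z * B.majorant j₂ y z) hg hle fun z => ?_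
  have h1 := integral_majorant_left_le (B := B) hX j₁ z
  have h2 := integral_majorant_left_le (B := B) hX j₂ z
  simp_rw [integral_mul_const, integral_const_mul]
  have h3 : 0 ≤ ∫ x, B.majorant j₁ x z ∂(P : Measure (Obs d)) :=
    integral_nonneg fun x => zero_le_one.trans (B.one_le_majorant j₁ x z)
  have h4 : 0 ≤ ∫ x, B.majorant j₂ x z ∂(P : Measure (Obs d)) :=
    integral_nonneg fun x => zero_le_one.trans (B.one_le_majorant j₂ x z)
  gcongr

/-- The condition `6 s² n² ≤ v` says exactly that the loss `3 s² / n` is at most half of `v / n³`.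
-/
theorem le_variance_of_factors {n : ℕ} (hn : 1 ≤ n) {h : Obs d → Obs d → Obs d → ℝ}
    (hh : BddMeas fun z : Obs d × Obs d × Obs d => h z.1 z.2.1 z.2.2) {v s : ℝ}
    (hv : v ≤ ∫ x, ∫ y, ∫ z, h x y z ^ 2 ∂(P : Measure (Obs d)) ∂(P : Measure (Obs d))
      ∂(P : Measure (Obs d)))
    (hs : |∫ z, ∫ y, ∫ x, h x y z ∂(P : Measure (Obs d)) ∂(P : Measure (Obs d))
      ∂(P : Measure (Obs d))| ≤ s) (hvs : 6 * s ^ 2 * n ^ 2 ≤ v) :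
    v / 2 / n ^ 3 ≤ Var[ustat h; threeLaw (P : Measure (Obs d)) n] := by
  refine le_trans ?_ (le_variance_ustat (P : Measure (Obs d)) hn hh)
  have hn0 : (0 : ℝ) < n := by exact_mod_cast hn
  have h1 : (∫ z, ∫ y, ∫ x, h x y z ∂(P : Measure (Obs d)) ∂(P : Measure (Obs d))
      ∂(P : Measure (Obs d))) ^ 2 ≤ s ^ 2 := by
    rw [← sq_abs]; exact pow_le_pow_left₀ (abs_nonneg _) hs 2
  calc v / 2 / n ^ 3 ≤ v / n ^ 3 - 3 * s ^ 2 / n := by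
        have : 3 * s ^ 2 / n ≤ v / 2 / n ^ 3 := by
          rw [div_le_div_iff₀ hn0 (by positivity)]
          nlinarith [mul_le_mul_of_nonneg_right hvs hn0.le]
        have h2 : v / n ^ 3 = v / 2 / n ^ 3 + v / 2 / n ^ 3 := by ring
        linarith
    _ ≤ _ := by gcongr

theorem le_variance_psiMC (hS : 0 < S) (hP : P ∈ B.model d C₁ C₂ α β M) {δ : ℝ} (hδ0 : 0 < δ)
    (hA : ∀ᵐ o ∂(P : Measure (Obs d)), δ ≤ |clipA C₁ C₂ o|)
    (hY : ∀ᵐ o ∂(P : Measure (Obs d)), δ ≤ |clipY C₁ C₂ o|) {n : ℕ} (hn : 1 ≤ n) {j₁ j₂ : ℕ}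
    (h₁ : B.J₀ ≤ j₁) (h₂ : B.J₀ ≤ j₂)
    (hk : 6 * (radius C₁ C₂ ^ 2 * B.massC d * B.massC d) ^ 2 * n ^ 2 ≤
      (δ ^ 2 * B.diagC ^ d) ^ 2 * (res d j₁ * res d j₂)) :
    (δ ^ 2 * B.diagC ^ d) ^ 2 / 2 * (res d j₁ * res d j₂ / n ^ 3) ≤
      Var[(B.psiMC j₁ j₂ : Sample d 4 n → ℝ); sampleLaw P 4 n] := by
  have hD := B.diagC_pos
  have k₁ := res_pos d j₁
  have k₂ := res_pos d j₂
  rw [variance_psiMC hP hn j₁ j₂]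
  have hv := le_integral_sq_of_factors (P : Measure (Obs d))
    (f₁ := fun x z => clipA C₁ C₂ x * B.kernel j₁ (obsX x) (obsX z))
    (f₂ := fun x z => clipY C₁ C₂ x * B.kernel j₂ (obsX x) (obsX z))
    ((bddMeas_clipA_comp measurable_fst).mul (B.bddMeas_kernel_comp j₁ measurable_fst
      measurable_snd))
    ((bddMeas_clipY_comp measurable_fst).mul (B.bddMeas_kernel_comp j₂ measurable_fst
      measurable_snd))
    (c₁ := δ ^ 2 * B.diagC ^ d * res d j₁) (c₂ := δ ^ 2 * B.diagC ^ d * res d j₂)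
    (by positivity) (by positivity)
    ((ae_obsX_mem hP.1).mono fun z hz =>
      le_integral_sq_mul_kernel hS hP.1 h₁ (bddMeas_clipA C₁ C₂) hA hδ0.le hz)
    ((ae_obsX_mem hP.1).mono fun z hz =>
      le_integral_sq_mul_kernel hS hP.1 h₂ (bddMeas_clipY C₁ C₂) hY hδ0.le hz)
  have hs := abs_integral_le_of_le_majorants (P := P) hP.1 (sq_nonneg (radius C₁ C₂))
    (B.bddMeas_hMC (C₁ := C₁) (C₂ := C₂) j₁ j₂) (abs_hMC_le j₁ j₂)
  have h3 := le_variance_of_factors (P := P) hn (B.bddMeas_hMC (C₁ := C₁) (C₂ := C₂) j₁ j₂)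
    (v := (δ ^ 2 * B.diagC ^ d) ^ 2 * (res d j₁ * res d j₂))
    (le_trans (le_of_eq (by ring)) hv) hs hk
  have h4 : 0 ≤ Var[fun o => clipA C₁ C₂ o * clipY C₁ C₂ o; (P : Measure (Obs d))] / n :=
    div_nonneg (variance_nonneg _ _) (Nat.cast_nonneg n)
  refine le_trans (le_of_eq ?_) (h3.trans (le_add_of_nonneg_left h4))
  ring

theorem le_variance_psiIF (hS : 0 < S) (hP : P ∈ B.model d C₁ C₂ α β M) {δ : ℝ} (hδ0 : 0 < δ)
    (hA : ∀ᵐ o ∂(P : Measure (Obs d)), δ ≤ |clipA C₁ C₂ o|)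
    (hY : ∀ᵐ o ∂(P : Measure (Obs d)), δ ≤ |clipY C₁ C₂ o|) {n : ℕ} (hn : 1 ≤ n) {j₁ j₂ : ℕ}
    (h₁ : B.J₀ ≤ j₁) (h₂ : B.J₀ ≤ j₂)
    (hk₁ : 4 * radius C₁ C₂ ^ 2 ≤ δ ^ 2 * B.diagC ^ d * res d j₁)
    (hk₂ : 4 * radius C₁ C₂ ^ 2 ≤ δ ^ 2 * B.diagC ^ d * res d j₂)
    (hk : 6 * (radius C₁ C₂ ^ 2 * B.massC d * B.massC d) ^ 2 * n ^ 2 ≤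
      (δ ^ 2 * B.diagC ^ d / 4) ^ 2 * (res d j₁ * res d j₂)) :
    (δ ^ 2 * B.diagC ^ d / 4) ^ 2 / 2 * (res d j₁ * res d j₂ / n ^ 3) ≤
      Var[(B.psiIF j₁ j₂ : Sample d 3 n → ℝ); sampleLaw P 3 n] := by
  have hD := B.diagC_pos
  have k₁ := res_pos d j₁
  have k₂ := res_pos d j₂
  rw [variance_psiIF hP hn j₁ j₂]
  have hv := le_integral_sq_of_factors (P : Measure (Obs d))
    (f₁ := fun x z => clipA C₁ C₂ z - clipA C₁ C₂ x * B.kernel j₁ (obsX x) (obsX z))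
    (f₂ := fun x z => clipY C₁ C₂ z - clipY C₁ C₂ x * B.kernel j₂ (obsX x) (obsX z))
    ((bddMeas_clipA_comp measurable_snd).sub ((bddMeas_clipA_comp measurable_fst).mul
      (B.bddMeas_kernel_comp j₁ measurable_fst measurable_snd)))
    ((bddMeas_clipY_comp measurable_snd).sub ((bddMeas_clipY_comp measurable_fst).mul
      (B.bddMeas_kernel_comp j₂ measurable_fst measurable_snd)))
    (c₁ := δ ^ 2 * B.diagC ^ d * res d j₁ / 4) (c₂ := δ ^ 2 * B.diagC ^ d * res d j₂ / 4)
    (by positivity) (by positivity)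
    ((ae_obsX_mem hP.1).mono fun z hz =>
      le_integral_sq_sub_mul_kernel hS hP.1 h₁ (bddMeas_clipA C₁ C₂) hA hδ0.le hz
        (abs_clip_le _ _ _) hk₁)
    ((ae_obsX_mem hP.1).mono fun z hz =>
      le_integral_sq_sub_mul_kernel hS hP.1 h₂ (bddMeas_clipY C₁ C₂) hY hδ0.le hz
        (abs_clip_le _ _ _) hk₂)
  have hs := abs_integral_le_of_le_majorants (P := P) hP.1 (sq_nonneg (radius C₁ C₂))
    (B.bddMeas_hIF (C₁ := C₁) (C₂ := C₂) j₁ j₂) (abs_hIF_le j₁ j₂)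
  have h3 := le_variance_of_factors (P := P) hn (B.bddMeas_hIF (C₁ := C₁) (C₂ := C₂) j₁ j₂)
    (v := (δ ^ 2 * B.diagC ^ d / 4) ^ 2 * (res d j₁ * res d j₂))
    (le_trans (le_of_eq (by ring)) hv) hs hk
  refine le_trans (le_of_eq ?_) h3
  ring

end Estimators

/-! ### Functions with extremal wavelet coefficients -/

section Spike

variable {S : ℕ} (B : CDVBasis S) {d : ℕ}

/-- `Π_j` is self-adjoint and fixes wavelets of level below `j`. Together with the next two lemmas,
it acts as exact truncation of the wavelet expansion, freeing the levels from `j` on for a spike. -/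
theorem CDVBasis.inner2_proj_Psi_of_lt {l j : ℕ} (hl : B.J₀ ≤ l) (hlj : l < j)
    {u : (Fin d → ℝ) → ℝ} (hu : ContinuousOn u (cube d)) (ι : Fin d → Bool)
    (m : Fin d → Fin (2 ^ l)) : inner2 (B.proj j u) (B.Psi l ι m) = inner2 u (B.Psi l ι m) := by
  rw [B.inner2_proj_comm j hu (B.continuous_Psi l ι m).continuousOn]
  exact inner2_congr (fun _ _ => rfl) fun x hx => B.integral_kernel_Psi hl hlj ι m hx

theorem CDVBasis.inner2_proj_Phi_of_le {l j : ℕ} (hl : B.J₀ ≤ l) (hlj : l ≤ j)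
    {u : (Fin d → ℝ) → ℝ} (hu : ContinuousOn u (cube d))
    (m : Fin d → Fin (2 ^ l)) : inner2 (B.proj j u) (B.Phi l m) = inner2 u (B.Phi l m) := by
  rw [B.inner2_proj_comm j hu (B.continuous_Phi l m).continuousOn]
  exact inner2_congr (fun _ _ => rfl) fun x hx => B.integral_kernel_Phi hl hlj m hx

theorem CDVBasis.inner2_proj_Psi_of_ge {l j : ℕ} (hj : B.J₀ ≤ j) (hjl : j ≤ l)
    {u : (Fin d → ℝ) → ℝ} (hu : ContinuousOn u (cube d)) {ι : Fin d → Bool}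
    (hι : ι ≠ fun _ => false) (m : Fin d → Fin (2 ^ l)) :
    inner2 (B.proj j u) (B.Psi l ι m) = 0 := by
  rw [B.inner2_proj_left j hu (B.continuous_Psi l ι m).continuousOn]
  refine Finset.sum_eq_zero fun m' _ => ?_
  rw [inner2_comm (B.Psi l ι m), B.inner2_Phi_Psi hj hjl ι hι, mul_zero]

/-- Constants are fixed by the projection onto the coarsest space, which is orthogonal to all
wavelets. -/
theorem CDVBasis.inner2_one_Psi (hS : 0 < S) {l : ℕ} (hl : B.J₀ ≤ l) {ι : Fin d → Bool}
    (hι : ι ≠ fun _ => false) (m : Fin d → Fin (2 ^ l)) :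
    inner2 (fun _ => 1) (B.Psi l ι m) = 0 := by
  rw [← B.inner2_proj_Psi_of_ge le_rfl hl (u := fun _ => 1) continuousOn_const hι m]
  refine inner2_congr (fun x hx => ?_) fun _ _ => rfl
  simp only [CDVBasis.proj, one_mul]
  exact (B.integral_kernel hS le_rfl hx).symm

/-- The sum of all level-`l` wavelets that are wavelets in every coordinate, with the largest
coefficients that are allowed for the smoothness `γ`. -/
def CDVBasis.spikeLevel (γ : ℝ) (l : ℕ) (x : Fin d → ℝ) : ℝ :=
  (2 : ℝ) ^ (-((l : ℝ) * (γ + d / 2))) * ∑ m, B.Psi l (fun _ => true) m x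

/-- A function whose wavelet coefficients from level `L` on decay exactly as the smoothness `γ`
permits. -/
def CDVBasis.spike (γ : ℝ) (L : ℕ) (x : Fin d → ℝ) : ℝ := ∑' l, B.spikeLevel γ (L + l) x

theorem CDVBasis.continuous_spikeLevel (γ : ℝ) (l : ℕ) :
    Continuous (B.spikeLevel γ l : (Fin d → ℝ) → ℝ) :=
  continuous_const.mul (continuous_finsetSum _ fun m _ => B.continuous_Psi l _ m)

/-- Bounded overlap makes the sum of all wavelets of level `l` at most of order `2^{ld/2}`, which
uses up the `d/2` in the coefficient. The remaining geometric decay makes `spike` a uniformly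
convergent series. -/
theorem CDVBasis.abs_spikeLevel_le (γ : ℝ) (l : ℕ) (x : Fin d → ℝ) :
    |B.spikeLevel γ l x| ≤ B.sumC ^ d * ((2 : ℝ) ^ (-γ)) ^ l := by
  have h0 : (0 : ℝ) < 2 := two_pos
  have h1 : (√((2 : ℝ) ^ l)) ^ d = (2 : ℝ) ^ ((l : ℝ) * (d / 2)) := by
    rw [Real.sqrt_eq_rpow, ← Real.rpow_natCast 2 l, ← Real.rpow_mul h0.le, ← Real.rpow_natCast,
      ← Real.rpow_mul h0.le]
    congr 1; ring
  rw [CDVBasis.spikeLevel, abs_mul, abs_of_pos (Real.rpow_pos_of_pos h0 _)]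
  calc _ ≤ (2 : ℝ) ^ (-((l : ℝ) * (γ + d / 2))) * (B.sumC * √(2 ^ l)) ^ d := by
        gcongr
        exact (Finset.abs_sum_le_sum_abs _ _).trans (B.sum_abs_Psi_le l _ x)
    _ = B.sumC ^ d * ((2 : ℝ) ^ (-((l : ℝ) * (γ + d / 2))) * (2 : ℝ) ^ ((l : ℝ) * (d / 2))) := by
        rw [mul_pow, h1]; ring
    _ = _ := by
        rw [← Real.rpow_add h0, ← Real.rpow_natCast _ l, ← Real.rpow_mul h0.le]
        congr 2; ring

theorem CDVBasis.abs_spikeLevel_add_le (γ : ℝ) (L l : ℕ) (x : Fin d → ℝ) :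
    |B.spikeLevel γ (L + l) x| ≤ B.sumC ^ d * ((2 : ℝ) ^ (-γ)) ^ L * ((2 : ℝ) ^ (-γ)) ^ l := by
  rw [mul_assoc, ← pow_add]
  exact B.abs_spikeLevel_le γ _ x

theorem summable_const_mul_two_rpow {γ : ℝ} (hγ : 0 < γ) (C : ℝ) :
    Summable fun l : ℕ => C * ((2 : ℝ) ^ (-γ)) ^ l :=
  (summable_geometric_of_lt_one (Real.rpow_pos_of_pos two_pos _).le
    (two_rpow_neg_lt_one hγ)).mul_left _

theorem CDVBasis.continuous_spike {γ : ℝ} (hγ : 0 < γ) (L : ℕ) :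
    Continuous (B.spike γ L : (Fin d → ℝ) → ℝ) :=
  continuous_tsum (fun l => B.continuous_spikeLevel γ (L + l)) (summable_const_mul_two_rpow hγ _)
    fun l x => B.abs_spikeLevel_add_le γ L l x

theorem CDVBasis.exists_abs_spike_le (d : ℕ) {γ : ℝ} (hγ : 0 < γ) (L : ℕ) :
    ∃ K : ℝ, 0 < K ∧ ∀ x : Fin d → ℝ, |B.spike γ L x| ≤ K := by
  refine ⟨(∑' l : ℕ, B.sumC ^ d * ((2 : ℝ) ^ (-γ)) ^ L * ((2 : ℝ) ^ (-γ)) ^ l) + 1, ?_, fun x => ?_⟩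
  · have := B.sumC_pos
    have : 0 ≤ ∑' l : ℕ, B.sumC ^ d * ((2 : ℝ) ^ (-γ)) ^ L * ((2 : ℝ) ^ (-γ)) ^ l :=
      tsum_nonneg fun l => by positivity
    linarith
  · have := tsum_of_norm_bounded (f := fun l => B.spikeLevel γ (L + l) x)
      (summable_const_mul_two_rpow hγ (B.sumC ^ d * ((2 : ℝ) ^ (-γ)) ^ L)).hasSum fun l => B.abs_spikeLevel_add_le γ L l x
    rw [Real.norm_eq_abs] at this
    exact this.trans (le_add_of_nonneg_right zero_le_one)

/-- Termwise integration is justified by the geometric bound on the levels, so that the coefficients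
of `spike` can be read off level by level. -/
theorem CDVBasis.inner2_spike {γ : ℝ} (hγ : 0 < γ) (L : ℕ) {v : (Fin d → ℝ) → ℝ}
    (hv : ContinuousOn v (cube d)) :
    inner2 (B.spike γ L) v = ∑' l, inner2 (B.spikeLevel γ (L + l)) v := by
  have hint : ∀ l, Integrable (fun x => B.spikeLevel γ (L + l) x * v x)
      (volume.restrict (cube d)) := fun l =>
    integrable_cube ((B.continuous_spikeLevel γ (L + l)).continuousOn.mul hv)
  have hsum : Summable fun l => ∫ x in cube d, ‖B.spikeLevel γ (L + l) x * v x‖ := by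
    refine Summable.of_nonneg_of_le (fun l => integral_nonneg fun x => norm_nonneg _) (fun l => ?_)
      (summable_const_mul_two_rpow hγ
        (B.sumC ^ d * ((2 : ℝ) ^ (-γ)) ^ L * ∫ x in cube d, |v x|))
    calc ∫ x in cube d, ‖B.spikeLevel γ (L + l) x * v x‖
        ≤ ∫ x in cube d, B.sumC ^ d * ((2 : ℝ) ^ (-γ)) ^ L * ((2 : ℝ) ^ (-γ)) ^ l * |v x| := by
          refine integral_mono (hint l).norm ((integrable_cube hv).abs.const_mul _) fun x => ?_
          simp only [Real.norm_eq_abs, abs_mul]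
          exact mul_le_mul_of_nonneg_right (B.abs_spikeLevel_add_le γ L l x) (abs_nonneg _)
      _ = _ := by rw [integral_const_mul]; ring
  unfold inner2
  rw [integral_tsum_of_summable_integral_norm hint hsum]
  refine integral_congr_ae (ae_of_all _ fun x => ?_)
  simp only [CDVBasis.spike]
  rw [tsum_mul_right]

theorem CDVBasis.inner2_spikeLevel_Psi (γ : ℝ) {k l : ℕ} (hk : B.J₀ ≤ k) (hl : B.J₀ ≤ l)
    (hd : 1 ≤ d) {ι : Fin d → Bool} (hι : ι ≠ fun _ => false) (m : Fin d → Fin (2 ^ l)) :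
    inner2 (B.spikeLevel γ k) (B.Psi l ι m) =
      if k = l ∧ ι = fun _ => true then (2 : ℝ) ^ (-((l : ℝ) * (γ + d / 2))) else 0 := by
  have htrue : (fun _ : Fin d => true) ≠ fun _ => false := fun h => by
    simpa using congrFun h ⟨0, hd⟩
  have hc := (B.continuous_Psi l ι m).continuousOn (s := cube d)
  have h1 : inner2 (B.spikeLevel γ k) (B.Psi l ι m) = (2 : ℝ) ^ (-((k : ℝ) * (γ + d / 2))) *
      ∑ m', inner2 (B.Psi k (fun _ => true) m') (B.Psi l ι m) := by
    rw [← inner2_sum_left _ _ _ (fun m' _ => (B.continuous_Psi k _ m').continuousOn) hc,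
      ← inner2_const_mul_left]
    rfl
  rw [h1]
  rcases lt_trichotomy k l with h | h | h
  · rw [if_neg (fun h' => h.ne h'.1)]
    rw [Finset.sum_eq_zero fun m' _ => B.inner2_Psi_Psi_of_lt hk h _ ι hι m' m, mul_zero]
  · subst h
    simp_rw [B.inner2_Psi_Psi hk]
    by_cases hi : ι = fun _ => true
    · subst hi
      simp
    · simp [hi, Ne.symm hi]
  · rw [if_neg (fun h' => h.ne' h'.1)]
    rw [Finset.sum_eq_zero fun m' _ => ?_, mul_zero]
    rw [inner2_comm, B.inner2_Psi_Psi_of_lt hl h ι _ htrue m m']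

theorem CDVBasis.inner2_spike_Psi {γ : ℝ} (hγ : 0 < γ) {L l : ℕ} (hL : B.J₀ ≤ L) (hl : B.J₀ ≤ l)
    (hd : 1 ≤ d) {ι : Fin d → Bool} (hι : ι ≠ fun _ => false) (m : Fin d → Fin (2 ^ l)) :
    inner2 (B.spike γ L) (B.Psi l ι m) =
      if L ≤ l ∧ ι = fun _ => true then (2 : ℝ) ^ (-((l : ℝ) * (γ + d / 2))) else 0 := by
  rw [B.inner2_spike hγ L (B.continuous_Psi l ι m).continuousOn]
  simp_rw [fun k => B.inner2_spikeLevel_Psi γ (hL.trans (Nat.le_add_right L k)) hl hd hι m]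
  by_cases h : L ≤ l
  · rw [tsum_eq_single (l - L)]
    · simp [h]
    · intro k hk
      rw [if_neg]
      rintro ⟨h', -⟩
      omega
  · rw [if_neg (fun h' => h h'.1)]
    convert tsum_zero with k
    rw [if_neg]
    rintro ⟨h', -⟩
    omega

theorem CDVBasis.inner2_spike_Phi {γ : ℝ} (hγ : 0 < γ) {L l : ℕ} (hl : B.J₀ ≤ l) (hlL : l ≤ L)
    (hd : 1 ≤ d) (m : Fin d → Fin (2 ^ l)) : inner2 (B.spike γ L) (B.Phi l m) = 0 := by
  have htrue : (fun _ : Fin d => true) ≠ fun _ => false := fun h => by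
    simpa using congrFun h ⟨0, hd⟩
  have hc := (B.continuous_Phi l m).continuousOn (s := cube d)
  rw [B.inner2_spike hγ L hc]
  convert tsum_zero with k
  have h1 : inner2 (B.spikeLevel γ (L + k)) (B.Phi l m) =
      (2 : ℝ) ^ (-(((L + k : ℕ) : ℝ) * (γ + d / 2))) *
      ∑ m', inner2 (B.Psi (L + k) (fun _ => true) m') (B.Phi l m) := by
    rw [← inner2_sum_left _ _ _ (fun m' _ => (B.continuous_Psi (L + k) _ m').continuousOn) hc,
      ← inner2_const_mul_left]
    rfl
  rw [h1, Finset.sum_eq_zero fun m' _ => ?_, mul_zero]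
  rw [inner2_comm, B.inner2_Phi_Psi hl (hlL.trans (Nat.le_add_right L k)) _ htrue]

end Spike

/-! ### Perturbed regression functions -/

section Perturbation

variable {S : ℕ} (B : CDVBasis S) {d : ℕ} {C₁ C₂ : ℝ}

/-- Conditional expectation preserves the bounds `C₁ ≤ Z ≤ C₂`; the uniform law of `X` turns the
almost sure statement into one about almost every point of the cube. -/
theorem ae_mem_Icc_of_isRegression {P : ProbabilityMeasure (Obs d)}
    (hX : (P : Measure (Obs d)).map obsX = volume.restrict (cube d)) {Z : Obs d → ℝ}
    (hZm : Measurable Z) (hZ : ∀ᵐ o ∂(P : Measure (Obs d)), Z o ∈ Icc C₁ C₂)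
    {g : (Fin d → ℝ) → ℝ} (hg : ContinuousOn g (cube d)) (hreg : IsRegression P Z g) :
    ∀ᵐ x ∂volume.restrict (cube d), g x ∈ Icc C₁ C₂ := by
  have hZi : Integrable Z (P : Measure (Obs d)) :=
    Integrable.of_mem_Icc C₁ C₂ hZm.aemeasurable hZ
  have h1 := condExp_mono (m := sigmaX d) (integrable_const C₁) hZi (hZ.mono fun o h => h.1)
  have h2 := condExp_mono (m := sigmaX d) hZi (integrable_const C₂) (hZ.mono fun o h => h.2)
  rw [condExp_const sigmaX_le] at h1 h2
  have h3 : ∀ᵐ o ∂(P : Measure (Obs d)), (cube d).indicator g (obsX o) ∈ Icc C₁ C₂ := by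
    filter_upwards [h1, h2, hreg, ae_obsX_mem hX] with o h1 h2 h3 h4
    rw [indicator_of_mem h4, ← h3]
    exact ⟨h1, h2⟩
  have h4 := (ae_map_iff measurable_obsX.aemeasurable
    ((measurable_indicator_cube hg) measurableSet_Icc)).2 h3
  rw [hX] at h4
  filter_upwards [h4, ae_restrict_mem (measurableSet_cube d)] with x hx hx'
  rwa [indicator_of_mem hx'] at hx

/-- A regression function in a smaller Hölder ball whose segment to a suitable constant `c` stays
away from zero. -/
theorem CDVBasis.exists_segment {γ M' c : ℝ} (hM' : 0 < M') (hc : c ∈ Ioo C₁ C₂) (hc0 : c ≠ 0)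
    (h : ∃ g ∈ B.holderBall d γ M', ∀ᵐ x ∂volume.restrict (cube d), g x ∈ Icc C₁ C₂) :
    ∃ g ∈ B.holderBall d γ M', (∀ᵐ x ∂volume.restrict (cube d), g x ∈ Icc C₁ C₂) ∧
      ∀ t : ℝ, 0 < t → t ≤ 1 → ∃ δ : ℝ, 0 < δ ∧
        ∀ᵐ x ∂volume.restrict (cube d), δ ≤ |(1 - t) * g x + t * c| := by
  by_cases h0 : (0 : ℝ) ∈ Icc C₁ C₂
  -- If zero is an admissible value, the given function may cross it and is replaced by the zero
  -- function, so that the segment consists of the constants `t c`.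
  · refine ⟨fun _ => 0, ?_, ae_of_all _ fun _ => h0, fun t ht0 ht1 =>
      ⟨t * |c|, by positivity, ae_of_all _ fun x => ?_⟩⟩
    · refine B.mem_holderBall_of_bounds le_rfl le_rfl (by linarith) continuousOn_const
        (fun m => ?_) (fun l _ ι _ m => ?_) <;> simp [inner2]
    · simp [abs_mul, abs_of_pos ht0]
  · obtain ⟨g, hg, hgm⟩ := h
    refine ⟨g, hg, hgm, fun t ht0 ht1 => ?_⟩
    -- Here the whole interval lies on one side of zero, and convexity keeps the segment inside it.
    have hu : ∀ y ∈ Icc C₁ C₂, (1 - t) * y + t * c ∈ Icc C₁ C₂ := fun y hy =>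
      (convex_Icc C₁ C₂) hy (Ioo_subset_Icc_self hc) (by linarith) ht0.le (by ring)
    rcases lt_or_ge 0 C₁ with h1 | h1
    · refine ⟨C₁, h1, hgm.mono fun x hx => (hu _ hx).1.trans (le_abs_self _)⟩
    · have h2 : C₂ < 0 := by
        by_contra! h2; exact h0 ⟨h1, h2⟩
      refine ⟨-C₂, by linarith, hgm.mono fun x hx => ?_⟩
      exact (neg_le_neg (hu _ hx).2).trans (neg_le_abs _)

/-- Below `L` the coefficients are those of the convex combination, and the constant is invisible to
wavelets. From `L` on only the spike remains, whose normalised coefficients are at most `ε`. So the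
constant enlarges only the coarse budget and the spike only the fine one. -/
theorem CDVBasis.perturbation_mem_holderBall (hS : 0 < S) (hd : 1 ≤ d) {γ M M' t c ε : ℝ}
    (hγ : 0 < γ) (hM' : 0 ≤ M') (ht0 : 0 ≤ t) (ht1 : t ≤ 1) (hε : 0 ≤ ε)
    {g : (Fin d → ℝ) → ℝ} (hg : g ∈ B.holderBall d γ M') {L : ℕ} (hL : B.J₀ ≤ L)
    (hsum : t * (|c| * ∑ m : Fin d → Fin (2 ^ B.J₀), (2 : ℝ) ^ ((B.J₀ : ℝ) * (γ + d / 2)) *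
      |inner2 (fun _ => 1) (B.Phi B.J₀ m)|) + ε ≤ M - M') :
    (fun x => B.proj L (fun y => (1 - t) * g y + t * c * 1) x + ε * B.spike γ L x) ∈
      B.holderBall d γ M := by
  obtain ⟨M₁, M₂, h₁, h₂, h₁₂, hΦ, hΨ⟩ := B.exists_bounds_of_mem_holderBall hM' hg
  set K := ∑ m : Fin d → Fin (2 ^ B.J₀), (2 : ℝ) ^ ((B.J₀ : ℝ) * (γ + d / 2)) *
      |inner2 (fun _ => 1) (B.Phi B.J₀ m)|
  have hpos : ∀ l : ℝ, 0 < (2 : ℝ) ^ (l * (γ + d / 2)) := fun l => Real.rpow_pos_of_pos two_pos _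
  have hK0 : 0 ≤ K := Finset.sum_nonneg fun m _ => mul_nonneg (hpos _).le (abs_nonneg _)
  have hgc : ContinuousOn g (cube d) := hg.1.continuousOn
  have hg1 : ContinuousOn (fun y => (1 - t) * g y) (cube d) := continuousOn_const.mul hgc
  have hu : ContinuousOn (fun y => (1 - t) * g y + t * c * 1) (cube d) :=
    hg1.add continuousOn_const
  have hsp : ContinuousOn (B.spike γ L : (Fin d → ℝ) → ℝ) (cube d) :=
    (B.continuous_spike hγ L).continuousOn
  have hεsp : ContinuousOn (fun x => ε * B.spike γ L x) (cube d) := continuousOn_const.mul hsp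
  have hpc := (B.continuous_proj L hu).continuousOn (s := cube d)
  have hcoef : ∀ v : (Fin d → ℝ) → ℝ, Continuous v →
      inner2 (fun x => B.proj L (fun y => (1 - t) * g y + t * c * 1) x + ε * B.spike γ L x) v =
        inner2 (B.proj L fun y => (1 - t) * g y + t * c * 1) v + ε * inner2 (B.spike γ L) v :=
    fun v hv => by
      rw [inner2_add_left hpc hεsp hv.continuousOn, inner2_const_mul_left]
  have hcoef' : ∀ v : (Fin d → ℝ) → ℝ, Continuous v →
      inner2 (fun y => (1 - t) * g y + t * c * 1) v =
        (1 - t) * inner2 g v + t * c * inner2 (fun _ => 1) v := fun v hv => by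
    rw [inner2_add_left hg1 continuousOn_const hv.continuousOn, inner2_const_mul_left,
      inner2_const_mul_left (t * c) (fun _ => 1)]
  have ht1' : 0 ≤ 1 - t := by linarith
  refine B.mem_holderBall_of_bounds (M₁ := M₁ + t * (|c| * K)) (M₂ := M₂ + ε) (by positivity)
    (by positivity) (by linarith) (hpc.add (continuousOn_const.mul hsp)) (fun m => ?_)
    fun l hl ι hι m => ?_
  · have hc := B.continuous_Phi B.J₀ m
    rw [hcoef _ hc, B.inner2_spike_Phi hγ le_rfl hL hd, mul_zero, add_zero,
      B.inner2_proj_Phi_of_le le_rfl hL hu, hcoef' _ hc]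
    set a := (2 : ℝ) ^ ((B.J₀ : ℝ) * (γ + d / 2))
    have ha : 0 < a := hpos _
    have h3 : a * |inner2 (fun _ => 1) (B.Phi B.J₀ m)| ≤ K :=
      Finset.single_le_sum (f := fun m => a * |inner2 (fun _ => 1) (B.Phi B.J₀ m)|)
        (fun m _ => mul_nonneg ha.le (abs_nonneg _)) (Finset.mem_univ m)
    calc a * |(1 - t) * inner2 g (B.Phi B.J₀ m) + t * c * inner2 (fun _ => 1) (B.Phi B.J₀ m)|
        ≤ a * (|(1 - t) * inner2 g (B.Phi B.J₀ m)| +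
            |t * c * inner2 (fun _ => 1) (B.Phi B.J₀ m)|) := by
          gcongr; exact abs_add_le _ _
      _ = (1 - t) * (a * |inner2 g (B.Phi B.J₀ m)|) +
            t * (|c| * (a * |inner2 (fun _ => 1) (B.Phi B.J₀ m)|)) := by
          rw [abs_mul, abs_mul, abs_mul, abs_of_nonneg ht1', abs_of_nonneg ht0]; ring
      _ ≤ 1 * M₁ + t * (|c| * K) := by
          gcongr
          · linarith
          · exact hΦ m
      _ = _ := by rw [one_mul]
  · have hc := B.continuous_Psi l ι m
    rw [hcoef _ hc, B.inner2_spike_Psi hγ hL hl hd hι]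
    have h4 : (2 : ℝ) ^ ((l : ℝ) * (γ + d / 2)) * (2 : ℝ) ^ (-((l : ℝ) * (γ + d / 2))) = 1 := by
      rw [← Real.rpow_add two_pos, add_neg_cancel, Real.rpow_zero]
    set a := (2 : ℝ) ^ ((l : ℝ) * (γ + d / 2))
    have ha : 0 < a := hpos _
    rcases lt_or_ge l L with hlL | hlL
    · rw [if_neg (fun h => absurd h.1 (not_le.2 hlL)), mul_zero, add_zero,
        B.inner2_proj_Psi_of_lt hl hlL hu, hcoef' _ hc, B.inner2_one_Psi hS hl hι, mul_zero,
        add_zero, abs_mul, abs_of_nonneg ht1']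
      calc a * ((1 - t) * |inner2 g (B.Psi l ι m)|)
          = (1 - t) * (a * |inner2 g (B.Psi l ι m)|) := by ring
        _ ≤ 1 * M₂ := by
          gcongr
          · linarith
          · exact hΨ l hl ι hι m
        _ ≤ _ := by linarith
    · rw [B.inner2_proj_Psi_of_ge hL hlL hu hι, zero_add]
      split_ifs
      · rw [abs_mul, abs_of_nonneg hε, abs_of_pos (Real.rpow_pos_of_pos two_pos _),
          mul_left_comm, h4]
        linarith
      · simp only [mul_zero, abs_zero]; positivity

/-- Every sufficiently fine `L` is allowed, so that the perturbations of the two regression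
functions can share one level. Neither the base function nor `δ` depends on the amplitude `ε`, which
is fixed only later. -/
theorem CDVBasis.exists_perturbation (hS : 0 < S) (hd : 1 ≤ d) {γ M M' c : ℝ}
    (hγ : 0 < γ) (hM' : 0 < M') (hM : M' < M) (hc : c ∈ Ioo C₁ C₂) (hc0 : c ≠ 0)
    (h : ∃ g ∈ B.holderBall d γ M', ∀ᵐ x ∂volume.restrict (cube d), g x ∈ Icc C₁ C₂) :
    ∃ J, B.J₀ ≤ J ∧ ∀ L ≥ J, ∃ g : (Fin d → ℝ) → ℝ, Continuous g ∧
      (∀ l ≥ L, ∀ ι : Fin d → Bool, (ι ≠ fun _ => false) → ∀ m, inner2 g (B.Psi l ι m) = 0) ∧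
      ∃ ε₀ > 0, ∃ δ > 0, ∀ ε, 0 < ε → ε ≤ ε₀ →
        (fun x => g x + ε * B.spike γ L x) ∈ B.holderBall d γ M ∧
        ∀ᵐ x ∂volume.restrict (cube d), g x + ε * B.spike γ L x ∈ Icc C₁ C₂ ∧
          δ ≤ |g x + ε * B.spike γ L x| := by
  obtain ⟨g, hg, hgm, hgt⟩ := B.exists_segment hM' hc hc0 h
  have hgc : ContinuousOn g (cube d) := hg.1.continuousOn
  set K := ∑ m : Fin d → Fin (2 ^ B.J₀), (2 : ℝ) ^ ((B.J₀ : ℝ) * (γ + d / 2)) *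
      |inner2 (fun _ => 1) (B.Phi B.J₀ m)|
  have hK0 : 0 ≤ |c| * K := mul_nonneg (abs_nonneg _) (Finset.sum_nonneg fun m _ =>
    mul_nonneg (Real.rpow_pos_of_pos two_pos _).le (abs_nonneg _))
  have hMM : 0 < (M - M') / 2 := by linarith
  -- Half of the slack `M - M'` is reserved for the constant, the other half for the spike.
  obtain ⟨t, ht0, ht1, htK⟩ : ∃ t : ℝ, 0 < t ∧ t ≤ 1 ∧ t * (|c| * K) ≤ (M - M') / 2 := by
    refine ⟨min 1 ((M - M') / 2 / (|c| * K + 1)), by positivity, min_le_left _ _, ?_⟩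
    calc _ ≤ (M - M') / 2 / (|c| * K + 1) * (|c| * K + 1) := by
          gcongr
          · exact min_le_right _ _
          · linarith
      _ = _ := by field_simp
  obtain ⟨δ, hδ, hgδ⟩ := hgt t ht0 ht1
  have hu : ContinuousOn (fun y => (1 - t) * g y + t * c * 1) (cube d) :=
    (continuousOn_const.mul hgc).add continuousOn_const
  -- Moving towards `c` leaves margins `t (c - C₁)` and `t (C₂ - c)` at the end points. The
  -- projection error and the spike may each use `η`, whence the `2 * η`; the `4 * η ≤ δ` keeps the
  -- absolute value above `δ / 2`.
  obtain ⟨η, hη, hη₁, hη₂, hηδ⟩ : ∃ η : ℝ, 0 < η ∧ 2 * η ≤ t * (c - C₁) ∧ 2 * η ≤ t * (C₂ - c) ∧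
      4 * η ≤ δ := by
    have h1 : 0 < t * (c - C₁) := mul_pos ht0 (sub_pos.2 hc.1)
    have h2 : 0 < t * (C₂ - c) := mul_pos ht0 (sub_pos.2 hc.2)
    refine ⟨min (min (t * (c - C₁)) (t * (C₂ - c))) δ / 4, by positivity, ?_, ?_, ?_⟩
    · have := (min_le_left (min (t * (c - C₁)) (t * (C₂ - c))) δ).trans (min_le_left _ _)
      linarith
    · have := (min_le_left (min (t * (c - C₁)) (t * (C₂ - c))) δ).trans (min_le_right _ _)
      linarith
    · have := min_le_right (min (t * (c - C₁)) (t * (C₂ - c))) δ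
      linarith
  obtain ⟨J, hJ, hJη⟩ := B.proj_uniform hS hu hη
  refine ⟨J, hJ, fun L hL => ?_⟩
  have hL0 := hJ.trans hL
  obtain ⟨W, hW, hsW⟩ := B.exists_abs_spike_le d hγ L
  refine ⟨B.proj L fun y => (1 - t) * g y + t * c * 1, B.continuous_proj L hu,
    fun l hl ι hι m => B.inner2_proj_Psi_of_ge hL0 hl hu hι m,
    min ((M - M') / 2) (η / W), by positivity, δ / 2, by positivity, fun ε hε0 hε => ⟨?_, ?_⟩⟩
  · refine B.perturbation_mem_holderBall hS hd hγ hM'.le ht0.le ht1 hε0.le hg hL0 ?_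
    have := hε.trans (min_le_left _ _)
    linarith
  · filter_upwards [hgm, hgδ, ae_restrict_mem (measurableSet_cube d)] with x hx hxδ hxc
    have h1 := abs_le.1 (hJη L hL x hxc)
    have h2 : |ε * B.spike γ L x| ≤ η := by
      rw [abs_mul, abs_of_pos hε0]
      calc _ ≤ η / W * W := by
            gcongr
            · exact hε.trans (min_le_right _ _)
            · exact hsW x
        _ = η := by field_simp
    have h3 := abs_le.1 h2
    have h4 : (1 - t) * C₁ ≤ (1 - t) * g x := mul_le_mul_of_nonneg_left hx.1 (by linarith)
    have h5 : (1 - t) * g x ≤ (1 - t) * C₂ := mul_le_mul_of_nonneg_left hx.2 (by linarith)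
    refine ⟨⟨by linarith, by linarith⟩, ?_⟩
    rcases le_abs.1 hxδ with h6 | h6
    · exact (by linarith : δ / 2 ≤ _).trans (le_abs_self _)
    · exact (by linarith : δ / 2 ≤ _).trans (neg_le_abs _)

end Perturbation

/-! ### A distribution with large bias at every resolution -/

section LeastFavourable

variable {S : ℕ} (B : CDVBasis S) {d : ℕ}

theorem CDVBasis.lev_spike_right {β : ℝ} (hβ : 0 < β) (hd : 1 ≤ d) {L l : ℕ} (hL : B.J₀ ≤ L)
    (hl : B.J₀ ≤ l) (u : (Fin d → ℝ) → ℝ) :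
    B.lev l u (B.spike β L) = if L ≤ l then
      (2 : ℝ) ^ (-((l : ℝ) * (β + d / 2))) * ∑ m, inner2 u (B.Psi l (fun _ => true) m) else 0 := by
  have htrue : (fun _ : Fin d => true) ≠ fun _ => false := fun h => by
    simpa using congrFun h ⟨0, hd⟩
  unfold CDVBasis.lev
  rw [Finset.sum_eq_single (fun _ => true)]
  · simp_rw [B.inner2_spike_Psi hβ hL hl hd htrue]
    split_ifs with h1 h2 h2
    · rw [Finset.mul_sum]; exact Finset.sum_congr rfl fun m _ => mul_comm _ _
    · exact absurd h1.1 h2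
    · exact absurd ⟨h2, trivial⟩ h1
    · simp
  · intro ι hι hne
    refine Finset.sum_eq_zero fun m _ => ?_
    rw [B.inner2_spike_Psi hβ hL hl hd (Finset.mem_filter.1 hι).2, if_neg (fun h => hne h.2),
      mul_zero]
  · intro h
    rw [Finset.mem_filter] at h
    exact absurd ⟨Finset.mem_univ _, htrue⟩ h

/-- From `L` on, the base function contributes nothing, and the `2^{ld}` coefficient products at a
level are all equal to the largest permitted size up to `ε`; the extremal rate is attained exactly.
-/
theorem CDVBasis.lev_perturbation_spike {α β : ℝ} (hα : 0 < α) (hβ : 0 < β) (hd : 1 ≤ d) {L l : ℕ}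
    (hL : B.J₀ ≤ L) (hl : L ≤ l) {g : (Fin d → ℝ) → ℝ} (hg : Continuous g)
    (hgΨ : ∀ m, inner2 g (B.Psi l (fun _ => true) m) = 0) (ε : ℝ) :
    B.lev l (fun x => g x + ε * B.spike α L x) (B.spike β L) =
      ε * ((2 : ℝ) ^ (-(α + β))) ^ l := by
  have htrue : (fun _ : Fin d => true) ≠ fun _ => false := fun h => by
    simpa using congrFun h ⟨0, hd⟩
  have hsp : ContinuousOn (fun x : Fin d → ℝ => ε * B.spike α L x) (cube d) :=
    (continuous_const.mul (B.continuous_spike hα L)).continuousOn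
  have h1 : ∀ m, inner2 (fun x => g x + ε * B.spike α L x) (B.Psi l (fun _ => true) m) =
      ε * (2 : ℝ) ^ (-((l : ℝ) * (α + d / 2))) := fun m => by
    rw [inner2_add_left hg.continuousOn hsp (B.continuous_Psi l _ m).continuousOn, hgΨ, zero_add,
      inner2_const_mul_left, B.inner2_spike_Psi hα hL (hL.trans hl) hd htrue, if_pos ⟨hl, rfl⟩]
  rw [B.lev_spike_right hβ hd hL (hL.trans hl), if_pos hl, ← level_rpow l d α β]
  simp_rw [h1]
  rw [Finset.sum_const, Finset.card_univ, Fintype.card_fun, Fintype.card_fin, Fintype.card_fin,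
    nsmul_eq_mul]
  push_cast
  ring

theorem exists_pos_le_of_pos {f : ℕ → ℝ} (L : ℕ) (hf : ∀ j < L, 0 < f j) :
    ∃ c : ℝ, 0 < c ∧ ∀ j < L, c ≤ f j := by
  induction L with
  | zero => exact ⟨1, one_pos, fun j hj => absurd hj (Nat.not_lt_zero j)⟩
  | succ L ih =>
    obtain ⟨c, hc, h⟩ := ih fun j hj => hf j (hj.trans (Nat.lt_succ_self L))
    refine ⟨min c (f L), lt_min hc (hf L (Nat.lt_succ_self L)), fun j hj => ?_⟩
    rcases Nat.lt_succ_iff_lt_or_eq.1 hj with h' | rfl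
    · exact (min_le_left _ _).trans (h j h')
    · exact min_le_right _ _

/-- Two perturbed functions whose gap is of the maximal order at every resolution. -/
theorem CDVBasis.exists_le_abs_gap (hS : 0 < S) (hd : 1 ≤ d) {α β : ℝ} (hα : 0 < α) (hβ : 0 < β)
    {L : ℕ} (hL : B.J₀ ≤ L) {g g' : (Fin d → ℝ) → ℝ} (hg : Continuous g) (hg' : Continuous g')
    (hgΨ : ∀ l ≥ L, ∀ ι : Fin d → Bool, (ι ≠ fun _ => false) → ∀ m, inner2 g (B.Psi l ι m) = 0)
    (hgΨ' : ∀ l ≥ L, ∀ ι : Fin d → Bool, (ι ≠ fun _ => false) → ∀ m,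
      inner2 g' (B.Psi l ι m) = 0) {ε₁ ε₂ : ℝ} (hε₁ : 0 < ε₁) (hε₂ : 0 < ε₂) :
    ∃ ε : ℝ, 0 < ε ∧ ε ≤ ε₂ ∧ ∃ c : ℝ, 0 < c ∧ ∀ j ≥ B.J₀, c * ((2 : ℝ) ^ (-(α + β))) ^ j ≤
      |B.gap j (fun x => g x + ε₁ * B.spike α L x) fun x => g' x + ε * B.spike β L x| := by
  have htrue : (fun _ : Fin d => true) ≠ fun _ => false := fun h => by
    simpa using congrFun h ⟨0, hd⟩
  set p := fun x => g x + ε₁ * B.spike α L x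
  set w : (Fin d → ℝ) → ℝ := B.spike β L
  set r := (2 : ℝ) ^ (-(α + β))
  have hr0 : 0 < r := Real.rpow_pos_of_pos two_pos _
  have hpc : ContinuousOn p (cube d) :=
    (hg.add (continuous_const.mul (B.continuous_spike hα L))).continuousOn
  have hwc : ContinuousOn w (cube d) := (B.continuous_spike hβ L).continuousOn
  have hgc' := hg'.continuousOn (s := cube d)
  have hlev : ∀ l ≥ L, B.lev l p w = ε₁ * r ^ l := fun l hl =>
    B.lev_perturbation_spike hα hβ hd hL hl hg (hgΨ l hl _ htrue) ε₁
  -- Below `L` the spike has no coefficients, so nothing there can offset the positive levels above.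
  have hlev0 : ∀ l ≥ B.J₀, 0 ≤ B.lev l p w := fun l hl => by
    rcases lt_or_ge l L with h | h
    · rw [B.lev_spike_right hβ hd hL hl, if_neg (not_le.2 h)]
    · rw [hlev l h]; positivity
  have hgapw : ∀ j ≥ B.J₀, ε₁ * r ^ max j L ≤ B.gap j p w := fun j hj => by
    rw [← hlev _ (le_max_right j L)]
    exact B.lev_le_gap hS hj hpc hwc (fun l hl => hlev0 l (hj.trans hl)) (le_max_left j L)
  have hgapw0 : ∀ j ≥ B.J₀, 0 < B.gap j p w := fun j hj =>
    (by positivity : 0 < ε₁ * r ^ max j L).trans_le (hgapw j hj)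
  have hgapg : ∀ j ≥ L, B.gap j p g' = 0 := fun j hj => by
    have h := B.abs_gap_le_of_lev_le hS (hL.trans hj) hpc hgc' (le_refl (0 : ℝ)) (le_refl (0 : ℝ))
      zero_lt_one fun l hl => by
        rw [zero_mul, CDVBasis.lev, Finset.sum_eq_zero, abs_zero]
        intro ι hι
        refine Finset.sum_eq_zero fun m _ => ?_
        rw [hgΨ' l (hj.trans hl) ι (Finset.mem_filter.1 hι).2, mul_zero]
    rw [zero_mul, zero_div] at h
    exact abs_nonpos_iff.1 h
  -- For each `j < L` with `J₀ ≤ j` the gap is affine in `ε` with positive slope and vanishes for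
  -- one value only. The interval `(0, ε₂]` is infinite, so some amplitude avoids all these roots at
  -- once.
  obtain ⟨ε, hε, hεn⟩ := (Set.Ioc_infinite hε₂).exists_notMem_finset
    ((Finset.range L).image fun j => -(B.gap j p g' / B.gap j p w))
  have hgap : ∀ j, B.gap j p (fun x => g' x + ε * w x) = B.gap j p g' + ε * B.gap j p w :=
    fun j => B.gap_add_mul_right j hpc hgc' hwc ε
  -- The value `1` for `j < J₀` only keeps the family positive; such `j` do not occur in the
  -- conclusion.
  obtain ⟨c, hc, hcj⟩ := exists_pos_le_of_pos
    (f := fun j => if B.J₀ ≤ j then |B.gap j p g' + ε * B.gap j p w| / r ^ j else 1) L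
    fun j hj => by
      split_ifs with h
      · refine div_pos (abs_pos.2 fun h0 => hεn ?_) (pow_pos hr0 _)
        refine Finset.mem_image.2 ⟨j, Finset.mem_range.2 hj, ?_⟩
        have := (hgapw0 j h).ne'
        field_simp
        linarith
      · exact one_pos
  refine ⟨ε, hε.1, hε.2, min c (ε * ε₁), lt_min hc (mul_pos hε.1 hε₁), fun j hj => ?_⟩
  rw [hgap]
  rcases lt_or_ge j L with h | h
  · have h1 := hcj j h
    rw [if_pos hj, le_div_iff₀ (pow_pos hr0 _)] at h1
    refine le_trans ?_ h1
    gcongr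
    exact min_le_left _ _
  · rw [hgapg j h, zero_add, abs_of_pos (mul_pos hε.1 (hgapw0 j hj))]
    have h1 := hgapw j hj
    rw [max_eq_left h] at h1
    calc min c (ε * ε₁) * r ^ j ≤ ε * ε₁ * r ^ j := by gcongr; exact min_le_right _ _
      _ = ε * (ε₁ * r ^ j) := by ring
      _ ≤ _ := mul_le_mul_of_nonneg_left h1 hε.1.le

theorem isRegression_map {p : (Fin d → ℝ) → ℝ} (hp : Continuous p) {Z : Obs d → ℝ}
    {P : ProbabilityMeasure (Obs d)} (hZ : Z =ᵐ[(P : Measure (Obs d))] fun o => p (obsX o))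
    (hZi : Integrable Z (P : Measure (Obs d))) : IsRegression P Z p := by
  unfold IsRegression
  refine (condExp_congr_ae hZ).trans (EventuallyEq.of_eq ?_)
  refine condExp_of_stronglyMeasurable sigmaX_le ?_ (hZi.congr hZ)
  exact (hp.measurable.comp (comap_measurable obsX)).stronglyMeasurable

/-- The law of `(X, p(X), b(X))`. -/
theorem CDVBasis.exists_deterministic {C₁ C₂ α β M δ : ℝ} {p b : (Fin d → ℝ) → ℝ}
    (hp : Continuous p) (hb : Continuous b)
    (hpM : p ∈ B.holderBall d α M) (hbM : b ∈ B.holderBall d β M)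
    (hpC : ∀ᵐ x ∂volume.restrict (cube d), p x ∈ Icc C₁ C₂ ∧ δ ≤ |p x|)
    (hbC : ∀ᵐ x ∂volume.restrict (cube d), b x ∈ Icc C₁ C₂ ∧ δ ≤ |b x|) :
    ∃ P ∈ B.model d C₁ C₂ α β M, IsRegression P obsA p ∧ IsRegression P obsY b ∧
      (∀ᵐ o ∂(P : Measure (Obs d)), δ ≤ |clipA C₁ C₂ o|) ∧
      ∀ᵐ o ∂(P : Measure (Obs d)), δ ≤ |clipY C₁ C₂ o| := by
  have hm : Measurable fun x : Fin d → ℝ => ((x, p x, b x) : Obs d) :=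
    measurable_id.prodMk (hp.measurable.prodMk hb.measurable)
  let P : ProbabilityMeasure (Obs d) := ⟨(volume.restrict (cube d)).map fun x => (x, p x, b x),
    Measure.isProbabilityMeasure_map hm.aemeasurable⟩
  have hP : (P : Measure (Obs d)) = (volume.restrict (cube d)).map fun x => (x, p x, b x) := rfl
  have hX : (P : Measure (Obs d)).map obsX = volume.restrict (cube d) := by
    rw [hP, Measure.map_map measurable_obsX hm]
    exact Measure.map_id
  have hA : obsA =ᵐ[(P : Measure (Obs d))] fun o => p (obsX o) := by
    rw [hP]
    exact (ae_map_iff hm.aemeasurable (measurableSet_eq_fun measurable_obsA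
      (hp.measurable.comp measurable_obsX))).2 (ae_of_all _ fun x => rfl)
  have hY : obsY =ᵐ[(P : Measure (Obs d))] fun o => b (obsX o) := by
    rw [hP]
    exact (ae_map_iff hm.aemeasurable (measurableSet_eq_fun measurable_obsY
      (hb.measurable.comp measurable_obsX))).2 (ae_of_all _ fun x => rfl)
  have hpo := ae_of_ae_map measurable_obsX.aemeasurable (hX.symm ▸ hpC)
  have hbo := ae_of_ae_map measurable_obsX.aemeasurable (hX.symm ▸ hbC)
  have hAC : ∀ᵐ o ∂(P : Measure (Obs d)), obsA o ∈ Icc C₁ C₂ := by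
    filter_upwards [hA, hpo] with o h1 h2
    rw [h1]; exact h2.1
  have hYC : ∀ᵐ o ∂(P : Measure (Obs d)), obsY o ∈ Icc C₁ C₂ := by
    filter_upwards [hY, hbo] with o h1 h2
    rw [h1]; exact h2.1
  have hAr : IsRegression P obsA p :=
    isRegression_map hp hA (Integrable.of_mem_Icc C₁ C₂ measurable_obsA.aemeasurable hAC)
  have hYr : IsRegression P obsY b :=
    isRegression_map hb hY (Integrable.of_mem_Icc C₁ C₂ measurable_obsY.aemeasurable hYC)
  refine ⟨P, ⟨hX, hAC.and hYC, ⟨p, hpM, hAr⟩, ⟨b, hbM, hYr⟩⟩, hAr, hYr, ?_, ?_⟩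
  · filter_upwards [hA, hpo, hAC] with o h1 h2 h3
    rw [clipA, clip_of_mem h3, h1]; exact h2.2
  · filter_upwards [hY, hbo, hYC] with o h1 h2 h3
    rw [clipY, clip_of_mem h3, h1]; exact h2.2

theorem exists_ne_zero_mem_Ioo {C₁ C₂ : ℝ} (hC : C₁ < C₂) : ∃ c ∈ Ioo C₁ C₂, c ≠ 0 := by
  obtain ⟨c, hc, h⟩ := (Set.Ioo_infinite hC).exists_notMem_finset {0}
  exact ⟨c, hc, by simpa using h⟩

/-- Both perturbations use the level `max J₁ J₂`. The first spike gets its full amplitude `ε₁`, the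
second the amplitude that keeps the gap nonzero. No noise is required: with `A = p(X)` and `Y =
b(X)`, the lower bounds on `|p|` and `|b|` pass directly to the observations. -/
theorem CDVBasis.exists_least_favourable (hS : 0 < S) (hd : 1 ≤ d) {α β M C₁ C₂ : ℝ}
    (hα : 0 < α) (hβ : 0 < β) (hC : C₁ < C₂)
    (hmodel : ∃ M' : ℝ, 0 < M' ∧ M' < M ∧ (B.model d C₁ C₂ α β M').Nonempty) :
    ∃ P ∈ B.model d C₁ C₂ α β M, ∃ p ∈ B.holderBall d α M, ∃ b ∈ B.holderBall d β M,
      IsRegression P obsA p ∧ IsRegression P obsY b ∧ (∃ δ > 0,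
        (∀ᵐ o ∂(P : Measure (Obs d)), δ ≤ |clipA C₁ C₂ o|) ∧
        ∀ᵐ o ∂(P : Measure (Obs d)), δ ≤ |clipY C₁ C₂ o|) ∧
      ∃ c > 0, ∀ j ≥ B.J₀, c * ((2 : ℝ) ^ (-(α + β))) ^ j ≤ |B.gap j p b| := by
  obtain ⟨M', hM', hM, Q, hQX, hQ, ⟨p₀, hp₀, hp₀r⟩, ⟨b₀, hb₀, hb₀r⟩⟩ := hmodel
  obtain ⟨c, hc, hc0⟩ := exists_ne_zero_mem_Ioo hC
  obtain ⟨J₁, hJ₁, h₁⟩ := B.exists_perturbation hS hd hα hM' hM hc hc0 ⟨p₀, hp₀,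
    ae_mem_Icc_of_isRegression hQX measurable_obsA (hQ.mono fun o h => h.1) hp₀.1.continuousOn
      hp₀r⟩
  obtain ⟨J₂, hJ₂, h₂⟩ := B.exists_perturbation hS hd hβ hM' hM hc hc0 ⟨b₀, hb₀,
    ae_mem_Icc_of_isRegression hQX measurable_obsY (hQ.mono fun o h => h.2) hb₀.1.continuousOn
      hb₀r⟩
  obtain ⟨g₁, hg₁, hgΨ₁, ε₁, hε₁, δ₁, hδ₁, hm₁⟩ := h₁ (max J₁ J₂) (le_max_left _ _)
  obtain ⟨g₂, hg₂, hgΨ₂, ε₂, hε₂, δ₂, hδ₂, hm₂⟩ := h₂ (max J₁ J₂) (le_max_right _ _)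
  have hL : B.J₀ ≤ max J₁ J₂ := hJ₁.trans (le_max_left _ _)
  obtain ⟨ε, hε0, hε, k, hk, hgap⟩ :=
    B.exists_le_abs_gap hS hd hα hβ hL hg₁ hg₂ hgΨ₁ hgΨ₂ hε₁ hε₂
  obtain ⟨hpM, hpC⟩ := hm₁ ε₁ hε₁ le_rfl
  obtain ⟨hbM, hbC⟩ := hm₂ ε hε0 hε
  obtain ⟨P, hP, hA, hY, hAδ, hYδ⟩ := B.exists_deterministic (δ := min δ₁ δ₂)
    (hg₁.add (continuous_const.mul (B.continuous_spike hα _)))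
    (hg₂.add (continuous_const.mul (B.continuous_spike hβ _))) hpM hbM
    (hpC.mono fun x h => ⟨h.1, (min_le_left _ _).trans h.2⟩)
    (hbC.mono fun x h => ⟨h.1, (min_le_right _ _).trans h.2⟩)
  exact ⟨P, hP, _, hpM, _, hbM, hA, hY, ⟨min δ₁ δ₂, lt_min hδ₁ hδ₂, hAδ, hYδ⟩, k, hk, hgap⟩

end LeastFavourable

/-! ### Worst-case quantities and growing resolutions -/

section Assembly

variable {d m n : ℕ} {Q : Set (ProbabilityMeasure (Obs d))} {est : Sample d m n → ℝ}

theorem worstBias_le {c : ℝ} (h : ∀ P ∈ Q, |bias P est| ≤ c) :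
    worstBias Q est ≤ ENNReal.ofReal c :=
  iSup₂_le fun P hP => ENNReal.ofReal_le_ofReal (h P hP)

theorem le_worstBias {c : ℝ} {P : ProbabilityMeasure (Obs d)} (hP : P ∈ Q) (h : c ≤ |bias P est|) :
    ENNReal.ofReal c ≤ worstBias Q est :=
  (ENNReal.ofReal_le_ofReal h).trans
    (le_iSup₂ (f := fun P (_ : P ∈ Q) => ENNReal.ofReal |bias P est|) P hP)

theorem worstVar_le {c : ℝ} (h : ∀ P ∈ Q, MemLp est 2 (sampleLaw P m n) ∧
    Var[est; sampleLaw P m n] ≤ c) : worstVar Q est ≤ ENNReal.ofReal c :=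
  iSup₂_le fun P hP => by
    rw [← (h P hP).1.ofReal_variance_eq]
    exact ENNReal.ofReal_le_ofReal (h P hP).2

theorem eventually_mul_le_res {d : ℕ} {j : ℕ → ℕ}
    (h : Tendsto (fun n : ℕ => res d (j n) / (n : ℝ)) atTop atTop) (K : ℝ) :
    ∀ᶠ n : ℕ in atTop, K * n ≤ res d (j n) := by
  filter_upwards [h.eventually_ge_atTop K, eventually_ge_atTop 1] with n hn h1
  exact (le_div_iff₀ (by exact_mod_cast h1)).1 hn

/-- Eventually both resolutions exceed `K n`, and their product exceeds `K² n²`; a `K` above `1`, `b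
/ a` and `e / s` meets all thresholds. The pair `e`, `s` is for conditions on each resolution alone.
-/
theorem eventually_large_res {d : ℕ} {j₁ j₂ : ℕ → ℕ}
    (h₁ : Tendsto (fun n : ℕ => res d (j₁ n) / (n : ℝ)) atTop atTop)
    (h₂ : Tendsto (fun n : ℕ => res d (j₂ n) / (n : ℝ)) atTop atTop) {a b e s : ℝ} (ha : 0 < a)
    (hs : 0 < s) : ∀ᶠ n : ℕ in atTop, 1 ≤ n ∧ b * n ^ 2 ≤ a * (res d (j₁ n) * res d (j₂ n)) ∧
      e ≤ s * res d (j₁ n) ∧ e ≤ s * res d (j₂ n) := by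
  set K := max 1 (max (b / a) (e / s))
  have hK1 : 1 ≤ K := le_max_left _ _
  have hKb : b ≤ K * a :=
    (div_le_iff₀ ha).1 ((le_max_left _ _).trans (le_max_right _ _))
  have hKe : e ≤ K * s :=
    (div_le_iff₀ hs).1 ((le_max_right _ _).trans (le_max_right _ _))
  filter_upwards [eventually_mul_le_res h₁ K, eventually_mul_le_res h₂ K, eventually_ge_atTop 1]
    with n hn₁ hn₂ hn
  have hn1 : (1 : ℝ) ≤ n := by exact_mod_cast hn
  have k₁ := (res_pos d (j₁ n)).le
  have hKn : K ≤ K * n := le_mul_of_one_le_right (by linarith) hn1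
  refine ⟨hn, ?_, ?_, ?_⟩
  · calc b * n ^ 2 ≤ K * a * n ^ 2 := by gcongr
      _ ≤ K * (K * a) * n ^ 2 := by
        gcongr
        exact le_mul_of_one_le_left (by positivity) hK1
      _ = a * (K * n * (K * n)) := by ring
      _ ≤ _ := by gcongr
  · calc e ≤ K * s := hKe
      _ ≤ K * n * s := by gcongr
      _ ≤ res d (j₁ n) * s := by gcongr
      _ = _ := mul_comm _ _
  · calc e ≤ K * s := hKe
      _ ≤ K * n * s := by gcongr
      _ ≤ res d (j₂ n) * s := by gcongr
      _ = _ := mul_comm _ _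

end Assembly

end DoubleSplit

end

theorem theorem1 {d S : ℕ} (hd : 1 ≤ d) (B : CDVBasis S) {α β M C₁ C₂ : ℝ}
    (hα : 0 < α) (hβ : 0 < β) (hαS : α < S) (hβS : β < S) (hM : 0 < M) (hC : C₁ < C₂)
    (hmodel : ∃ M' : ℝ, 0 < M' ∧ M' < M ∧ (B.model d C₁ C₂ α β M').Nonempty) :
    -- all three estimators are square integrable, so that biases and variances are meaningful
    (∀ P ∈ B.model d C₁ C₂ α β M, ∀ n : ℕ, 1 ≤ n → ∀ j₁ ≥ B.J₀, ∀ j₂ ≥ B.J₀,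
      MemLp (B.psiINT j₁ j₂ : Sample d 3 n → ℝ) 2 (sampleLaw P 3 n) ∧
      MemLp (B.psiMC j₁ j₂ : Sample d 4 n → ℝ) 2 (sampleLaw P 4 n) ∧
      MemLp (B.psiIF j₁ j₂ : Sample d 3 n → ℝ) 2 (sampleLaw P 3 n)) ∧
    -- 1) integral-based plug-in estimator
    (∃ c : ℝ, 0 < c ∧ ∃ C : ℝ, 0 < C ∧ ∀ n : ℕ, 1 ≤ n → ∀ j₁ ≥ B.J₀, ∀ j₂ ≥ B.J₀,
      ENNReal.ofReal (c * min (res d j₁) (res d j₂) ^ (-(α + β) / (d : ℝ))) ≤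
        worstBias (B.model d C₁ C₂ α β M) (B.psiINT j₁ j₂ : Sample d 3 n → ℝ) ∧
      worstBias (B.model d C₁ C₂ α β M) (B.psiINT j₁ j₂ : Sample d 3 n → ℝ) ≤
        ENNReal.ofReal (C * min (res d j₁) (res d j₂) ^ (-(α + β) / (d : ℝ))) ∧
      worstVar (B.model d C₁ C₂ α β M) (B.psiINT j₁ j₂ : Sample d 3 n → ℝ) ≤
        ENNReal.ofReal (C * (1 / (n : ℝ) + min (res d j₁) (res d j₂) / (n : ℝ) ^ 2))) ∧
    -- 2a) Monte Carlo-based plug-in estimator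
    (∃ c : ℝ, 0 < c ∧ ∃ C : ℝ, 0 < C ∧ ∀ n : ℕ, 1 ≤ n → ∀ j₁ ≥ B.J₀, ∀ j₂ ≥ B.J₀,
      ENNReal.ofReal (c * min (res d j₁) (res d j₂) ^ (-(α + β) / (d : ℝ))) ≤
        worstBias (B.model d C₁ C₂ α β M) (B.psiMC j₁ j₂ : Sample d 4 n → ℝ) ∧
      worstBias (B.model d C₁ C₂ α β M) (B.psiMC j₁ j₂ : Sample d 4 n → ℝ) ≤
        ENNReal.ofReal (C * min (res d j₁) (res d j₂) ^ (-(α + β) / (d : ℝ))) ∧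
      worstVar (B.model d C₁ C₂ α β M) (B.psiMC j₁ j₂ : Sample d 4 n → ℝ) ≤
        ENNReal.ofReal (C * (1 / (n : ℝ) + max (res d j₁) (res d j₂) / (n : ℝ) ^ 2
          + res d j₁ * res d j₂ / (n : ℝ) ^ 3))) ∧
    -- 2b) one distribution for all resolution sequences `k₁, k₂ ≫ n`
    (∃ P ∈ B.model d C₁ C₂ α β M, ∃ c : ℝ, 0 < c ∧ ∀ j₁ j₂ : ℕ → ℕ,
      (∀ n, B.J₀ ≤ j₁ n) → (∀ n, B.J₀ ≤ j₂ n) →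
      Tendsto (fun n : ℕ => res d (j₁ n) / (n : ℝ)) atTop atTop →
      Tendsto (fun n : ℕ => res d (j₂ n) / (n : ℝ)) atTop atTop →
      ∀ᶠ n : ℕ in atTop,
        c * min (res d (j₁ n)) (res d (j₂ n)) ^ (-(α + β) / (d : ℝ)) ≤
          |bias P (B.psiMC (j₁ n) (j₂ n) : Sample d 4 n → ℝ)| ∧
        c * (res d (j₁ n) * res d (j₂ n) / (n : ℝ) ^ 3) ≤
          var P (B.psiMC (j₁ n) (j₂ n) : Sample d 4 n → ℝ)) ∧
    -- 3a) first-order bias-corrected estimator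
    (∃ c : ℝ, 0 < c ∧ ∃ C : ℝ, 0 < C ∧ ∀ n : ℕ, 1 ≤ n → ∀ j₁ ≥ B.J₀, ∀ j₂ ≥ B.J₀,
      ENNReal.ofReal (c * max (res d j₁) (res d j₂) ^ (-(α + β) / (d : ℝ))) ≤
        worstBias (B.model d C₁ C₂ α β M) (B.psiIF j₁ j₂ : Sample d 3 n → ℝ) ∧
      worstBias (B.model d C₁ C₂ α β M) (B.psiIF j₁ j₂ : Sample d 3 n → ℝ) ≤
        ENNReal.ofReal (C * max (res d j₁) (res d j₂) ^ (-(α + β) / (d : ℝ))) ∧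
      worstVar (B.model d C₁ C₂ α β M) (B.psiIF j₁ j₂ : Sample d 3 n → ℝ) ≤
        ENNReal.ofReal (C * (1 / (n : ℝ) + max (res d j₁) (res d j₂) / (n : ℝ) ^ 2
          + res d j₁ * res d j₂ / (n : ℝ) ^ 3))) ∧
    -- 3b) one distribution for all resolution sequences `k₁, k₂ ≫ n`
    (∃ P ∈ B.model d C₁ C₂ α β M, ∃ c : ℝ, 0 < c ∧ ∀ j₁ j₂ : ℕ → ℕ,
      (∀ n, B.J₀ ≤ j₁ n) → (∀ n, B.J₀ ≤ j₂ n) →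
      Tendsto (fun n : ℕ => res d (j₁ n) / (n : ℝ)) atTop atTop →
      Tendsto (fun n : ℕ => res d (j₂ n) / (n : ℝ)) atTop atTop →
      ∀ᶠ n : ℕ in atTop,
        c * max (res d (j₁ n)) (res d (j₂ n)) ^ (-(α + β) / (d : ℝ)) ≤
          |bias P (B.psiIF (j₁ n) (j₂ n) : Sample d 3 n → ℝ)| ∧
        c * (res d (j₁ n) * res d (j₂ n) / (n : ℝ) ^ 3) ≤
          var P (B.psiIF (j₁ n) (j₂ n) : Sample d 3 n → ℝ)) := by
  -- Positive regularity puts the constants into every `V_j`.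
  have hS : 0 < S := by
    rcases Nat.eq_zero_or_pos S with h | h
    · subst h
      simp only [Nat.cast_zero] at hαS
      linarith
    · exact h
  have hαβ : 0 < α + β := add_pos hα hβ
  obtain ⟨P, hP, p, hp, b, hb, hpr, hbr, ⟨δ, hδ, hAδ, hYδ⟩, c, hc, hgap⟩ :=
    B.exists_least_favourable hS hd hα hβ hC hmodel
  have hV := B.varC_pos d C₁ C₂
  have hD := B.diagC_pos
  have hB := biasC_nonneg (d := d) (M := M) hαβ
  set V := 4 * B.varC d C₁ C₂
  -- One constant dominates both the bias and the variance bounds.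
  set K := biasC d M (α + β) + V
  have hK0 : 0 < K := by positivity
  have hle : ∀ p ∈ B.holderBall d α M, ∀ b ∈ B.holderBall d β M, ∀ j ≥ B.J₀,
      |B.gap j p b| ≤ K * res d j ^ (-(α + β) / (d : ℝ)) := fun p hp b hb j hj => by
    refine (B.abs_gap_le hS hM.le hαβ hp hb hj).trans ?_
    rw [res_rpow hd]
    have := pow_nonneg (Real.rpow_pos_of_pos two_pos (-(α + β))).le j
    gcongr
    linarith
  have hge : ∀ j ≥ B.J₀, c * res d j ^ (-(α + β) / (d : ℝ)) ≤ |B.gap j p b| := fun j hj => by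
    rw [res_rpow hd]
    exact hgap j hj
  have hVK : V ≤ K := le_add_of_nonneg_left hB
  refine ⟨fun P hP n hn j₁ h₁ j₂ h₂ => ⟨memLp_psiINT hP hn h₁ h₂, memLp_psiMC hP j₁ j₂,
    memLp_psiIF hP hn j₁ j₂⟩, ?_, ?_, ?_, ?_, ?_⟩
  · refine ⟨c, hc, K, hK0, fun n hn j₁ h₁ j₂ h₂ => ⟨le_worstBias hP ?_,
      worstBias_le fun Q hQ => ?_, worstVar_le fun Q hQ => ⟨memLp_psiINT hQ hn h₁ h₂, ?_⟩⟩⟩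
    · rw [bias_psiINT hP hp hpr hb hbr hn h₁ h₂, ← res_min]
      exact hge _ (le_min h₁ h₂)
    · obtain ⟨-, -, ⟨p', hp', hpr'⟩, b', hb', hbr'⟩ := id hQ
      rw [bias_psiINT hQ hp' hpr' hb' hbr' hn h₁ h₂, ← res_min]
      exact hle _ hp' _ hb' _ (le_min h₁ h₂)
    · refine (variance_psiINT_le hQ hn h₁ h₂).trans (mul_le_mul_of_nonneg_right hVK ?_)
      rw [← res_min]
      have := res_pos d (min j₁ j₂)
      positivity
  · refine ⟨c, hc, K, hK0, fun n hn j₁ h₁ j₂ h₂ => ⟨le_worstBias hP ?_,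
      worstBias_le fun Q hQ => ?_, worstVar_le fun Q hQ => ⟨memLp_psiMC hQ j₁ j₂, ?_⟩⟩⟩
    · rw [bias_psiMC hP hp hpr hb hbr hn h₁ h₂, ← res_min]
      exact hge _ (le_min h₁ h₂)
    · obtain ⟨-, -, ⟨p', hp', hpr'⟩, b', hb', hbr'⟩ := id hQ
      rw [bias_psiMC hQ hp' hpr' hb' hbr' hn h₁ h₂, ← res_min]
      exact hle _ hp' _ hb' _ (le_min h₁ h₂)
    · refine (variance_psiMC_le hQ hn j₁ j₂).trans (mul_le_mul_of_nonneg_right hVK ?_)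
      have := res_pos d j₁
      have := res_pos d j₂
      positivity
  · refine ⟨P, hP, min c ((δ ^ 2 * B.diagC ^ d) ^ 2 / 2), by positivity,
      fun j₁ j₂ h₁ h₂ ht₁ ht₂ => ?_⟩
    -- For Monte Carlo only the product of the resolutions must be large, hence the vacuous choice
    -- `e = 0`, `s = 1`.
    filter_upwards [eventually_large_res ht₁ ht₂ (a := (δ ^ 2 * B.diagC ^ d) ^ 2)
      (b := 6 * (radius C₁ C₂ ^ 2 * B.massC d * B.massC d) ^ 2) (e := 0) (s := 1) (by positivity)
      one_pos] with n ⟨hn, hk, _, _⟩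
    have k₁ := res_pos d (j₁ n)
    have k₂ := res_pos d (j₂ n)
    constructor
    · rw [bias_psiMC hP hp hpr hb hbr hn (h₁ n) (h₂ n), ← res_min]
      refine le_trans (mul_le_mul_of_nonneg_right (min_le_left _ _) ?_)
        (hge _ (le_min (h₁ n) (h₂ n)))
      exact Real.rpow_nonneg (res_pos d _).le _
    · exact le_trans (mul_le_mul_of_nonneg_right (min_le_right _ _) (by positivity))
        (le_variance_psiMC hS hP hδ hAδ hYδ hn (h₁ n) (h₂ n) hk)
  · refine ⟨c, hc, K, hK0, fun n hn j₁ h₁ j₂ h₂ => ⟨le_worstBias hP ?_,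
      worstBias_le fun Q hQ => ?_, worstVar_le fun Q hQ => ⟨memLp_psiIF hQ hn j₁ j₂, ?_⟩⟩⟩
    · rw [bias_psiIF hP hp hpr hb hbr hn h₁ h₂, ← res_max]
      exact hge _ (le_max_of_le_left h₁)
    · obtain ⟨-, -, ⟨p', hp', hpr'⟩, b', hb', hbr'⟩ := id hQ
      rw [bias_psiIF hQ hp' hpr' hb' hbr' hn h₁ h₂, ← res_max]
      exact hle _ hp' _ hb' _ (le_max_of_le_left h₁)
    · refine (variance_psiIF_le hQ hn j₁ j₂).trans (mul_le_mul_of_nonneg_right hVK ?_)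
      have := res_pos d j₁
      have := res_pos d j₂
      positivity
  · refine ⟨P, hP, min c ((δ ^ 2 * B.diagC ^ d / 4) ^ 2 / 2), by positivity,
      fun j₁ j₂ h₁ h₂ ht₁ ht₂ => ?_⟩
    -- Here each resolution must also be large by itself, so that the kernel terms outweigh the
    -- observations they are subtracted from.
    filter_upwards [eventually_large_res ht₁ ht₂ (a := (δ ^ 2 * B.diagC ^ d / 4) ^ 2)
      (b := 6 * (radius C₁ C₂ ^ 2 * B.massC d * B.massC d) ^ 2) (e := 4 * radius C₁ C₂ ^ 2)
      (s := δ ^ 2 * B.diagC ^ d) (by positivity) (by positivity)] with n ⟨hn, hk, hk₁, hk₂⟩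
    have k₁ := res_pos d (j₁ n)
    have k₂ := res_pos d (j₂ n)
    constructor
    · rw [bias_psiIF hP hp hpr hb hbr hn (h₁ n) (h₂ n), ← res_max]
      refine le_trans (mul_le_mul_of_nonneg_right (min_le_left _ _) ?_)
        (hge _ (le_max_of_le_left (h₁ n)))
      exact Real.rpow_nonneg (res_pos d _).le _
    · exact le_trans (mul_le_mul_of_nonneg_right (min_le_right _ _) (by positivity))
        (le_variance_psiIF hS hP hδ hAδ hYδ hn (h₁ n) (h₂ n) hk₁ hk₂ hk)
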